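/- Let $X$ be a finite set with $\#X\ge 3$ and let $F(X)$ be the free group on $X$. An $X$-digraph is a directed graph (loops and multiple edges allowed) whose edges are labelled by elements of $X$. It is connected if any two vertices are joined by a path that may cross edges in either direction (crossing an $x$-edge backwards reads $x^{-1}$). It is folded if no two distinct edges with the same label have the same initial vertex or the same terminal vertex, and cyclically reduced if no vertex has degree one (a loop contributes two to the degree). A map of $X$-digraphs preserves orientation and labels, and is an immersion if it is injective on the link of every vertex. A finite, connected, folded, cyclically reduced $X$-digraph $S$ represents the conjugacy class of $H\le F(X)$ if, for some vertex $p$ of $S$, the reduced words that label loops at $p$ are exactly those representing the elements of some conjugate of $H$. For $\phi\in\mathrm{Aut}\,F(X)$, the automorphic image $\phi(S)$ is obtained from $S$ by replacing every $x$-edge by a path labelled by the reduced word of $\phi(x)$, for all $x\in X$, then folding until no fold is possible, then deleting leaves until none remains. $S$ is minimal if it has the least number of edges among its automorphic images, and $\min(S)$ is the set of minimal automorphic images of $S$ (up to isomorphism). For a partition $X=A\sqcup B$, an $X$-digraph $T$ satisfies Property $(S)$ with respect to $(A,B)$ if $T$ is connected and cyclically reduced, the subgraph spanned by the $A$-edges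 is a bouquet of single-edge loops (it has exactly one vertex), and the subgraph spanned by the $B$-edges is a finite connected graph of rank one. **Lemma.** Let $S$ be a finite, connected, folded, cyclically reduced $X$-digraph that represents the conjugacy class of a subgroup contained in no proper free factor of $F(X)$. Let $X=A\sqcup B$ be a partition, and suppose that $S$ admits an immersion onto an $X$-digraph satisfying Property $(S)$ with respect to $(A,B)$. If $S$ is not minimal, then some element of $\min(S)$ also admits an immersion onto an $X$-digraph satisfying Property $(S)$ with respect to the same partition $(A,B)$. -/

import Mathlib

universe u v

/-- An `X`-digraph: a directed graph (loops and multiple edges allowed) with edges labelled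
by elements of `X`. -/
structure XDigraph (X : Type u) where
  V : Type v
  E : Type v
  src : E → V
  tgt : E → V
  label : E → X

namespace XDigraph

variable {X : Type u}

/-- The edges that leave `x`. -/
def outLink (S : XDigraph.{u, v} X) (x : S.V) : Set S.E := {e | S.src e = x}

/-- The edges that arrive at `x`. -/
def inLink (S : XDigraph.{u, v} X) (x : S.V) : Set S.E := {e | S.tgt e = x}

/-- A leaf is a vertex of degree one; an edge is counted once for each of its ends at the vertex,
so a loop contributes two to the degree. -/
def IsLeaf (S : XDigraph.{u, v} X) (x : S.V) : Prop :=
  (S.outLink x).encard + (S.inLink x).encard = 1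

/-- No vertex is a leaf. -/
def IsCyclicallyReduced (S : XDigraph.{u, v} X) : Prop := ∀ x : S.V, ¬ S.IsLeaf x

/-- No two distinct coinitial edges, and no two distinct coterminal edges, share a label. -/
def IsFolded (S : XDigraph.{u, v} X) : Prop :=
  (∀ e f : S.E, S.src e = S.src f → S.label e = S.label f → e = f) ∧
  (∀ e f : S.E, S.tgt e = S.tgt f → S.label e = S.label f → e = f)

/-- `S.IsPath x w y`: some path from `x` to `y`, which may cross edges in both directions, has
label `w`. A letter is `(a, true)` for `a` and `(a, false)` for `a⁻¹`, as in `FreeGroup`. -/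
inductive IsPath (S : XDigraph.{u, v} X) : S.V → List (X × Bool) → S.V → Prop
  | nil (x : S.V) : IsPath S x [] x
  | forward (e : S.E) {w : List (X × Bool)} {y : S.V} :
      IsPath S (S.tgt e) w y → IsPath S (S.src e) ((S.label e, true) :: w) y
  | backward (e : S.E) {w : List (X × Bool)} {y : S.V} :
      IsPath S (S.src e) w y → IsPath S (S.tgt e) ((S.label e, false) :: w) y

/-- Any two vertices are joined by a path. -/
def IsConnected (S : XDigraph.{u, v} X) : Prop :=
  ∀ x y : S.V, ∃ w : List (X × Bool), S.IsPath x w y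

/-- A map of `X`-digraphs, preserving orientation and labels. -/
structure Hom (S T : XDigraph.{u, v} X) where
  onV : S.V → T.V
  onE : S.E → T.E
  src_onE : ∀ e, T.src (onE e) = onV (S.src e)
  tgt_onE : ∀ e, T.tgt (onE e) = onV (S.tgt e)
  label_onE : ∀ e, T.label (onE e) = S.label e

/-- Injective on the link of every vertex. The two ends of a loop are distinct
elements of the link, so outgoing and incoming edges are treated separately. -/
def Hom.IsImmersion {S T : XDigraph.{u, v} X} (f : Hom S T) : Prop :=
  ∀ x : S.V, Set.InjOn f.onE (S.outLink x) ∧ Set.InjOn f.onE (S.inLink x)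

/-- `S` admits an immersion onto `T`. -/
def ImmersesOnto (S T : XDigraph.{u, v} X) : Prop :=
  ∃ f : Hom S T, f.IsImmersion ∧ Function.Surjective f.onV ∧ Function.Surjective f.onE

/-- `S` and `T` are isomorphic `X`-digraphs. -/
def Isomorphic (S T : XDigraph.{u, v} X) : Prop :=
  ∃ f : Hom S T, Function.Bijective f.onV ∧ Function.Bijective f.onE

/-! ### Subgroups represented by a digraph -/

/-- `(S, x)` is a Stallings graph of `H`: the reduced words that represent elements of `H` are
exactly the reduced words that label a loop at `x`. (A path with reduced label is immersed.) -/
def IsStallingsGraph [DecidableEq X] (S : XDigraph.{u, v} X) (x : S.V)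
    (H : Subgroup (FreeGroup X)) : Prop :=
  ∀ g : FreeGroup X, g ∈ H ↔ S.IsPath x g.toWord x

/-- `S` represents the conjugacy class of `H`: for some choice of basepoint it is the Stallings
graph of a conjugate of `H`. -/
def Represents [DecidableEq X] (S : XDigraph.{u, v} X) (H : Subgroup (FreeGroup X)) : Prop :=
  ∃ (x : S.V) (g : FreeGroup X), S.IsStallingsGraph x (H.map (MulAut.conj g).toMonoidHom)

/-! ### The image of a digraph under an automorphism -/

/-- The reduced word of `φ a`. -/
def imageWord [DecidableEq X] (φ : FreeGroup X ≃* FreeGroup X) (a : X) : List (X × Bool) :=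
  (φ (FreeGroup.of a)).toWord

/-- The vertices of the subdivided graph: those of `S`, and the interior points `(e, i)` of the
path that replaces the edge `e`. -/
abbrev SubdivV [DecidableEq X] (φ : FreeGroup X ≃* FreeGroup X) (S : XDigraph.{u, v} X) :
    Type v :=
  S.V ⊕ {p : S.E × ℕ // 0 < p.2 ∧ p.2 < (imageWord φ (S.label p.1)).length}

/-- The `i`-th vertex on the path that replaces `e`. -/
def subdivPoint [DecidableEq X] (φ : FreeGroup X ≃* FreeGroup X) (S : XDigraph.{u, v} X)
    (e : S.E) (i : ℕ) : SubdivV φ S :=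
  if h₀ : 0 < i then
    if h₁ : i < (imageWord φ (S.label e)).length then Sum.inr ⟨(e, i), h₀, h₁⟩
    else Sum.inl (S.tgt e)
  else Sum.inl (S.src e)

/-- Subdivide every edge with label `a` into a path and relabel that path by `φ a`.
A letter `y⁻¹` of `φ a` gives a `y`-edge that points backwards along the path. -/
def subdivide [DecidableEq X] (φ : FreeGroup X ≃* FreeGroup X) (S : XDigraph.{u, v} X) :
    XDigraph.{u, v} X where
  V := SubdivV φ S
  E := Σ e : S.E, Fin (imageWord φ (S.label e)).length
  src := fun p => if ((imageWord φ (S.label p.1)).get p.2).2 then subdivPoint φ S p.1 p.2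
    else subdivPoint φ S p.1 (p.2 + 1)
  tgt := fun p => if ((imageWord φ (S.label p.1)).get p.2).2 then subdivPoint φ S p.1 (p.2 + 1)
    else subdivPoint φ S p.1 p.2
  label := fun p => ((imageWord φ (S.label p.1)).get p.2).1

/-- The identifications of vertices made by performing all possible folds. -/
inductive FoldRel (S : XDigraph.{u, v} X) : S.V → S.V → Prop
  | refl (x : S.V) : FoldRel S x x
  | symm {x y : S.V} : FoldRel S x y → FoldRel S y x
  | trans {x y z : S.V} : FoldRel S x y → FoldRel S y z → FoldRel S x z
  | out (e f : S.E) : S.label e = S.label f → FoldRel S (S.src e) (S.src f) →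
      FoldRel S (S.tgt e) (S.tgt f)
  | into (e f : S.E) : S.label e = S.label f → FoldRel S (S.tgt e) (S.tgt f) →
      FoldRel S (S.src e) (S.src f)

/-- The vertices of the folded graph are the classes of this relation. -/
def foldSetoidV (S : XDigraph.{u, v} X) : Setoid S.V where
  r := FoldRel S
  iseqv := ⟨FoldRel.refl, FoldRel.symm, FoldRel.trans⟩

/-- Two edges become equal in the folded graph if they have the same label and their initial
vertices (hence also their terminal vertices) are identified. -/
def foldSetoidE (S : XDigraph.{u, v} X) : Setoid S.E where
  r := fun e f => S.label e = S.label f ∧ FoldRel S (S.src e) (S.src f)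
  iseqv := ⟨fun _ => ⟨rfl, FoldRel.refl _⟩, fun h => ⟨h.1.symm, h.2.symm⟩,
    fun h h' => ⟨h.1.trans h'.1, h.2.trans h'.2⟩⟩

/-- The folded graph that results from performing folds until none remains. -/
def fold (S : XDigraph.{u, v} X) : XDigraph.{u, v} X where
  V := Quotient S.foldSetoidV
  E := Quotient S.foldSetoidE
  src := Quotient.map' S.src fun _ _ h => h.2
  tgt := Quotient.map' S.tgt fun e f h => FoldRel.out e f h.1 h.2
  label := Quotient.lift S.label fun _ _ h => h.1

/-- The subgraph induced on a set of vertices. -/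
def induce (S : XDigraph.{u, v} X) (W : Set S.V) : XDigraph.{u, v} X where
  V := W
  E := {e : S.E // S.src e ∈ W ∧ S.tgt e ∈ W}
  src := fun e => ⟨S.src e, e.2.1⟩
  tgt := fun e => ⟨S.tgt e, e.2.2⟩
  label := fun e => S.label e

/-- `S.LeafDeletion W`: the subgraph induced on `W` arises from `S` by deleting leaves, one at a
time, each with the unique edge incident to it. -/
inductive LeafDeletion (S : XDigraph.{u, v} X) : Set S.V → Prop
  | start : LeafDeletion S Set.univ
  | delete {W : Set S.V} (x : W) :
      LeafDeletion S W → (S.induce W).IsLeaf x → LeafDeletion S (W \ {x.1})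

/-- `T` is (up to isomorphism) the graph `φ(S)`: subdivide and relabel `S` by `φ`, fold, and delete
leaves until none remains. -/
def IsImage [DecidableEq X] (φ : FreeGroup X ≃* FreeGroup X) (S T : XDigraph.{u, v} X) : Prop :=
  ∃ W : Set (fold (subdivide φ S)).V, (fold (subdivide φ S)).LeafDeletion W ∧
    ((fold (subdivide φ S)).induce W).IsCyclicallyReduced ∧
    T.Isomorphic ((fold (subdivide φ S)).induce W)

/-- The number of edges of `S` is minimal among all its automorphic images. -/
def IsMinimal [DecidableEq X] (S : XDigraph.{u, v} X) : Prop :=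
  ∀ (φ : FreeGroup X ≃* FreeGroup X) (T : XDigraph.{u, v} X),
    IsImage φ S T → Nat.card S.E ≤ Nat.card T.E

/-- The minimal automorphic images of `S`. -/
def minSet [DecidableEq X] (S : XDigraph.{u, v} X) : Set (XDigraph.{u, v} X) :=
  {T | (∃ φ : FreeGroup X ≃* FreeGroup X, IsImage φ S T) ∧ T.IsMinimal}

/-! ### Property (S) -/

/-- The subgraph spanned by the `Y`-edges: all `Y`-edges and all vertices incident to one. -/
def spanned (S : XDigraph.{u, v} X) (Y : Set X) : XDigraph.{u, v} X where
  V := {x : S.V // ∃ e : S.E, S.label e ∈ Y ∧ (S.src e = x ∨ S.tgt e = x)}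
  E := {e : S.E // S.label e ∈ Y}
  src := fun e => ⟨S.src e, e, e.2, Or.inl rfl⟩
  tgt := fun e => ⟨S.tgt e, e, e.2, Or.inr rfl⟩
  label := fun e => S.label e

/-- A bouquet of single-edge loops: there is exactly one vertex, so every edge is a loop. -/
def IsBouquet (S : XDigraph.{u, v} X) : Prop := Nonempty S.V ∧ Subsingleton S.V

/-- A finite non-empty connected graph of rank `#E - #V + 1 = 1`. -/
def IsRankOne (S : XDigraph.{u, v} X) : Prop :=
  Finite S.V ∧ Finite S.E ∧ Nonempty S.V ∧ S.IsConnected ∧ Nat.card S.E = Nat.card S.V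

/-- `T` satisfies property (S), with the partition `X = A ⊔ B`. -/
structure PropertyS (T : XDigraph.{u, v} X) (A B : Set X) : Prop where
  isConnected : T.IsConnected
  isCyclicallyReduced : T.IsCyclicallyReduced
  isCompl : IsCompl A B
  bouquet : (T.spanned A).IsBouquet
  rankOne : (T.spanned B).IsRankOne

end XDigraph

/-- A proper free factor: generated by a proper subset of some basis of the free group. -/
def IsProperFreeFactor {X : Type u} (K : Subgroup (FreeGroup X)) : Prop :=
  ∃ (ι : Type u) (b : FreeGroupBasis ι (FreeGroup X)) (J : Set ι),
    J ≠ Set.univ ∧ K = Subgroup.closure (b '' J)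

/-! The number of edges of an image of `S` depends on `H` alone. Vertices of a Stallings graph
correspond to left cosets of the subgroup, and a vertex has an edge reading the letter `l` exactly
when its coset is split by the cylinder of `l`, that is, meets both the cylinder and its complement
in infinitely many points (`IsMarking.splitCosets_eq`). So the image under `φ` has `totalSplit (φ
H)` edges (`IsMarking.card_image_eq`).

Split counts are submodular in the splitting set, and invariant under complements, translations and
finite changes. This yields Whitehead's theorem by uncrossing. Call `H` locally minimal if no cut of
the letters that separates `a` from `a⁻¹` splits fewer cosets than the cylinder of `a`; a Whitehead
automorphism replaces one cylinder by the cone of such a cut and keeps the other counts. Uncrossing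
extends the inequality from cones to all almost invariant sets with odd boundary in the direction
`a` (`LocallyMinimal.le_splitCount`). For an automorphism these parities form an invertible matrix
over `ZMod 2`; a nonzero term of its determinant matches the generators with the preimages of the
cylinders, and summation gives global minimality (`LocallyMinimal.totalSplit_le`).

An immersion onto a graph with property (S) puts a conjugate of `H` into `⟨A, g⟩` with `g` in the
free group on `B`. Conversely, if `φ H` lies in `⟨A, w⟩` for a cyclically reduced non-empty word `w`
over `B`, then the image of `S` immerses into the rose with petals `A` and one further petal reading
`w`; the immersion is onto because every label occurs, as `H` lies in no proper free factor. So it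
suffices to find a minimal position of this form (`exists_minimal_le_range_augment`).

Choose `w` as short as possible, and then a subgroup `J` of the free group on `A` and one additional
letter, with image a position of `H` having as few edges as possible. Substituting `w` for the
additional letter subdivides edges, so the count of a cone is a count for `J` plus a count of turns
of `w` (`IsBlowup.splitCount_map`). The choice of `w` controls the turns. The choice of `J` controls
the Whitehead moves that fix the additional letter, since these extend to the large free group. A
cut that separates both a generator in `A` and the additional letter is not covered by such moves;
there one letter is dropped from the cut, and the loss is paid for by a turn inside `w`
(`turnCount_turns_ne_zero`). Hence the position is locally minimal, and therefore minimal. -/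

open scoped Pointwise

/-! ### Cosets that are split by a set -/

section SplitCount

variable {G : Type*} [Group G]

/-- The left cosets of `H` that meet both `D` and its complement in infinitely many points. -/
def splitCosets (H : Subgroup G) (D : Set G) : Set (Set G) :=
  {C | (∃ g : G, C = g • (H : Set G)) ∧ (C ∩ D).Infinite ∧ (C \ D).Infinite}

/-- The number of left cosets of `H` that are split by `D`. -/
noncomputable def splitCount (H : Subgroup G) (D : Set G) : ℕ∞ := (splitCosets H D).encard

theorem splitCount_compl (H : Subgroup G) (D : Set G) : splitCount H Dᶜ = splitCount H D := by
  unfold splitCount splitCosets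
  congr 1
  ext C
  simp only [Set.mem_ofPred_eq, Set.sdiff_eq, compl_compl]
  tauto

/-- Submodularity is checked coset by coset: a coset split by one of `D ∩ E` and `D ∪ E` is split by
`D` or by `E`, and a coset split by both is split by both `D` and `E`. -/
theorem splitCount_inter_add_union_le (H : Subgroup G) (D E : Set G) :
    splitCount H (D ∩ E) + splitCount H (D ∪ E) ≤ splitCount H D + splitCount H E := by
  unfold splitCount
  rw [← Set.encard_union_add_encard_inter (splitCosets H (D ∩ E)),
    ← Set.encard_union_add_encard_inter (splitCosets H D)]
  have key : ∀ C : Set G, (C \ (D ∩ E)).Infinite → (C \ D).Infinite ∨ (C \ E).Infinite := by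
    intro C h
    rw [Set.sdiff_inter] at h
    exact Set.infinite_union.mp h
  have key' : ∀ C : Set G, (C ∩ (D ∪ E)).Infinite → (C ∩ D).Infinite ∨ (C ∩ E).Infinite := by
    intro C h
    rw [Set.inter_union_distrib_left] at h
    exact Set.infinite_union.mp h
  refine add_le_add (Set.encard_le_encard ?_) (Set.encard_le_encard ?_)
  · rintro C (⟨h, h1, h2⟩ | ⟨h, h1, h2⟩)
    · have a : (C ∩ D).Infinite := h1.mono fun x hx => ⟨hx.1, hx.2.1⟩
      have b : (C ∩ E).Infinite := h1.mono fun x hx => ⟨hx.1, hx.2.2⟩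
      rcases key C h2 with h3 | h3
      · exact Or.inl ⟨h, a, h3⟩
      · exact Or.inr ⟨h, b, h3⟩
    · have a : (C \ D).Infinite := h2.mono fun x hx => ⟨hx.1, fun h => hx.2 (Or.inl h)⟩
      have b : (C \ E).Infinite := h2.mono fun x hx => ⟨hx.1, fun h => hx.2 (Or.inr h)⟩
      rcases key' C h1 with h3 | h3
      · exact Or.inl ⟨h, h3, a⟩
      · exact Or.inr ⟨h, h3, b⟩
  · rintro C ⟨⟨h, h1, -⟩, -, -, h2⟩
    exact ⟨⟨h, h1.mono fun x hx => ⟨hx.1, hx.2.1⟩,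
        h2.mono fun x hx => ⟨hx.1, fun h => hx.2 (Or.inl h)⟩⟩,
      ⟨h, h1.mono fun x hx => ⟨hx.1, hx.2.2⟩,
        h2.mono fun x hx => ⟨hx.1, fun h => hx.2 (Or.inr h)⟩⟩⟩

theorem splitCount_diff_add_diff_le (H : Subgroup G) (D E : Set G) :
    splitCount H (D \ E) + splitCount H (E \ D) ≤ splitCount H D + splitCount H E := by
  have h := splitCount_inter_add_union_le H D Eᶜ
  rw [splitCount_compl H E, ← splitCount_compl H (D ∪ Eᶜ), Set.compl_union, compl_compl,
    Set.inter_comm Dᶜ] at h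
  exact h

theorem splitCount_diff_le (H : Subgroup G) (D E : Set G) :
    splitCount H (D \ E) ≤ splitCount H D + splitCount H E :=
  le_trans le_self_add (splitCount_diff_add_diff_le H D E)

/-- Sets that differ by a finite set split the same cosets. -/
theorem splitCount_congr (H : Subgroup G) {D E : Set G} (h : (D \ E).Finite) (h' : (E \ D).Finite) :
    splitCount H D = splitCount H E := by
  have key : ∀ {D E : Set G} (_ : (D \ E).Finite) (_ : (E \ D).Finite),
      splitCosets H D ⊆ splitCosets H E := by
    rintro D E h h' C ⟨hC, h1, h2⟩
    refine ⟨hC, fun h3 => h1 ((h3.union h).subset ?_), fun h3 => h2 ((h3.union h').subset ?_)⟩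
    · rintro x ⟨hx, hx'⟩
      by_cases hE : x ∈ E
      · exact Or.inl ⟨hx, hE⟩
      · exact Or.inr ⟨hx', hE⟩
    · rintro x ⟨hx, hx'⟩
      by_cases hE : x ∈ E
      · exact Or.inr ⟨hE, hx'⟩
      · exact Or.inl ⟨hx, hE⟩
  unfold splitCount
  rw [(key h h').antisymm (key h' h)]

theorem splitCount_map {G' : Type*} [Group G'] (φ : G ≃* G') (H : Subgroup G) (D : Set G) :
    splitCount (H.map φ.toMonoidHom) (φ '' D) = splitCount H D := by
  unfold splitCount
  rw [← (Set.image_injective.mpr φ.injective).encard_image (splitCosets H D)]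
  congr 1
  have hcos : ∀ g : G, φ '' (g • (H : Set G)) = φ g • ((H.map φ.toMonoidHom : Subgroup G') : Set G') := by
    intro g
    rw [Subgroup.coe_map]
    ext y
    simp [Set.mem_smul_set]
  ext C
  constructor
  · rintro ⟨⟨g, rfl⟩, h1, h2⟩
    obtain ⟨g, rfl⟩ := φ.surjective g
    rw [← hcos] at h1 h2 ⊢
    refine ⟨_, ⟨⟨g, rfl⟩, ?_, ?_⟩, rfl⟩
    · rw [← Set.image_inter φ.injective] at h1
      exact h1.of_image
    · rw [← Set.image_sdiff φ.injective] at h2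
      exact h2.of_image
  · rintro ⟨C, ⟨⟨g, rfl⟩, h1, h2⟩, rfl⟩
    refine ⟨⟨φ g, hcos g⟩, ?_, ?_⟩
    · rw [← Set.image_inter φ.injective]
      exact h1.image φ.injective.injOn
    · rw [← Set.image_sdiff φ.injective]
      exact h2.image φ.injective.injOn

theorem splitCount_smul (H : Subgroup G) (g : G) (D : Set G) :
    splitCount H (g • D) = splitCount H D := by
  unfold splitCount
  rw [← (MulAction.injective (β := Set G) g).encard_image (splitCosets H D)]
  congr 1
  ext C
  constructor
  · rintro ⟨⟨k, rfl⟩, h1, h2⟩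
    refine ⟨(g⁻¹ * k) • (H : Set G), ⟨⟨_, rfl⟩, ?_, ?_⟩, by simp [smul_smul]⟩
    · have : k • (H : Set G) ∩ g • D = g • ((g⁻¹ * k) • (H : Set G) ∩ D) := by
        rw [Set.smul_set_inter, smul_smul, mul_inv_cancel_left]
      rw [this] at h1
      exact h1.of_image
    · have : k • (H : Set G) \ g • D = g • ((g⁻¹ * k) • (H : Set G) \ D) := by
        rw [Set.smul_set_sdiff, smul_smul, mul_inv_cancel_left]
      rw [this] at h2
      exact h2.of_image
  · rintro ⟨C, ⟨⟨k, rfl⟩, h1, h2⟩, rfl⟩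
    refine ⟨⟨g * k, by simp [smul_smul]⟩, ?_, ?_⟩
    · simp only
      rw [← Set.smul_set_inter]
      exact h1.smul_set
    · simp only
      rw [← Set.smul_set_sdiff]
      exact h2.smul_set

end SplitCount

/-! ### Parity of the boundary of a set -/

section Parity

variable {G : Type*} [Group G]

/-- The points of `G` at which membership in `E` changes under right multiplication by `a`. -/
def rightBoundary (E : Set G) (a : G) : Set G := {g | ¬ (g ∈ E ↔ g * a ∈ E)}

/-- The set `E` changes by a finite set under every right multiplication. -/
def AlmostInvariant (E : Set G) : Prop := ∀ a : G, (rightBoundary E a).Finite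

/-- The parity of the boundary of `E` in the direction of `a`. -/
noncomputable def boundaryParity (E : Set G) (a : G) : ZMod 2 := ((rightBoundary E a).ncard : ZMod 2)

theorem ncard_symmDiff_zmod_two {α : Type*} {s t : Set α} (hs : s.Finite) (ht : t.Finite) :
    ((symmDiff s t).ncard : ZMod 2) = s.ncard + t.ncard := by
  have h1 : (symmDiff s t).ncard = (s \ t).ncard + (t \ s).ncard := by
    rw [Set.symmDiff_def, Set.ncard_union_eq _ hs.sdiff ht.sdiff]
    exact Set.disjoint_left.mpr fun x hx hx' => hx.2 hx'.1
  have h2 := Set.ncard_inter_add_ncard_sdiff_eq_ncard s t hs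
  have h3 := Set.ncard_inter_add_ncard_sdiff_eq_ncard t s ht
  rw [Set.inter_comm] at h3
  rw [h1, ← h2, ← h3]
  push_cast
  have : ((s ∩ t).ncard : ZMod 2) + (s ∩ t).ncard = 0 := CharTwo.add_self_eq_zero _
  linear_combination -this

theorem AlmostInvariant.compl {E : Set G} (h : AlmostInvariant E) : AlmostInvariant Eᶜ := by
  intro a
  refine (h a).subset fun g hg => ?_
  simp only [rightBoundary, Set.mem_compl_iff, Set.mem_ofPred_eq] at hg ⊢
  tauto

theorem AlmostInvariant.inter {D E : Set G} (h : AlmostInvariant D) (h' : AlmostInvariant E) :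
    AlmostInvariant (D ∩ E) := by
  intro a
  refine ((h a).union (h' a)).subset fun g hg => ?_
  simp only [rightBoundary, Set.mem_inter_iff, Set.mem_union, Set.mem_ofPred_eq] at hg ⊢
  tauto

theorem AlmostInvariant.diff {D E : Set G} (h : AlmostInvariant D) (h' : AlmostInvariant E) :
    AlmostInvariant (D \ E) := h.inter h'.compl

theorem rightBoundary_smul (g : G) (E : Set G) (a : G) :
    rightBoundary (g • E) a = g • rightBoundary E a := by
  ext x
  simp [rightBoundary, Set.mem_smul_set_iff_inv_smul_mem, mul_assoc]

theorem AlmostInvariant.smul {E : Set G} (h : AlmostInvariant E) (g : G) :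
    AlmostInvariant (g • E) := fun a => by
  rw [rightBoundary_smul]
  exact (h a).smul_set

theorem boundaryParity_smul (g : G) (E : Set G) (a : G) :
    boundaryParity (g • E) a = boundaryParity E a := by
  rw [boundaryParity, rightBoundary_smul, Set.ncard_smul_set, boundaryParity]

theorem boundaryParity_compl (E : Set G) (a : G) :
    boundaryParity Eᶜ a = boundaryParity E a := by
  unfold boundaryParity
  congr 2
  ext g
  simp only [rightBoundary, Set.mem_compl_iff, Set.mem_ofPred_eq]
  tauto

/-- Additivity along a partition. -/
theorem boundaryParity_eq_inter_add_diff {D E : Set G} (h : AlmostInvariant D)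
    (h' : AlmostInvariant E) (a : G) :
    boundaryParity E a = boundaryParity (D ∩ E) a + boundaryParity (E \ D) a := by
  unfold boundaryParity
  rw [← ncard_symmDiff_zmod_two ((h.inter h') a) ((h'.diff h) a)]
  congr 2
  ext g
  simp only [rightBoundary, Set.mem_symmDiff, Set.mem_inter_iff, Set.mem_sdiff, Set.mem_ofPred_eq]
  tauto

/-- Membership changes from `g` to `g * a * b` iff it changes in exactly one of the two steps, so
the boundary is a symmetric difference. The parity is thus a homomorphism to `ZMod 2`, which factors
through the abelianization modulo two. -/
theorem boundaryParity_mul {E : Set G} (h : AlmostInvariant E) (a b : G) :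
    boundaryParity E (a * b) = boundaryParity E a + boundaryParity E b := by
  have hb : ((rightBoundary E b).image (· * a⁻¹)).ncard = (rightBoundary E b).ncard :=
    Set.ncard_image_of_injective _ (mul_left_injective _)
  unfold boundaryParity
  rw [← hb, ← ncard_symmDiff_zmod_two (h a) ((h b).image _)]
  congr 2
  ext g
  simp only [rightBoundary, Set.mem_symmDiff, Set.mem_image, Set.mem_ofPred_eq]
  have : (∃ x, ¬ (x ∈ E ↔ x * b ∈ E) ∧ x * a⁻¹ = g) ↔ ¬ (g * a ∈ E ↔ g * (a * b) ∈ E) := by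
    constructor
    · rintro ⟨x, hx, rfl⟩
      simpa [mul_assoc] using hx
    · intro hx
      exact ⟨g * a, by simpa [mul_assoc] using hx, by simp⟩
  rw [this]
  tauto

theorem AlmostInvariant.finite_boundary_mul {E : Set G} {a b : G} (h : (rightBoundary E a).Finite)
    (h' : (rightBoundary E b).Finite) : (rightBoundary E (a * b)).Finite := by
  refine (h.union (h'.image (· * a⁻¹))).subset fun g hg => ?_
  simp only [rightBoundary, Set.mem_union, Set.mem_image, Set.mem_ofPred_eq] at hg ⊢
  by_cases h1 : g ∈ E ↔ g * a ∈ E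
  · refine Or.inr ⟨g * a, ?_, by simp⟩
    rwa [h1, ← mul_assoc] at hg
  · exact Or.inl h1

theorem AlmostInvariant.finite_boundary_inv {E : Set G} {a : G} (h : (rightBoundary E a).Finite) :
    (rightBoundary E a⁻¹).Finite := by
  refine (h.image (· * a)).subset fun g hg => ?_
  simp only [rightBoundary, Set.mem_image, Set.mem_ofPred_eq] at hg ⊢
  refine ⟨g * a⁻¹, ?_, by simp⟩
  rw [inv_mul_cancel_right]
  tauto

theorem AlmostInvariant.image {G' : Type*} [Group G'] (φ : G ≃* G') {E : Set G}
    (h : AlmostInvariant E) : AlmostInvariant (φ '' E) := by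
  intro a
  obtain ⟨a, rfl⟩ := φ.surjective a
  refine ((h a).image φ).subset fun g hg => ?_
  obtain ⟨g, rfl⟩ := φ.surjective g
  refine ⟨g, ?_, rfl⟩
  have hmem : ∀ x, φ x ∈ φ '' E ↔ x ∈ E := fun x => φ.injective.mem_set_image
  simpa only [rightBoundary, Set.mem_ofPred_eq, ← map_mul, hmem] using hg

theorem boundaryParity_image {G' : Type*} [Group G'] (φ : G ≃* G') (E : Set G) (a : G) :
    boundaryParity (φ '' E) (φ a) = boundaryParity E a := by
  unfold boundaryParity
  rw [← Set.ncard_image_of_injective (rightBoundary E a) φ.injective]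
  congr 2
  have hmem : ∀ x, φ x ∈ φ '' E ↔ x ∈ E := fun x => φ.injective.mem_set_image
  ext g
  obtain ⟨g, rfl⟩ := φ.surjective g
  rw [φ.injective.mem_set_image]
  simp only [rightBoundary, Set.mem_ofPred_eq, ← map_mul, hmem]

theorem AlmostInvariant.singleton (x : G) : AlmostInvariant ({x} : Set G) := by
  intro a
  refine (Set.toFinite ({x, x * a⁻¹} : Set G)).subset fun g hg => ?_
  simp only [rightBoundary, Set.mem_ofPred_eq, Set.mem_singleton_iff] at hg
  by_cases h : g = x
  · exact Or.inl h
  · refine Or.inr ?_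
    simp only [h, false_iff, not_not] at hg
    rw [Set.mem_singleton_iff, ← hg, mul_inv_cancel_right]

/-- For `a ≠ 1` the boundary consists of the two points `x` and `x * a⁻¹`. Hence adding or removing
a point does not affect the parity of an almost invariant set. -/
theorem boundaryParity_singleton (x a : G) : boundaryParity ({x} : Set G) a = 0 := by
  by_cases ha : a = 1
  · have : rightBoundary ({x} : Set G) a = ∅ := by ext; simp [rightBoundary, ha]
    simp [boundaryParity, this]
  · have : rightBoundary ({x} : Set G) a = {x, x * a⁻¹} := by
      ext g
      simp only [rightBoundary, Set.mem_ofPred_eq, Set.mem_singleton_iff, Set.mem_insert_iff]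
      have : g * a = x ↔ g = x * a⁻¹ := eq_mul_inv_iff_mul_eq.symm
      rw [this]
      have : x ≠ x * a⁻¹ := by simpa [eq_comm] using ha
      by_cases h : g = x
      · subst h; simpa using this
      · simp [h]
    rw [boundaryParity, this, Set.ncard_pair (by simpa [eq_comm] using ha)]
    rfl

/-- Conjugate subgroups have the same number of cosets split by an almost invariant set. -/
theorem splitCount_conj {E : Set G} (h : AlmostInvariant E) (H : Subgroup G) (g : G) :
    splitCount (H.map (MulAut.conj g).toMonoidHom) E = splitCount H E := by
  have h1 := splitCount_map (MulAut.conj g) H (MulAut.conj g ⁻¹' E)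
  rw [Set.image_preimage_eq _ (MulAut.conj g).surjective] at h1
  rw [show H.map (MulAut.conj g).toMonoidHom = H.map (MulEquiv.toMonoidHom (MulAut.conj g)) from rfl, h1,
    ← splitCount_smul H g]
  -- The translated preimage consists of the `x` with `x * g⁻¹ ∈ E`, so it differs from `E` only on
  -- the boundary for `g⁻¹`.
  refine splitCount_congr H ?_ ?_
  · refine (h g⁻¹).subset fun x hx => ?_
    simp only [Set.mem_sdiff, Set.mem_smul_set_iff_inv_smul_mem, Set.mem_preimage, MulAut.conj_apply,
      smul_eq_mul, mul_inv_cancel_left, rightBoundary, Set.mem_ofPred_eq] at hx ⊢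
    tauto
  · refine (h g⁻¹).subset fun x hx => ?_
    simp only [Set.mem_sdiff, Set.mem_smul_set_iff_inv_smul_mem, Set.mem_preimage, MulAut.conj_apply,
      smul_eq_mul, mul_inv_cancel_left, rightBoundary, Set.mem_ofPred_eq] at hx ⊢
    tauto

end Parity

/-! ### Cylinders in a free group -/

namespace FreeGroup

variable {α : Type*}

/-- The inverse of a letter. -/
def bar (l : α × Bool) : α × Bool := (l.1, !l.2)

@[simp] theorem bar_bar (l : α × Bool) : bar (bar l) = l := by simp [bar]

@[simp] theorem bar_fst (l : α × Bool) : (bar l).1 = l.1 := rfl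

theorem bar_ne (l : α × Bool) : bar l ≠ l := fun h => by
  have := congrArg Prod.snd h
  simp [bar] at this

theorem eq_or_eq_bar_of_fst_eq {l m : α × Bool} (h : l.1 = m.1) : l = m ∨ l = bar m := by
  obtain ⟨a, b⟩ := l
  obtain ⟨c, d⟩ := m
  simp only at h
  subst h
  cases b <;> cases d <;> simp [bar]

theorem isReduced_cons_cons_iff_ne_bar {a b : α × Bool} {L : List (α × Bool)} :
    IsReduced (a :: b :: L) ↔ b ≠ bar a ∧ IsReduced (b :: L) := by
  rw [isReduced_cons_cons]
  refine and_congr_left fun _ => ?_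
  obtain ⟨a, s⟩ := a
  obtain ⟨b, t⟩ := b
  simp only [bar, ne_eq, Prod.mk.injEq, not_and, @eq_comm _ b a]
  cases s <;> cases t <;> simp

/-- The group element of a letter. -/
def ltr (l : α × Bool) : FreeGroup α := mk [l]

theorem ltr_true (a : α) : ltr (a, true) = of a := rfl

theorem ltr_bar (l : α × Bool) : ltr (bar l) = (ltr l)⁻¹ := by
  simp [ltr, bar, inv_mk, invRev]

theorem ltr_false (a : α) : ltr (a, false) = (of a)⁻¹ := ltr_bar (a, true)

theorem mk_cons (l : α × Bool) (L : List (α × Bool)) : mk (l :: L) = ltr l * mk L := by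
  simp [ltr, mul_mk]

variable [DecidableEq α]

@[simp] theorem toWord_ltr (l : α × Bool) : (ltr l).toWord = [l] := by simp [ltr]

theorem ltr_ne_one (l : α × Bool) : ltr l ≠ 1 := fun h => by
  have := congrArg toWord h
  simp at this

/-- The elements whose reduced word starts with the letter `l`. -/
def cyl (l : α × Bool) : Set (FreeGroup α) := {g | g.toWord.head? = some l}

/-- The elements whose reduced word starts with a letter in `Z`. -/
def cone (Z : Set (α × Bool)) : Set (FreeGroup α) := {g | ∃ l ∈ Z, g.toWord.head? = some l}

theorem mem_cyl {l : α × Bool} {g : FreeGroup α} : g ∈ cyl l ↔ g.toWord.head? = some l := Iff.rfl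

theorem mem_cone {Z : Set (α × Bool)} {g : FreeGroup α} :
    g ∈ cone Z ↔ ∃ l ∈ Z, g ∈ cyl l := Iff.rfl

theorem cone_singleton (l : α × Bool) : cone {l} = cyl l := by ext; simp [cone, cyl]

@[simp] theorem cone_empty : cone (∅ : Set (α × Bool)) = ∅ := by ext; simp [cone]

theorem cone_union (Z W : Set (α × Bool)) : cone (Z ∪ W) = cone Z ∪ cone W := by
  ext g
  simp only [mem_cone, Set.mem_union, or_and_right, exists_or]

theorem one_notMem_cyl (l : α × Bool) : (1 : FreeGroup α) ∉ cyl l := by simp [cyl]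

theorem one_notMem_cone (Z : Set (α × Bool)) : (1 : FreeGroup α) ∉ cone Z := by simp [cone]

theorem eq_of_mem_cyl {l m : α × Bool} {g : FreeGroup α} (h : g ∈ cyl l) (h' : g ∈ cyl m) :
    l = m := Option.some_injective _ (h.symm.trans h')

theorem eq_one_or_exists_mem_cyl (g : FreeGroup α) : g = 1 ∨ ∃ l, g ∈ cyl l := by
  cases h : g.toWord with
  | nil => exact Or.inl (toWord_eq_nil_iff.mp h)
  | cons l L => exact Or.inr ⟨l, by simp [cyl, h]⟩

theorem mem_cone_iff_of_mem_cyl {Z : Set (α × Bool)} {l : α × Bool} {g : FreeGroup α}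
    (h : g ∈ cyl l) : g ∈ cone Z ↔ l ∈ Z :=
  ⟨fun ⟨_, hm, h'⟩ => eq_of_mem_cyl h h' ▸ hm, fun hl => ⟨l, hl, h⟩⟩

theorem ltr_mem_cyl (l : α × Bool) : ltr l ∈ cyl l := by simp [cyl]

theorem cone_diff (Z W : Set (α × Bool)) : cone (Z \ W) = cone Z \ cone W := by
  ext g
  rcases eq_one_or_exists_mem_cyl g with rfl | ⟨l, hl⟩
  · simp [one_notMem_cone]
  · simp [mem_cone_iff_of_mem_cyl hl]

/-- Complements of sets of letters give complements of cones, up to the identity. -/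
theorem cone_compl (Z : Set (α × Bool)) : cone Zᶜ = (cone Z)ᶜ \ {1} := by
  ext g
  rcases eq_one_or_exists_mem_cyl g with rfl | ⟨l, hl⟩
  · simp [one_notMem_cone]
  · have : g ≠ 1 := fun h => one_notMem_cyl l (h ▸ hl)
    simp [mem_cone_iff_of_mem_cyl hl, this]

theorem splitCount_cone_compl (H : Subgroup (FreeGroup α)) (Z : Set (α × Bool)) :
    splitCount H (cone Zᶜ) = splitCount H (cone Z) := by
  rw [cone_compl, ← splitCount_compl H (cone Z)]
  exact splitCount_congr H (by simp [Set.sdiff_eq, Set.inter_right_comm])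
    ((Set.finite_singleton 1).subset (by simp))

/-- Products of reduced words without cancellation. -/
theorem toWord_mul_of_getLast {g h : FreeGroup α}
    (hgh : ∀ l, g.toWord.getLast? = some l → h ∉ cyl (bar l)) :
    (g * h).toWord = g.toWord ++ h.toWord := by
  rw [toWord_mul]
  refine IsReduced.reduce_eq ?_
  refine List.IsChain.append isReduced_toWord isReduced_toWord ?_
  intro x hx y hy hxy
  by_contra hne
  refine hgh x hx ?_
  rw [mem_cyl]
  rw [Option.mem_def] at hy
  rw [hy]
  obtain ⟨x, s⟩ := x
  obtain ⟨y, t⟩ := y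
  simp only at hxy hne
  subst hxy
  cases s <;> cases t <;> simp_all [bar]

theorem toWord_ltr_mul {l : α × Bool} {g : FreeGroup α} (h : g ∉ cyl (bar l)) :
    (ltr l * g).toWord = l :: g.toWord := by
  rw [toWord_mul_of_getLast (by simpa using h), toWord_ltr]
  rfl

/-- If `g` starts with the inverse of `l`, cancellation exposes its second letter, which is not `l`
because the word is reduced. -/
theorem ltr_mul_mem_cyl_iff {l : α × Bool} {g : FreeGroup α} :
    ltr l * g ∈ cyl l ↔ g ∉ cyl (bar l) := by
  refine ⟨fun h h' => ?_, fun h => by simp [cyl, toWord_ltr_mul h]⟩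
  cases hw : g.toWord with
  | nil => simp [cyl, hw] at h'
  | cons m L =>
    rw [mem_cyl, hw, List.head?_cons, Option.some_inj] at h'
    subst h'
    have hred : IsReduced (bar l :: L) := hw ▸ isReduced_toWord
    have hg : g = ltr (bar l) * mk L := by rw [← mk_cons, ← hw, mk_toWord]
    have hL : (mk L).toWord = L := by
      rw [toWord_mk]
      exact IsReduced.reduce_eq (hred.infix (List.suffix_cons _ _).isInfix)
    rw [hg, ltr_bar, mul_inv_cancel_left, mem_cyl, hL] at h
    cases L with
    | nil => simp at h
    | cons n L =>
      rw [List.head?_cons, Option.some_inj] at h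
      subst h
      exact (isReduced_cons_cons_iff_ne_bar.mp hred).1 (bar_bar _).symm

theorem mem_cyl_iff_inv_mul {l : α × Bool} {g : FreeGroup α} :
    g ∈ cyl l ↔ (ltr l)⁻¹ * g ∉ cyl (bar l) := by
  rw [← ltr_mul_mem_cyl_iff, mul_inv_cancel_left]

theorem cyl_eq_smul (l : α × Bool) : cyl l = ltr l • (cyl (bar l))ᶜ := by
  ext g
  rw [Set.mem_smul_set_iff_inv_smul_mem, smul_eq_mul, Set.mem_compl_iff, mem_cyl_iff_inv_mul]

theorem splitCount_cyl_bar (H : Subgroup (FreeGroup α)) (l : α × Bool) :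
    splitCount H (cyl (bar l)) = splitCount H (cyl l) := by
  rw [cyl_eq_smul l, splitCount_smul, splitCount_compl]

theorem splitCount_cyl_of_fst_eq (H : Subgroup (FreeGroup α)) {l m : α × Bool} (h : l.1 = m.1) :
    splitCount H (cyl l) = splitCount H (cyl m) := by
  rcases eq_or_eq_bar_of_fst_eq h with rfl | rfl
  · rfl
  · exact splitCount_cyl_bar H m

/-- Induction on reduced words. -/
theorem ltr_mul_induction {p : FreeGroup α → Prop} (one : p 1)
    (mul : ∀ l g, g ∉ cyl (bar l) → p g → p (ltr l * g)) (g : FreeGroup α) : p g := by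
  obtain ⟨w, hw⟩ : ∃ w, g.toWord = w := ⟨_, rfl⟩
  induction w generalizing g with
  | nil => rwa [toWord_eq_nil_iff.mp hw]
  | cons l L ih =>
    have hg : g = ltr l * mk L := by rw [← mk_cons, ← hw, mk_toWord]
    have hL : (mk L).toWord = L := by
      rw [toWord_mk]
      have hred : IsReduced (l :: L) := hw ▸ isReduced_toWord
      exact IsReduced.reduce_eq (hred.infix (List.suffix_cons _ _).isInfix)
    rw [hg]
    refine mul l _ ?_ (ih _ hL)
    rw [← ltr_mul_mem_cyl_iff, ← hg, mem_cyl, hw]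
    rfl

/-- Right multiplication by a letter alters only the end of the reduced word. If the letter cancels,
the argument is applied to `g * ltr m` and the inverse letter, where nothing cancels. -/
theorem mul_ltr_mem_cyl_iff {l m : α × Bool} {g : FreeGroup α} (h1 : g ≠ 1) (h2 : g * ltr m ≠ 1) :
    g * ltr m ∈ cyl l ↔ g ∈ cyl l := by
  have key : ∀ {g : FreeGroup α} {m : α × Bool}, g ≠ 1 → g.toWord.getLast? ≠ some (bar m) →
      (g * ltr m ∈ cyl l ↔ g ∈ cyl l) := by
    intro g m h1 h
    have h3 : (g * ltr m).toWord = g.toWord ++ (ltr m).toWord := by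
      refine toWord_mul_of_getLast fun k hk hm => h ?_
      rw [hk, eq_of_mem_cyl (ltr_mem_cyl m) hm, bar_bar]
    have h4 : g.toWord ≠ [] := fun h => h1 (toWord_eq_nil_iff.mp h)
    rw [mem_cyl, mem_cyl, h3, List.head?_append_of_ne_nil _ h4]
  by_cases h : g.toWord.getLast? = some (bar m)
  · have h3 : (g * ltr m).toWord.getLast? ≠ some (bar (bar m)) := by
      intro h'
      rw [bar_bar] at h'
      have e1 := List.dropLast_append_getLast? _ h
      have e2 := List.dropLast_append_getLast? _ h'
      set L1 := g.toWord.dropLast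
      set L2 := (g * ltr m).toWord.dropLast
      have hr1 : IsReduced L1 := (isReduced_toWord (x := g)).infix (List.dropLast_prefix _).isInfix
      have hr2 : IsReduced L2 :=
        (isReduced_toWord (x := g * ltr m)).infix (List.dropLast_prefix _).isInfix
      have g1 : g = mk L1 * ltr (bar m) := by rw [ltr, mul_mk, e1, mk_toWord]
      have g2 : g * ltr m = mk L2 * ltr m := by
        conv_rhs => rw [ltr, mul_mk, e2, mk_toWord]
      rw [mul_left_inj] at g2
      have g3 : g.toWord = L2 := by rw [g2, toWord_mk, hr2.reduce_eq]
      have hr : IsReduced (L1 ++ [bar m] ++ [m]) := by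
        rw [e1, g3, e2]; exact isReduced_toWord
      have : IsReduced [bar m, m] := hr.infix ⟨L1, [], by simp⟩
      exact (isReduced_cons_cons_iff_ne_bar.mp this).1 (bar_bar m).symm
    have := key h2 h3
    rw [ltr_bar, mul_inv_cancel_right] at this
    exact this.symm
  · exact key h1 h

theorem mul_ltr_mem_cone_iff {Z : Set (α × Bool)} {m : α × Bool} {g : FreeGroup α} (h1 : g ≠ 1)
    (h2 : g * ltr m ≠ 1) : g * ltr m ∈ cone Z ↔ g ∈ cone Z := by
  simp only [mem_cone, mul_ltr_mem_cyl_iff h1 h2]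

theorem almostInvariant_of_generators {E : Set (FreeGroup α)}
    (h : ∀ a, (rightBoundary E (of a)).Finite) : AlmostInvariant E := by
  intro g
  induction g using FreeGroup.induction_on with
  | C1 => convert Set.finite_empty (α := FreeGroup α); ext; simp [rightBoundary]
  | of a => exact h a
  | inv_of a h => exact AlmostInvariant.finite_boundary_inv h
  | mul g k hg hk => exact AlmostInvariant.finite_boundary_mul hg hk

theorem almostInvariant_cone (Z : Set (α × Bool)) : AlmostInvariant (cone Z) := by
  refine almostInvariant_of_generators fun a => ?_
  refine (Set.toFinite ({1, (of a)⁻¹} : Set (FreeGroup α))).subset fun g hg => ?_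
  by_contra h
  rw [Set.mem_insert_iff, Set.mem_singleton_iff, not_or] at h
  exact hg (mul_ltr_mem_cone_iff (m := (a, true)) h.1
    (fun h' => h.2 (eq_inv_of_mul_eq_one_left h'))).symm

theorem almostInvariant_cyl (l : α × Bool) : AlmostInvariant (cyl l) :=
  cone_singleton l ▸ almostInvariant_cone _

-- Only the two edges at the identity contribute: the one from `1` to `a` and the one from `a⁻¹` to
-- `1`.
open Classical in
theorem boundaryParity_cone (Z : Set (α × Bool)) (a : α) :
    boundaryParity (cone Z) (of a) =
      (if (a, true) ∈ Z then 1 else 0) + (if (a, false) ∈ Z then 1 else 0) := by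
  have h1 : (1 : FreeGroup α) ∈ rightBoundary (cone Z) (of a) ↔ (a, true) ∈ Z := by
    have := mem_cone_iff_of_mem_cyl (Z := Z) (ltr_mem_cyl (a, true))
    rw [ltr_true] at this
    simp [rightBoundary, one_notMem_cone, this]
  have h2 : (of a : FreeGroup α)⁻¹ ∈ rightBoundary (cone Z) (of a) ↔ (a, false) ∈ Z := by
    have := mem_cone_iff_of_mem_cyl (Z := Z) (ltr_mem_cyl (a, false))
    rw [ltr_false] at this
    simp [rightBoundary, one_notMem_cone, this]
  have h3 : ∀ g ∈ rightBoundary (cone Z) (of a), g = 1 ∨ g = (of a)⁻¹ := by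
    intro g hg
    by_contra h
    rw [not_or] at h
    exact hg (mul_ltr_mem_cone_iff (m := (a, true)) h.1
      (fun h' => h.2 (eq_inv_of_mul_eq_one_left h'))).symm
  have hne : (1 : FreeGroup α) ≠ (of a)⁻¹ := by simp [eq_comm]
  unfold boundaryParity
  by_cases c1 : (a, true) ∈ Z <;> by_cases c2 : (a, false) ∈ Z
  · have : rightBoundary (cone Z) (of a) = {1, (of a)⁻¹} := by
      ext g; constructor
      · exact h3 g
      · rintro (rfl | rfl)
        · exact h1.mpr c1
        · exact h2.mpr c2
    rw [this, Set.ncard_pair hne, if_pos c1, if_pos c2]; rfl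
  · have : rightBoundary (cone Z) (of a) = {1} := by
      ext g; constructor
      · intro hg
        rcases h3 g hg with rfl | rfl
        · rfl
        · exact absurd (h2.mp hg) c2
      · rintro rfl
        exact h1.mpr c1
    rw [this, Set.ncard_singleton, if_pos c1, if_neg c2]; rfl
  · have : rightBoundary (cone Z) (of a) = {(of a)⁻¹} := by
      ext g; constructor
      · intro hg
        rcases h3 g hg with rfl | rfl
        · exact absurd (h1.mp hg) c1
        · rfl
      · rintro rfl
        exact h2.mpr c2
    rw [this, Set.ncard_singleton, if_neg c1, if_pos c2]; rfl
  · have : rightBoundary (cone Z) (of a) = ∅ := by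
      refine Set.eq_empty_of_forall_notMem fun g hg => ?_
      rcases h3 g hg with rfl | rfl
      · exact c1 (h1.mp hg)
      · exact c2 (h2.mp hg)
    rw [this, Set.ncard_empty, if_neg c1, if_neg c2]; rfl

/-- The set of letters `Z` separates the two ends of the generator `a`. -/
def Separates (Z : Set (α × Bool)) (a : α) : Prop := ¬ ((a, true) ∈ Z ↔ (a, false) ∈ Z)

theorem separates_iff_boundaryParity {Z : Set (α × Bool)} {a : α} :
    Separates Z a ↔ boundaryParity (cone Z) (of a) = 1 := by
  classical
  rw [boundaryParity_cone, Separates]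
  by_cases c1 : (a, true) ∈ Z <;> by_cases c2 : (a, false) ∈ Z <;> simp [c1, c2]

theorem separates_iff_letter {Z : Set (α × Bool)} (l : α × Bool) :
    Separates Z l.1 ↔ ¬ (l ∈ Z ↔ bar l ∈ Z) := by
  obtain ⟨a, b⟩ := l
  cases b <;> simp [Separates, bar] <;> tauto

/-- The number of translates of the half-spaces of the generators that split `H`, which is the
number of edges of the Stallings graph. -/
noncomputable def totalSplit [Fintype α] (H : Subgroup (FreeGroup α)) : ℕ∞ :=
  ∑ a, splitCount H (cyl (a, true))

end FreeGroup

/-! ### Local minimality implies global minimality -/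

namespace FreeGroup

variable {α : Type*} [DecidableEq α]

/-- The elements whose reduced word has the reduced word of `w` as a prefix. -/
def extensions (w : FreeGroup α) : Set (FreeGroup α) := {g | w.toWord <+: g.toWord}

theorem exists_toWord_eq_concat {w : FreeGroup α} (hw : w ≠ 1) :
    ∃ l, w.toWord.getLast? = some l := by
  cases h : w.toWord.getLast? with
  | none => exact absurd (toWord_eq_nil_iff.mp (List.getLast?_eq_none_iff.mp h)) hw
  | some l => exact ⟨l, rfl⟩

theorem mul_mem_extensions_iff {w g : FreeGroup α} {l : α × Bool}
    (hl : w.toWord.getLast? = some l) : w * g ∈ extensions w ↔ g ∉ cyl (bar l) := by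
  constructor
  · rintro ⟨s, hs⟩ hg
    have h1 : g = mk s := by
      have h := congrArg (fun t : List (α × Bool) => w⁻¹ * mk t) hs
      simp only [mk_toWord, ← mul_mk, inv_mul_cancel_left] at h
      exact h.symm
    have h2 : IsReduced (w.toWord ++ s) := hs ▸ isReduced_toWord
    have h3 : g.toWord = s := by
      rw [h1, toWord_mk]
      exact IsReduced.reduce_eq (h2.infix (List.suffix_append _ _).isInfix)
    rw [mem_cyl, h3] at hg
    obtain ⟨s, rfl⟩ : ∃ s', s = bar l :: s' := by
      cases s with
      | nil => simp at hg
      | cons m s => simp only [List.head?_cons, Option.some_inj] at hg; exact ⟨s, by rw [hg]⟩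
    rw [← List.dropLast_append_getLast? l hl] at h2
    have : IsReduced [l, bar l] := h2.infix ⟨w.toWord.dropLast, s, by simp⟩
    exact (isReduced_cons_cons_iff_ne_bar.mp this).1 rfl
  · intro hg
    refine ⟨g.toWord, (toWord_mul_of_getLast fun m hm => ?_).symm⟩
    rw [hl, Option.some_inj] at hm
    rwa [← hm]

/-- Seen from `w`, everything outside its extensions lies in the direction of the inverse of its
last letter. So this set splits as many cosets as the cylinder of that letter. -/
theorem compl_extensions_eq {w : FreeGroup α} {l : α × Bool} (hl : w.toWord.getLast? = some l) :
    (extensions w)ᶜ = w • cyl (bar l) := by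
  ext g
  rw [Set.mem_smul_set_iff_inv_smul_mem, smul_eq_mul, Set.mem_compl_iff, ← not_iff_not, not_not,
    ← mul_mem_extensions_iff hl, mul_inv_cancel_left]

/-- The prefixes `w` such that membership in `E` is not constant on the extensions of `w`. -/
def branchSet (E : Set (FreeGroup α)) : Set (FreeGroup α) :=
  {w | ∃ g ∈ extensions w, ¬ (g ∈ E ↔ w ∈ E)}

theorem self_mem_extensions (w : FreeGroup α) : w ∈ extensions w := List.prefix_refl _

theorem branchSet_prefix {E : Set (FreeGroup α)} {v w : FreeGroup α} (hw : w ∈ branchSet E)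
    (hv : w ∈ extensions v) : v ∈ branchSet E := by
  obtain ⟨g, hg, h⟩ := hw
  by_cases h1 : w ∈ E ↔ v ∈ E
  · exact ⟨g, hv.trans hg, by rwa [← h1]⟩
  · exact ⟨w, hv, h1⟩

theorem branchSet_compl (E : Set (FreeGroup α)) : branchSet Eᶜ = branchSet E := by
  ext w
  simp only [branchSet, Set.mem_ofPred_eq, Set.mem_compl_iff, not_iff_not]

theorem branchSet_diff_singleton {E : Set (FreeGroup α)} {w : FreeGroup α} (hw : w ∈ branchSet E) :
    branchSet (E \ {w}) ⊆ branchSet E := by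
  intro v hv
  by_contra hv'
  have h1 : w ∉ extensions v := fun h => hv' (branchSet_prefix hw h)
  obtain ⟨g, hg, h⟩ := hv
  refine hv' ⟨g, hg, ?_⟩
  have a : g ≠ w := fun e => h1 (e ▸ hg)
  have b : v ≠ w := fun e => h1 (e ▸ self_mem_extensions v)
  simpa [a, b] using h

/-- Cutting off the part of `E` beyond `w` removes `w` from the branch set. -/
theorem branchSet_diff_extensions {E : Set (FreeGroup α)} {w : FreeGroup α}
    (hw : w ∈ branchSet E) : branchSet (E \ extensions w) ⊆ branchSet E \ {w} := by
  intro v hv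
  obtain ⟨g, hg, h⟩ := hv
  have hvw : v ∉ extensions w := by
    intro h'
    have : g ∈ extensions w := h'.trans hg
    simp [this, h'] at h
  refine ⟨?_, fun e => hvw (e ▸ self_mem_extensions v)⟩
  by_contra hv'
  refine hv' ⟨g, hg, ?_⟩
  have : g ∉ extensions w := by
    intro h'
    rcases List.prefix_or_prefix_of_prefix hg h' with h2 | h2
    · exact hv' (branchSet_prefix hw h2)
    · exact hvw h2
  simpa [this, hvw] using h

theorem branchSet_compl_extensions_diff {E : Set (FreeGroup α)} {w : FreeGroup α}
    (hw : w ∈ branchSet E) : branchSet ((extensions w)ᶜ \ E) ⊆ branchSet E \ {w} := by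
  have h : (extensions w)ᶜ \ E = Eᶜ \ extensions w := by
    ext; simp [and_comm]
  rw [h, ← branchSet_compl E]
  exact branchSet_diff_extensions (by rwa [branchSet_compl])

theorem finite_prefixes (g : FreeGroup α) : {w : FreeGroup α | g ∈ extensions w}.Finite := by
  refine Set.Finite.of_finite_image (f := toWord)
    ((List.finite_toSet (List.inits g.toWord)).subset ?_) toWord_injective.injOn
  rintro _ ⟨w, hw, rfl⟩
  exact (List.mem_inits _ _).mpr hw

/-- If membership in `E` is not constant beyond `w`, it changes along some edge that starts at an
extension of `w`. There are finitely many such edges in all, and each starting point has finitely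
many prefixes. -/
theorem finite_branchSet [Finite α] {E : Set (FreeGroup α)} (hE : AlmostInvariant E) :
    (branchSet E).Finite := by
  have hfin : (⋃ l : α × Bool, ⋃ g ∈ rightBoundary E (ltr l),
      {w : FreeGroup α | g ∈ extensions w}).Finite :=
    Set.finite_iUnion fun l => (hE _).biUnion fun g _ => finite_prefixes g
  refine hfin.subset fun w hw => ?_
  obtain ⟨g, hg, h⟩ := hw
  by_contra hno
  simp only [Set.mem_iUnion, not_exists, Set.mem_ofPred_eq] at hno
  refine h ?_
  clear h
  obtain ⟨s, hs⟩ := hg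
  induction s using List.reverseRecOn generalizing g with
  | nil => rw [List.append_nil] at hs; rw [toWord_injective hs]
  | append_singleton s l ih =>
    rw [← List.append_assoc] at hs
    have hred : IsReduced (w.toWord ++ s) :=
      (hs ▸ isReduced_toWord (x := g)).infix (List.prefix_append _ _).isInfix
    have h1 : (mk (w.toWord ++ s)).toWord = w.toWord ++ s := by rw [toWord_mk, hred.reduce_eq]
    have h2 : mk (w.toWord ++ s) * ltr l = g := by rw [ltr, mul_mk, hs, mk_toWord]
    have h3 := ih _ h1.symm
    have h4 := hno l (mk (w.toWord ++ s))
    simp only [rightBoundary, Set.mem_ofPred_eq, h2] at h4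
    rw [← h3]
    by_contra h5
    exact h4 (fun h => h5 h.symm) (by rw [extensions, Set.mem_ofPred_eq, h1]; exact List.prefix_append _ _)

/-- No cut of the letters that separates the ends of a generator beats that generator. -/
def LocallyMinimal (H : Subgroup (FreeGroup α)) : Prop :=
  ∀ (Z : Set (α × Bool)) (a : α), Separates Z a →
    splitCount H (cyl (a, true)) ≤ splitCount H (cone Z)

/-- Base case of the induction: membership is constant beyond each letter, so `E` is a cone up to
the identity, which affects neither split counts nor parities. -/
theorem LocallyMinimal.le_splitCount_of_branchSet_subset {H : Subgroup (FreeGroup α)}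
    (hH : LocallyMinimal H) {E : Set (FreeGroup α)} (hE : AlmostInvariant E)
    (hb : branchSet E ⊆ {1}) {a : α} (ha : boundaryParity E (of a) = 1) :
    splitCount H (cyl (a, true)) ≤ splitCount H E := by
  have h1 : E \ {1} = cone {l | ltr l ∈ E} := by
    ext g
    rcases eq_one_or_exists_mem_cyl g with rfl | ⟨l, hl⟩
    · simp [one_notMem_cone]
    · have h1 : g ≠ 1 := fun h => one_notMem_cyl l (h ▸ hl)
      have h2 : ltr l ∉ branchSet E := fun h => ltr_ne_one l (hb h)
      have h3 : g ∈ extensions (ltr l) := by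
        rw [mem_cyl] at hl
        simp only [extensions, toWord_ltr, Set.mem_ofPred_eq]
        cases h : g.toWord with
        | nil => simp [h] at hl
        | cons m L => simp only [h, List.head?_cons, Option.some_inj] at hl; simp [hl]
      have h4 : g ∈ E ↔ ltr l ∈ E := by
        by_contra h
        exact h2 ⟨g, h3, h⟩
      rw [mem_cone_iff_of_mem_cyl hl]
      simp [h1, h4]
  have h2 : splitCount H E = splitCount H (cone {l | ltr l ∈ E}) := by
    rw [← h1]
    exact splitCount_congr H ((Set.finite_singleton 1).subset (by simp)) (by simp)
  rw [h2]
  refine hH _ _ ?_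
  rw [separates_iff_boundaryParity, ← h1, ← ha, boundaryParity_eq_inter_add_diff
    (AlmostInvariant.singleton 1) hE]
  have : boundaryParity ({1} ∩ E) (of a) = 0 := by
    by_cases h : (1 : FreeGroup α) ∈ E
    · rw [Set.inter_eq_left.mpr (by simpa using h), boundaryParity_singleton]
    · rw [Set.singleton_inter_eq_empty.mpr h]
      simp [boundaryParity, rightBoundary]
  rw [this, zero_add]

theorem zmod_two_cases (x : ZMod 2) : x = 0 ∨ x = 1 := by
  revert x; decide

/-- The inductive step of `LocallyMinimal.le_splitCount`: beyond `w` the set `E` is a cone based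
at `w`, which does not contain `w` nor the direction of the last letter of `w`. -/
theorem LocallyMinimal.le_splitCount_step {H : Subgroup (FreeGroup α)} (hH : LocallyMinimal H)
    (hfin : ∀ a, splitCount H (cyl (a, true)) ≠ ⊤) {E : Set (FreeGroup α)}
    (hE : AlmostInvariant E) {w : FreeGroup α} {l : α × Bool} (hl : w.toWord.getLast? = some l)
    {Z : Set (α × Bool)} (hZ : E ∩ extensions w = w • cone Z) (hlZ : l ∉ Z) (hlZ' : bar l ∉ Z)
    (h1 : ∀ a, boundaryParity (E \ extensions w) (of a) = 1 →
      splitCount H (cyl (a, true)) ≤ splitCount H (E \ extensions w))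
    (h2 : ∀ a, boundaryParity ((extensions w)ᶜ \ E) (of a) = 1 →
      splitCount H (cyl (a, true)) ≤ splitCount H ((extensions w)ᶜ \ E))
    {a : α} (ha : boundaryParity E (of a) = 1) :
    splitCount H (cyl (a, true)) ≤ splitCount H E := by
  set U : Set (FreeGroup α) := (extensions w)ᶜ with hU
  have hUw : U = w • cyl (bar l) := compl_extensions_eq hl
  have hUai : AlmostInvariant U := hUw ▸ (almostInvariant_cyl _).smul w
  have hUn : splitCount H U = splitCount H (cyl (l.1, true)) := by
    rw [hUw, splitCount_smul]
    exact splitCount_cyl_of_fst_eq H rfl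
  have hdU : E \ U = w • cone Z := by rw [← hZ, hU, Set.sdiff_compl]
  have hEU : E \ extensions w = U ∩ E := by rw [hU, Set.sdiff_eq, Set.inter_comm]
  rw [hEU] at h1
  have hpar : ∀ b, boundaryParity E (of b) =
      boundaryParity (U ∩ E) (of b) + boundaryParity (cone Z) (of b) := by
    intro b
    rw [boundaryParity_eq_inter_add_diff hUai hE, hdU, boundaryParity_smul]
  have hunion : U ∪ E = w • cone (insert (bar l) Z) := by
    rw [← Set.union_sdiff_self, hdU, hUw, ← Set.smul_set_union, ← cone_singleton, ← cone_union,
      Set.singleton_union]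
  have hZl : ¬ Separates Z l.1 := by
    rw [separates_iff_letter]
    simp [hlZ, hlZ']
  have hsub := splitCount_inter_add_union_le H U E
  rw [hunion, splitCount_smul, hUn] at hsub
  -- `U ∪ E` is a translate of a cone that separates the last letter of `w`, so it splits at least
  -- as many cosets as `U`. Submodularity leaves the bound for `U ∩ E`.
  have hle : splitCount H (U ∩ E) ≤ splitCount H E := by
    have h3 : splitCount H (cyl (l.1, true)) ≤ splitCount H (cone (insert (bar l) Z)) := by
      refine hH _ _ ?_
      rw [separates_iff_letter]
      simp [hlZ, (bar_ne l).symm]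
    rw [add_comm] at hsub
    have h4 := (add_le_add_left h3 (splitCount H (U ∩ E))).trans hsub
    exact (ENat.add_le_add_iff_left (hfin _)).mp h4
  -- If `U ∩ E` is odd at `a`, then `h1` finishes. Otherwise the cone at `w` separates `a`, and the
  -- parity of `U ∩ E` at the last letter of `w` decides which pair of sets to compare.
  rcases zmod_two_cases (boundaryParity (U ∩ E) (of a)) with h | h
  · have hZa : Separates Z a := by
      rw [separates_iff_boundaryParity, ← ha, hpar, h, zero_add]
    rcases zmod_two_cases (boundaryParity (U ∩ E) (of l.1)) with h' | h'
    -- Now `U \ E` is odd at `l.1`, so it splits at least as many cosets as `U`. Uncrossing by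
    -- differences then bounds the count of the cone `E \ U` by that of `E`.
    · have h5 : splitCount H (cyl (l.1, true)) ≤ splitCount H (U \ E) := by
        refine h2 _ ?_
        have := boundaryParity_eq_inter_add_diff hE hUai (of l.1)
        rw [Set.inter_comm, h', zero_add, hUw, boundaryParity_smul, ← cone_singleton] at this
        rw [hUw, ← cone_singleton, ← this, ← separates_iff_boundaryParity, separates_iff_letter]
        simp [(bar_ne l).symm]
      have h6 := splitCount_diff_add_diff_le H U E
      rw [hdU, splitCount_smul, hUn] at h6
      have h7 := (add_le_add_left h5 (splitCount H (cone Z))).trans h6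
      exact (hH Z a hZa).trans ((ENat.add_le_add_iff_left (hfin _)).mp h7)
    -- Here `U ∩ E` accounts for `l.1` and `U ∪ E` for `a`: as `Z` does not separate `l.1`, the two
    -- generators differ, and adding `bar l` keeps `a` separated.
    · have hal : a ≠ l.1 := fun e => hZl (e ▸ hZa)
      have h8 : splitCount H (cyl (a, true)) ≤ splitCount H (cone (insert (bar l) Z)) := by
        refine hH _ _ ?_
        have e1 : (a, true) ≠ bar l := fun e => hal (by rw [← bar_fst l, ← e])
        have e2 : (a, false) ≠ bar l := fun e => hal (by rw [← bar_fst l, ← e])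
        simpa [Separates, e1, e2] using hZa
      have h9 := (add_le_add (h1 _ h') h8).trans hsub
      exact (ENat.add_le_add_iff_left (hfin _)).mp h9
  · exact (h1 a h).trans hle

/-- Induction on the size of the branch set. Beyond a longest branch point `w` the set is determined
by the directions at `w`; uncrossing it with the complement of the extensions of `w` produces sets
whose branch sets no longer contain `w`. -/
theorem LocallyMinimal.le_splitCount [Finite α] {H : Subgroup (FreeGroup α)}
    (hH : LocallyMinimal H) (hfin : ∀ a, splitCount H (cyl (a, true)) ≠ ⊤)
    {E : Set (FreeGroup α)} (hE : AlmostInvariant E) {a : α} (ha : boundaryParity E (of a) = 1) :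
    splitCount H (cyl (a, true)) ≤ splitCount H E := by
  obtain ⟨n, hn⟩ : ∃ n, (branchSet E).ncard = n := ⟨_, rfl⟩
  induction n using Nat.strong_induction_on generalizing E a with
  | _ n ih =>
  by_cases hb : branchSet E ⊆ {1}
  · exact hH.le_splitCount_of_branchSet_subset hE hb ha
  have hbf := finite_branchSet hE
  obtain ⟨w, hw, hmax⟩ := Set.exists_max_image (branchSet E) (fun w => w.toWord.length) hbf
    (Set.nonempty_iff_ne_empty.mpr fun h => hb (by simp [h]))
  have hw1 : w ≠ 1 := by
    rintro rfl
    refine hb fun v hv => ?_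
    have := hmax v hv
    rw [toWord_one, List.length_nil, Nat.le_zero, List.length_eq_zero_iff, toWord_eq_nil_iff] at this
    exact this
  obtain ⟨l, hl⟩ := exists_toWord_eq_concat hw1
  have step : ∀ {E' : Set (FreeGroup α)}, AlmostInvariant E' → branchSet E' ⊆ branchSet E \ {w} →
      ∀ a, boundaryParity E' (of a) = 1 → splitCount H (cyl (a, true)) ≤ splitCount H E' := by
    intro E' hE' hsub a ha
    refine ih _ ?_ hE' ha rfl
    rw [← hn]
    refine lt_of_le_of_lt (Set.ncard_le_ncard hsub hbf.sdiff) ?_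
    exact Set.ncard_sdiff_singleton_lt_of_mem hw hbf
  have hUai : AlmostInvariant (extensions w) := by
    have : AlmostInvariant (extensions w)ᶜ := compl_extensions_eq hl ▸ (almostInvariant_cyl _).smul w
    simpa using this.compl
  -- the case in which `E` avoids `w` and the direction of `l`
  have main : ∀ {D : Set (FreeGroup α)}, AlmostInvariant D → branchSet D ⊆ branchSet E →
      w ∉ D → w * ltr l ∉ D → boundaryParity D (of a) = 1 →
      splitCount H (cyl (a, true)) ≤ splitCount H D := by
    intro D hD hDE hwD hwlD hDa
    by_cases hwb : w ∈ branchSet D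
    swap
    · exact step hD (fun v hv => ⟨hDE hv, fun e => hwb (e ▸ hv)⟩) a hDa
    have hsub : branchSet D \ {w} ⊆ branchSet E \ {w} := fun v hv => ⟨hDE hv.1, hv.2⟩
    -- `Z` records the forward directions at `w` that belong to `D`. As `w` is a longest branch
    -- point, membership is constant beyond each of them.
    refine hH.le_splitCount_step hfin hD hl (Z := {m | m ≠ bar l ∧ w * ltr m ∈ D}) ?_ ?_ ?_
      (step (hD.diff hUai) ((branchSet_diff_extensions hwb).trans hsub))
      (step (hUai.compl.diff hD) ((branchSet_compl_extensions_diff hwb).trans hsub)) hDa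
    · ext g
      obtain ⟨g, rfl⟩ : ∃ g', g = w * g' := ⟨w⁻¹ * g, by simp⟩
      rw [Set.mem_smul_set_iff_inv_smul_mem, smul_eq_mul, inv_mul_cancel_left, Set.mem_inter_iff,
        mul_mem_extensions_iff hl]
      rcases eq_one_or_exists_mem_cyl g with rfl | ⟨m, hm⟩
      · simp [hwD, one_notMem_cone]
      rw [mem_cone_iff_of_mem_cyl hm, Set.mem_ofPred_eq]
      have hml : g ∉ cyl (bar l) ↔ m ≠ bar l :=
        not_congr ⟨fun h => eq_of_mem_cyl hm h, fun h => h ▸ hm⟩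
      rw [hml, and_comm]
      refine and_congr_right fun hne => ?_
      have e1 : (w * ltr m).toWord = w.toWord ++ [m] := by
        rw [toWord_mul_of_getLast, toWord_ltr]
        intro k hk h
        rw [hl, Option.some_inj] at hk
        exact hne (hk ▸ eq_of_mem_cyl (ltr_mem_cyl m) h)
      have e2 : (w * g).toWord = w.toWord ++ g.toWord := by
        refine toWord_mul_of_getLast fun k hk h => ?_
        rw [hl, Option.some_inj] at hk
        exact hne (hk ▸ eq_of_mem_cyl hm h)
      have h3 : w * ltr m ∉ branchSet D := by
        intro h
        have := hmax _ (hDE h)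
        simp [e1] at this
      by_contra h4
      refine h3 ⟨w * g, ?_, h4⟩
      rw [extensions, Set.mem_ofPred_eq, e1, e2, List.prefix_append_right_inj]
      rw [mem_cyl] at hm
      cases h : g.toWord with
      | nil => simp [h] at hm
      | cons k L => simp only [h, List.head?_cons, Option.some_inj] at hm; simp [hm]
    · exact fun h => hwlD h.2
    · exact fun h => h.1 rfl
  -- The point `w` itself may be removed, since a single point affects neither side.
  have main' : ∀ {D : Set (FreeGroup α)}, AlmostInvariant D → branchSet D = branchSet E →
      w * ltr l ∉ D → boundaryParity D (of a) = 1 →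
      splitCount H (cyl (a, true)) ≤ splitCount H D := by
    intro D hD hDE hwlD hDa
    have hs := AlmostInvariant.singleton w
    have h1 : splitCount H (D \ {w}) = splitCount H D :=
      splitCount_congr H (by simp) ((Set.finite_singleton w).subset (by simp))
    rw [← h1]
    refine main (hD.diff hs) (hDE ▸ branchSet_diff_singleton (hDE ▸ hw)) (by simp)
      (fun h => hwlD h.1) ?_
    rw [← hDa, boundaryParity_eq_inter_add_diff hs hD]
    have : boundaryParity ({w} ∩ D) (of a) = 0 := by
      by_cases h : w ∈ D
      · rw [Set.inter_eq_left.mpr (by simpa using h), boundaryParity_singleton]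
      · rw [Set.singleton_inter_eq_empty.mpr h]
        simp [boundaryParity, rightBoundary]
    rw [this, zero_add]
  -- One of `E` and its complement avoids `w * ltr l`, and the two have the same split count,
  -- parities and branch set.
  by_cases hwl : w * ltr l ∈ E
  · rw [← splitCount_compl H E]
    exact main' hE.compl (branchSet_compl E) (by simpa using hwl) (by rwa [boundaryParity_compl])
  · exact main' hE rfl hwl ha

end FreeGroup

/-! ### Global minimality -/

namespace FreeGroup

variable {α : Type*} [DecidableEq α]

/-- The parities of the cylinders are the coordinates on the abelianization modulo two. -/
theorem boundaryParity_cyl (a b : α) :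
    boundaryParity (cyl (a, true)) (of b) = if b = a then 1 else 0 := by
  classical
  rw [← cone_singleton, boundaryParity_cone]
  simp

/-- **Whitehead's theorem** for subgroups: a locally minimal subgroup has the least total split count in
its orbit under automorphisms. -/
theorem LocallyMinimal.totalSplit_le [Fintype α] {H : Subgroup (FreeGroup α)}
    (hH : LocallyMinimal H) (hfin : ∀ a, splitCount H (cyl (a, true)) ≠ ⊤)
    (φ : FreeGroup α ≃* FreeGroup α) : totalSplit H ≤ totalSplit (H.map φ.toMonoidHom) := by
  -- the mod 2 abelianization of an automorphism
  let M : (FreeGroup α ≃* FreeGroup α) → Matrix α α (ZMod 2) := fun ψ =>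
    Matrix.of fun y x => boundaryParity (cyl (y, true)) (ψ (of x))
  -- Both sides are homomorphisms in `g`, so it suffices to compare them on generators.
  have hlin : ∀ (y : α) (g : FreeGroup α) (ψ : FreeGroup α ≃* FreeGroup α),
      boundaryParity (cyl (y, true)) (ψ g) =
        ∑ x, M ψ y x * boundaryParity (cyl (x, true)) g := by
    intro y g ψ
    have hy := almostInvariant_cyl (y, true)
    let f : FreeGroup α →* Multiplicative (ZMod 2) :=
      { toFun := fun g => Multiplicative.ofAdd (boundaryParity (cyl (y, true)) (ψ g))
        map_one' := by simp [boundaryParity, rightBoundary]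
        map_mul' := fun g k => by rw [_root_.map_mul, boundaryParity_mul hy, ofAdd_add] }
    let f' : FreeGroup α →* Multiplicative (ZMod 2) :=
      { toFun := fun g => Multiplicative.ofAdd
          (∑ x, M ψ y x * boundaryParity (cyl (x, true)) g)
        map_one' := by simp [boundaryParity, rightBoundary]
        map_mul' := fun g k => by
          rw [← ofAdd_add, ← Finset.sum_add_distrib]
          simp only [boundaryParity_mul (almostInvariant_cyl _), mul_add] }
    have hff : f = f' := by
      refine FreeGroup.ext_hom _ _ fun a => ?_
      simp only [MonoidHom.coe_mk, OneHom.coe_mk, f, f', boundaryParity_cyl]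
      simp [M]
    exact Multiplicative.ofAdd.injective (DFunLike.congr_fun hff g)
  have hmul : M φ.symm * M φ = 1 := by
    ext y x
    have := hlin y (φ (of x)) φ.symm
    rw [MulEquiv.symm_apply_apply, boundaryParity_cyl] at this
    rw [Matrix.mul_apply, Matrix.one_apply]
    simp only [eq_comm (a := y)]
    exact this.symm
  have hdet : (M φ).det ≠ 0 := by
    intro h
    have := congrArg Matrix.det hmul
    rw [Matrix.det_mul, h, mul_zero, Matrix.det_one] at this
    exact zero_ne_one this
  -- A nonzero determinant has a nonzero term in its expansion.
  obtain ⟨σ, hσ⟩ : ∃ σ : Equiv.Perm α, ∀ x, M φ (σ x) x ≠ 0 := by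
    by_contra! h
    refine hdet ?_
    rw [Matrix.det_apply]
    refine Finset.sum_eq_zero fun σ _ => ?_
    obtain ⟨x, hx⟩ := h σ
    have : ∏ i, M φ (σ i) i = 0 := Finset.prod_eq_zero (Finset.mem_univ x) hx
    exact (congrArg _ this).trans (smul_zero _)
  -- The preimage under `φ` of the cylinder of `σ x` has odd boundary at `x`, by the choice of `σ`.
  have hle : ∀ x, splitCount H (cyl (x, true)) ≤
      splitCount (H.map φ.toMonoidHom) (cyl (σ x, true)) := by
    intro x
    have h1 := splitCount_map φ H (φ.symm '' cyl (σ x, true))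
    rw [← Set.image_comp] at h1
    simp only [MulEquiv.self_comp_symm, Set.image_id] at h1
    rw [h1]
    refine hH.le_splitCount hfin ((almostInvariant_cyl _).image φ.symm) ?_
    have h2 := boundaryParity_image φ.symm (cyl (σ x, true)) (φ (of x))
    rw [MulEquiv.symm_apply_apply] at h2
    rw [h2]
    exact (zmod_two_cases _).resolve_left (hσ x)
  unfold totalSplit
  rw [← Equiv.sum_comp σ fun y => splitCount (H.map φ.toMonoidHom) (cyl (y, true))]
  exact Finset.sum_le_sum fun x _ => hle x

end FreeGroup

/-! ### Whitehead automorphisms -/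

namespace FreeGroup

variable {α : Type*}

/-- The endomorphism that multiplies each generator on both sides by prescribed elements. -/
def twistHom (c : α × Bool → FreeGroup α) : FreeGroup α →* FreeGroup α :=
  lift fun a => c (a, true) * of a * (c (a, false))⁻¹

theorem twistHom_of (c : α × Bool → FreeGroup α) (a : α) :
    twistHom c (of a) = c (a, true) * of a * (c (a, false))⁻¹ := by simp [twistHom]

theorem twistHom_ltr (c : α × Bool → FreeGroup α) (l : α × Bool) :
    twistHom c (ltr l) = c l * ltr l * (c (bar l))⁻¹ := by
  obtain ⟨a, b⟩ := l
  cases b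
  · simp [ltr_false, twistHom_of, bar, mul_assoc]
  · simp [ltr_true, twistHom_of, bar]

/-- `twistHom` as an automorphism, when the multipliers are fixed. -/
def twistEquiv (c : α × Bool → FreeGroup α) (h : ∀ l, twistHom c (c l) = c l)
    (h' : ∀ l, twistHom (fun l => (c l)⁻¹) (c l) = c l) : FreeGroup α ≃* FreeGroup α :=
  MonoidHom.toMulEquiv (twistHom c) (twistHom fun l => (c l)⁻¹)
    (by
      refine FreeGroup.ext_hom _ _ fun a => ?_
      simp [twistHom_of, h', mul_assoc])
    (by
      refine FreeGroup.ext_hom _ _ fun a => ?_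
      simp [twistHom_of, h, mul_assoc])

theorem twistEquiv_apply (c : α × Bool → FreeGroup α) (h h') (g : FreeGroup α) :
    twistEquiv c h h' g = twistHom c g := rfl

variable [DecidableEq α]

open Classical in
/-- The multipliers of the Whitehead automorphism of the cut `Z` with multiplier `v`. -/
noncomputable def whiteheadMultiplier (Z : Set (α × Bool)) (v l : α × Bool) : FreeGroup α :=
  if l ∈ Z ∧ l.1 ≠ v.1 then (ltr v)⁻¹ else 1

theorem whiteheadMultiplier_of_mem {Z : Set (α × Bool)} {v l : α × Bool} (h : l ∈ Z)
    (h' : l.1 ≠ v.1) : whiteheadMultiplier Z v l = (ltr v)⁻¹ := by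
  simp [whiteheadMultiplier, h, h']

theorem whiteheadMultiplier_of_notMem {Z : Set (α × Bool)} {v l : α × Bool} (h : l ∉ Z) :
    whiteheadMultiplier Z v l = 1 := by
  simp [whiteheadMultiplier, h]

theorem whiteheadMultiplier_of_eq {Z : Set (α × Bool)} {v l : α × Bool} (h : l.1 = v.1) :
    whiteheadMultiplier Z v l = 1 := by
  simp [whiteheadMultiplier, h]

/-- The Whitehead automorphism of the cut `Z` with multiplier `v`. -/
noncomputable def whitehead (Z : Set (α × Bool)) (v : α × Bool) : FreeGroup α ≃* FreeGroup α :=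
  have key : ∀ c : α × Bool → FreeGroup α, (∀ l, l.1 = v.1 → c l = 1) →
      twistHom c (ltr v) = ltr v := fun c hc => by
    rw [twistHom_ltr, hc v rfl, hc (bar v) rfl]; simp
  twistEquiv (whiteheadMultiplier Z v)
    (fun l => by
      by_cases h : l ∈ Z ∧ l.1 ≠ v.1
      · rw [whiteheadMultiplier_of_mem h.1 h.2, _root_.map_inv,
          key _ fun l hl => whiteheadMultiplier_of_eq hl]
      · rw [whiteheadMultiplier, if_neg h, _root_.map_one])
    (fun l => by
      by_cases h : l ∈ Z ∧ l.1 ≠ v.1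
      · rw [whiteheadMultiplier_of_mem h.1 h.2, _root_.map_inv,
          key _ fun l hl => by rw [whiteheadMultiplier_of_eq hl, inv_one]]
      · rw [whiteheadMultiplier, if_neg h, _root_.map_one])

theorem whitehead_ltr (Z : Set (α × Bool)) (v l : α × Bool) :
    whitehead Z v (ltr l) = whiteheadMultiplier Z v l * ltr l * (whiteheadMultiplier Z v (bar l))⁻¹ :=
  twistHom_ltr _ _

theorem whitehead_symm_of (Z : Set (α × Bool)) (v : α × Bool) (a : α) :
    (whitehead Z v).symm (of a) = (whiteheadMultiplier Z v (a, true))⁻¹ * of a *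
      whiteheadMultiplier Z v (a, false) := by
  have : (whitehead Z v).symm (of a) = twistHom (fun l => (whiteheadMultiplier Z v l)⁻¹) (of a) := rfl
  rw [this, twistHom_of, inv_inv]

open Classical in
/-- The image of the cylinder of `l` under a Whitehead automorphism. -/
noncomputable def whiteheadCyl (Z : Set (α × Bool)) (v l : α × Bool) : Set (FreeGroup α) :=
  if l = v then cone Z else if l = bar v then (ltr v)⁻¹ • (cone Z)ᶜ
    else whiteheadMultiplier Z v l • cyl l

/-! ### Ping-pong for the images of cylinders -/

section
variable {Z : Set (α × Bool)} {v : α × Bool}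

theorem whiteheadCyl_self : whiteheadCyl Z v v = cone Z := by simp [whiteheadCyl]

theorem mem_whiteheadCyl_bar {x : FreeGroup α} :
    x ∈ whiteheadCyl Z v (bar v) ↔ ltr v * x ∉ cone Z := by
  simp [whiteheadCyl, bar_ne, Set.mem_smul_set_iff_inv_smul_mem]

theorem whiteheadCyl_of_ne {l : α × Bool} (h : l.1 ≠ v.1) :
    whiteheadCyl Z v l = whiteheadMultiplier Z v l • cyl l := by
  rw [whiteheadCyl, if_neg fun e => h (by rw [e]), if_neg fun e => h (by rw [e, bar_fst])]

theorem mem_whiteheadCyl_of_mem {l : α × Bool} (h : l.1 ≠ v.1) (hl : l ∈ Z) {x : FreeGroup α} :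
    x ∈ whiteheadCyl Z v l ↔ ltr v * x ∈ cyl l := by
  rw [whiteheadCyl_of_ne h, whiteheadMultiplier_of_mem hl h, Set.mem_smul_set_iff_inv_smul_mem,
    inv_inv, smul_eq_mul]

theorem mem_whiteheadCyl_of_notMem {l : α × Bool} (h : l.1 ≠ v.1) (hl : l ∉ Z) {x : FreeGroup α} :
    x ∈ whiteheadCyl Z v l ↔ x ∈ cyl l := by
  rw [whiteheadCyl_of_ne h, whiteheadMultiplier_of_notMem hl, one_smul]

/-- The cylinder of `l` that contains an element, read off from the element itself. -/
theorem whiteheadCyl_disjoint (hv : v ∈ Z) (hv' : bar v ∉ Z) {l m : α × Bool} {x : FreeGroup α}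
    (hl : x ∈ whiteheadCyl Z v l) (hm : x ∈ whiteheadCyl Z v m) : l = m := by
  have h1 : x ∉ cyl (bar v) → ltr v * x ∈ cyl v := ltr_mul_mem_cyl_iff.mpr
  have hor : ∀ k : α × Bool, k = v ∨ k = bar v ∨ k.1 ≠ v.1 := fun k => by
    by_cases h : k.1 = v.1
    · rcases eq_or_eq_bar_of_fst_eq h with h | h <;> simp [h]
    · simp [h]
  have vbar : ∀ {x : FreeGroup α}, x ∈ cone Z → x ∉ cyl (bar v) := fun h h' =>
    hv' ((mem_cone_iff_of_mem_cyl h').mp h)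
  have key1 : ∀ {k : α × Bool}, k ≠ v → x ∈ whiteheadCyl Z v v → x ∈ whiteheadCyl Z v k → False := by
    intro k hk hx hx'
    rw [whiteheadCyl_self] at hx
    have hx2 := h1 (vbar hx)
    rcases hor k with rfl | rfl | hk'
    · exact hk rfl
    · rw [mem_whiteheadCyl_bar] at hx'
      exact hx' ⟨v, hv, hx2⟩
    · by_cases hkZ : k ∈ Z
      · rw [mem_whiteheadCyl_of_mem hk' hkZ] at hx'
        exact hk (eq_of_mem_cyl hx' hx2)
      · rw [mem_whiteheadCyl_of_notMem hk' hkZ] at hx'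
        exact hkZ ((mem_cone_iff_of_mem_cyl hx').mp hx)
  have key2 : ∀ {k : α × Bool}, k.1 ≠ v.1 → x ∈ whiteheadCyl Z v (bar v) →
      x ∈ whiteheadCyl Z v k → False := by
    intro k hk hx hx'
    rw [mem_whiteheadCyl_bar] at hx
    by_cases hkZ : k ∈ Z
    · rw [mem_whiteheadCyl_of_mem hk hkZ] at hx'
      exact hx ⟨k, hkZ, hx'⟩
    · rw [mem_whiteheadCyl_of_notMem hk hkZ] at hx'
      refine hx ⟨v, hv, h1 fun h => hk ?_⟩
      rw [eq_of_mem_cyl hx' h, bar_fst]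
  have key3 : ∀ {k n : α × Bool}, k.1 ≠ v.1 → n.1 ≠ v.1 → k ∈ Z → n ∉ Z →
      x ∈ whiteheadCyl Z v k → x ∈ whiteheadCyl Z v n → False := by
    intro k n hk hn hkZ hnZ hx hx'
    rw [mem_whiteheadCyl_of_mem hk hkZ] at hx
    rw [mem_whiteheadCyl_of_notMem hn hnZ] at hx'
    have : ltr v * x ∈ cyl v := h1 fun h => hn (by rw [eq_of_mem_cyl hx' h, bar_fst])
    exact hk (by rw [eq_of_mem_cyl hx this])
  by_contra hne
  rcases hor l with rfl | rfl | hl' <;> rcases hor m with rfl | rfl | hm'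
  · exact hne rfl
  · exact key1 (Ne.symm hne) hl hm
  · exact key1 (Ne.symm hne) hl hm
  · exact key1 hne hm hl
  · exact hne rfl
  · exact key2 hm' hl hm
  · exact key1 hne hm hl
  · exact key2 hl' hm hl
  · by_cases hlZ : l ∈ Z <;> by_cases hmZ : m ∈ Z
    · rw [mem_whiteheadCyl_of_mem hl' hlZ] at hl
      rw [mem_whiteheadCyl_of_mem hm' hmZ] at hm
      exact hne (eq_of_mem_cyl hl hm)
    · exact key3 hl' hm' hlZ hmZ hl hm
    · exact key3 hm' hl' hmZ hlZ hm hl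
    · rw [mem_whiteheadCyl_of_notMem hl' hlZ] at hl
      rw [mem_whiteheadCyl_of_notMem hm' hmZ] at hm
      exact hne (eq_of_mem_cyl hl hm)

theorem one_notMem_whiteheadCyl (hv : v ∈ Z) (l : α × Bool) : 1 ∉ whiteheadCyl Z v l := by
  by_cases h : l.1 = v.1
  · rcases eq_or_eq_bar_of_fst_eq h with rfl | rfl
    · rw [whiteheadCyl_self]; exact one_notMem_cone Z
    · rw [mem_whiteheadCyl_bar, mul_one, not_not]
      exact ⟨v, hv, ltr_mem_cyl v⟩
  · by_cases hlZ : l ∈ Z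
    · rw [mem_whiteheadCyl_of_mem h hlZ, mul_one]
      exact fun h' => h (by rw [eq_of_mem_cyl h' (ltr_mem_cyl v)])
    · rw [mem_whiteheadCyl_of_notMem h hlZ]
      exact one_notMem_cyl l

theorem whitehead_ltr_mul_mem {l : α × Bool} {x : FreeGroup α} (hx : x ∉ whiteheadCyl Z v (bar l)) :
    whitehead Z v (ltr l) * x ∈ whiteheadCyl Z v l := by
  rw [whitehead_ltr]
  by_cases h : l.1 = v.1
  · rw [whiteheadMultiplier_of_eq h, whiteheadMultiplier_of_eq (l := bar l) h, inv_one, one_mul,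
      mul_one]
    rcases eq_or_eq_bar_of_fst_eq h with rfl | rfl
    · rw [mem_whiteheadCyl_bar, not_not] at hx
      rwa [whiteheadCyl_self]
    · rw [bar_bar, whiteheadCyl_self] at hx
      rwa [mem_whiteheadCyl_bar, ltr_bar, mul_inv_cancel_left]
  · rw [whiteheadCyl_of_ne (l := bar l) h] at hx
    rw [whiteheadCyl_of_ne h, mul_assoc, mul_assoc, Set.mem_smul_set_iff_inv_smul_mem, smul_eq_mul,
      inv_mul_cancel_left, ltr_mul_mem_cyl_iff]
    rwa [Set.mem_smul_set_iff_inv_smul_mem, smul_eq_mul] at hx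

/-- Ping-pong along the reduced word. The sets are disjoint and avoid the identity, so the image of
the tail is never in the set of the inverse of the next letter, and `whitehead_ltr_mul_mem` applies.
-/
theorem whitehead_mem_whiteheadCyl (hv : v ∈ Z) (hv' : bar v ∉ Z) (g : FreeGroup α) :
    ∀ l, g ∈ cyl l → whitehead Z v g ∈ whiteheadCyl Z v l := by
  induction g using ltr_mul_induction with
  | one => exact fun l h => absurd h (one_notMem_cyl l)
  | mul m g hm ih =>
    intro l hl
    obtain rfl := eq_of_mem_cyl hl (ltr_mul_mem_cyl_iff.mpr hm)
    rw [_root_.map_mul]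
    refine whitehead_ltr_mul_mem fun h => ?_
    rcases eq_one_or_exists_mem_cyl g with rfl | ⟨n, hn⟩
    · rw [_root_.map_one] at h
      exact one_notMem_whiteheadCyl hv _ h
    · exact hm (whiteheadCyl_disjoint hv hv' h (ih n hn) ▸ hn)

/-- The sets attached to the letters are pairwise disjoint and avoid the identity, so the inclusions
given by ping-pong are equalities. -/
theorem whitehead_image_cyl (hv : v ∈ Z) (hv' : bar v ∉ Z) (l : α × Bool) :
    whitehead Z v '' cyl l = whiteheadCyl Z v l := by
  ext x
  constructor
  · rintro ⟨g, hg, rfl⟩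
    exact whitehead_mem_whiteheadCyl hv hv' g l hg
  · intro hx
    obtain ⟨g, rfl⟩ := (whitehead Z v).surjective x
    rcases eq_one_or_exists_mem_cyl g with rfl | ⟨n, hn⟩
    · rw [_root_.map_one] at hx
      exact absurd hx (one_notMem_whiteheadCyl hv l)
    · rw [whiteheadCyl_disjoint hv hv' hx (whitehead_mem_whiteheadCyl hv hv' g n hn)]
      exact ⟨g, hn, rfl⟩

/-- The inverse acts on `H` so that the automorphism itself acts on cylinders, where it is explicit:
the cylinder of `v` becomes the cone of `Z`, and cylinders of other generators are translated. -/
theorem splitCount_map_whitehead_symm (hv : v ∈ Z) (hv' : bar v ∉ Z) (H : Subgroup (FreeGroup α))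
    (l : α × Bool) : splitCount (H.map (whitehead Z v).symm.toMonoidHom) (cyl l) =
      splitCount H (whiteheadCyl Z v l) := by
  rw [← splitCount_map (whitehead Z v).symm H, ← whitehead_image_cyl hv hv', ← Set.image_comp]
  simp

theorem splitCount_map_whitehead_symm_self (hv : v ∈ Z) (hv' : bar v ∉ Z)
    (H : Subgroup (FreeGroup α)) {l : α × Bool} (h : l.1 = v.1) :
    splitCount (H.map (whitehead Z v).symm.toMonoidHom) (cyl l) = splitCount H (cone Z) := by
  rw [splitCount_cyl_of_fst_eq _ h, splitCount_map_whitehead_symm hv hv', whiteheadCyl_self]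

theorem splitCount_map_whitehead_symm_of_ne (hv : v ∈ Z) (hv' : bar v ∉ Z)
    (H : Subgroup (FreeGroup α)) {l : α × Bool} (h : l.1 ≠ v.1) :
    splitCount (H.map (whitehead Z v).symm.toMonoidHom) (cyl l) = splitCount H (cyl l) := by
  rw [splitCount_map_whitehead_symm hv hv', whiteheadCyl_of_ne h, splitCount_smul]

theorem whitehead_symm_of_self (a : α) (h : a = v.1) : (whitehead Z v).symm (of a) = of a := by
  rw [whitehead_symm_of, whiteheadMultiplier_of_eq h, whiteheadMultiplier_of_eq h]
  simp

theorem whitehead_symm_of_notMem (a : α) (h : (a, true) ∉ Z) (h' : (a, false) ∉ Z) :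
    (whitehead Z v).symm (of a) = of a := by
  rw [whitehead_symm_of, whiteheadMultiplier_of_notMem h, whiteheadMultiplier_of_notMem h']
  simp

end

end FreeGroup

/-! ### Paths in labelled digraphs -/

namespace XDigraph

open FreeGroup

variable {X : Type u} {S : XDigraph.{u, v} X}

/-- Some edge leads from `x` to `y` when it is crossed in the direction that reads `l`. -/
def Step (S : XDigraph.{u, v} X) (x : S.V) (l : X × Bool) (y : S.V) : Prop :=
  ∃ e : S.E, S.label e = l.1 ∧
    ((l.2 = true ∧ S.src e = x ∧ S.tgt e = y) ∨ (l.2 = false ∧ S.tgt e = x ∧ S.src e = y))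

theorem step_edge (S : XDigraph.{u, v} X) (e : S.E) : S.Step (S.src e) (S.label e, true) (S.tgt e) :=
  ⟨e, rfl, Or.inl ⟨rfl, rfl, rfl⟩⟩

theorem Step.bar {x y : S.V} {l : X × Bool} (h : S.Step x l y) : S.Step y (bar l) x := by
  obtain ⟨e, h1, ⟨h2, h3, h4⟩ | ⟨h2, h3, h4⟩⟩ := h
  · exact ⟨e, h1, Or.inr ⟨by simp [FreeGroup.bar, h2], h4, h3⟩⟩
  · exact ⟨e, h1, Or.inl ⟨by simp [FreeGroup.bar, h2], h4, h3⟩⟩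

theorem isPath_nil_iff {x y : S.V} : S.IsPath x [] y ↔ x = y := by
  constructor
  · intro h; cases h; rfl
  · rintro rfl; exact IsPath.nil _

theorem isPath_cons_iff {x y : S.V} {l : X × Bool} {w : List (X × Bool)} :
    S.IsPath x (l :: w) y ↔ ∃ z, S.Step x l z ∧ S.IsPath z w y := by
  constructor
  · intro h
    cases h with
    | forward e h => exact ⟨_, ⟨e, rfl, Or.inl ⟨rfl, rfl, rfl⟩⟩, h⟩
    | backward e h => exact ⟨_, ⟨e, rfl, Or.inr ⟨rfl, rfl, rfl⟩⟩, h⟩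
  · rintro ⟨z, ⟨e, h1, ⟨h2, rfl, rfl⟩ | ⟨h2, rfl, rfl⟩⟩, h⟩
    · obtain ⟨a, b⟩ := l
      simp only at h1 h2
      subst h1 h2
      exact IsPath.forward e h
    · obtain ⟨a, b⟩ := l
      simp only at h1 h2
      subst h1 h2
      exact IsPath.backward e h

theorem isPath_singleton_iff {x y : S.V} {l : X × Bool} : S.IsPath x [l] y ↔ S.Step x l y := by
  simp [isPath_cons_iff, isPath_nil_iff]

theorem isPath_append_iff {x y : S.V} {w₁ w₂ : List (X × Bool)} :
    S.IsPath x (w₁ ++ w₂) y ↔ ∃ z, S.IsPath x w₁ z ∧ S.IsPath z w₂ y := by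
  induction w₁ generalizing x with
  | nil => simp [isPath_nil_iff]
  | cons l w ih =>
    simp only [List.cons_append, isPath_cons_iff, ih]
    constructor
    · rintro ⟨z, h, z', h', h''⟩
      exact ⟨z', ⟨z, h, h'⟩, h''⟩
    · rintro ⟨z', ⟨z, h, h'⟩, h''⟩
      exact ⟨z, h, z', h', h''⟩

theorem IsPath.append {x y z : S.V} {w₁ w₂ : List (X × Bool)} (h₁ : S.IsPath x w₁ y)
    (h₂ : S.IsPath y w₂ z) : S.IsPath x (w₁ ++ w₂) z := isPath_append_iff.mpr ⟨y, h₁, h₂⟩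

theorem IsPath.invRev {x y : S.V} {w : List (X × Bool)} (h : S.IsPath x w y) :
    S.IsPath y (invRev w) x := by
  induction w generalizing x with
  | nil => rw [isPath_nil_iff] at h; subst h; exact IsPath.nil _
  | cons l w ih =>
    obtain ⟨z, h1, h2⟩ := isPath_cons_iff.mp h
    have : FreeGroup.invRev (l :: w) = FreeGroup.invRev w ++ [FreeGroup.bar l] := by
      simp [FreeGroup.invRev, FreeGroup.bar]
    rw [this]
    exact (ih h2).append (isPath_singleton_iff.mpr h1.bar)

theorem IsFolded.step_unique (hS : S.IsFolded) {x y z : S.V} {l : X × Bool} (h : S.Step x l y)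
    (h' : S.Step x l z) : y = z := by
  obtain ⟨e, h1, ⟨h2, h3, h4⟩ | ⟨h2, h3, h4⟩⟩ := h <;>
  obtain ⟨f, k1, ⟨k2, k3, k4⟩ | ⟨k2, k3, k4⟩⟩ := h'
  · rw [← h4, ← k4, hS.1 e f (h3.trans k3.symm) (h1.trans k1.symm)]
  · simp [h2] at k2
  · simp [h2] at k2
  · rw [← h4, ← k4, hS.2 e f (h3.trans k3.symm) (h1.trans k1.symm)]

/-- In a folded graph a cancelling pair of letters is read along one edge back and forth, so it can
be dropped from the path. -/
theorem IsFolded.isPath_of_red (hS : S.IsFolded) {w w' : List (X × Bool)} (h : Red w w')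
    {x y : S.V} (hw : S.IsPath x w y) : S.IsPath x w' y := by
  induction h with
  | refl => exact hw
  | tail _ hstep ih =>
    cases hstep with
    | @not L₁ L₂ a b =>
      obtain ⟨z, h1, h2⟩ := isPath_append_iff.mp ih
      obtain ⟨z₁, h3, h4⟩ := isPath_cons_iff.mp h2
      obtain ⟨z₂, h5, h6⟩ := isPath_cons_iff.mp h4
      rw [hS.step_unique h5 h3.bar] at h6
      exact h1.append h6

variable [DecidableEq X]

theorem IsFolded.isPath_toWord_mk (hS : S.IsFolded) {w : List (X × Bool)} {x y : S.V}
    (hw : S.IsPath x w y) : S.IsPath x (FreeGroup.mk w).toWord y := by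
  rw [toWord_mk]
  exact hS.isPath_of_red reduce.red hw

theorem IsFolded.isPath_mul (hS : S.IsFolded) {g h : FreeGroup X} {x y z : S.V}
    (hg : S.IsPath x g.toWord y) (hh : S.IsPath y h.toWord z) : S.IsPath x (g * h).toWord z := by
  have := hS.isPath_toWord_mk (hg.append hh)
  rwa [← mul_mk, mk_toWord, mk_toWord] at this

theorem isPath_inv {g : FreeGroup X} {x y : S.V} (hg : S.IsPath x g.toWord y) :
    S.IsPath y (g⁻¹).toWord x := by
  rw [toWord_inv]
  exact hg.invRev

end XDigraph

/-! ### Substituting words for the generators of a free group -/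

namespace FreeGroup

variable {α β : Type*}

/-- The word substituted for a letter when `ws b` is substituted for the generator `b`. -/
def block (ws : β → List (α × Bool)) (l : β × Bool) : List (α × Bool) :=
  if l.2 then ws l.1 else invRev (ws l.1)

theorem block_true (ws : β → List (α × Bool)) (b : β) : block ws (b, true) = ws b := rfl

theorem block_false (ws : β → List (α × Bool)) (b : β) : block ws (b, false) = invRev (ws b) := rfl

theorem head?_invRev (w : List (α × Bool)) : (invRev w).head? = w.getLast?.map bar := by
  simp [invRev]; rfl

theorem getLast?_invRev (w : List (α × Bool)) : (invRev w).getLast? = w.head?.map bar := by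
  simp [invRev]; rfl

theorem block_bar (ws : β → List (α × Bool)) (l : β × Bool) :
    block ws (bar l) = invRev (block ws l) := by
  obtain ⟨b, s⟩ := l
  cases s
  · simp [block, bar, invRev_invRev]
  · simp [block, bar]

/-- The words `ws b` are reduced and non-empty, and the first letters of these words and of their inverses
are distinct, so that no cancellation happens upon substitution. -/
structure IsBlowup (ws : β → List (α × Bool)) : Prop where
  intro ::
  reduced : ∀ b, IsReduced (ws b)
  ne_nil : ∀ b, ws b ≠ []
  head_inj : ∀ l m, (block ws l).head? = (block ws m).head? → l = m

/-- The homomorphism that substitutes `ws b` for `b`. -/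
def blowup (ws : β → List (α × Bool)) : FreeGroup β →* FreeGroup α := lift fun b => mk (ws b)

theorem blowup_of (ws : β → List (α × Bool)) (b : β) : blowup ws (of b) = mk (ws b) := by
  simp [blowup]

theorem blowup_ltr (ws : β → List (α × Bool)) (l : β × Bool) :
    blowup ws (ltr l) = mk (block ws l) := by
  obtain ⟨b, s⟩ := l
  cases s
  · rw [ltr_false, _root_.map_inv, blowup_of, inv_mk, block_false]
  · rw [ltr_true, blowup_of, block_true]

/-- The letters whose block starts with a letter in `Z`. -/
def pullLetters (ws : β → List (α × Bool)) (Z : Set (α × Bool)) : Set (β × Bool) :=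
  {l | ∃ m ∈ Z, (block ws l).head? = some m}

namespace IsBlowup

variable {ws : β → List (α × Bool)}

theorem block_ne_nil (h : IsBlowup ws) (l : β × Bool) : block ws l ≠ [] := by
  obtain ⟨b, s⟩ := l
  cases s
  · rw [block_false]
    intro e
    exact h.ne_nil b (by rw [← invRev_invRev (L₁ := ws b), e]; rfl)
  · exact h.ne_nil b

theorem exists_head (h : IsBlowup ws) (l : β × Bool) : ∃ m, (block ws l).head? = some m := by
  cases hw : block ws l with
  | nil => exact absurd hw (h.block_ne_nil l)
  | cons m L => exact ⟨m, rfl⟩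

variable [DecidableEq α]

theorem block_reduced (h : IsBlowup ws) (l : β × Bool) : IsReduced (block ws l) := by
  obtain ⟨b, s⟩ := l
  cases s
  · rw [block_false, isReduced_iff_reduce_eq, reduce_invRev, (h.reduced b).reduce_eq]
  · exact h.reduced b

theorem toWord_mk_block (h : IsBlowup ws) (l : β × Bool) : (mk (block ws l)).toWord = block ws l := by
  rw [toWord_mk, (h.block_reduced l).reduce_eq]

/-- The hypothesis concerns the image of `g` because its first letter is only identified afterwards,
in `blowup_mem_cyl`, which uses this lemma. -/
theorem toWord_blowup_ltr_mul_aux (h : IsBlowup ws) {l : β × Bool} {g : FreeGroup β}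
    (hg : ∀ m, blowup ws g ∈ cyl m → m ≠ (block ws (bar l)).head?) :
    (blowup ws (ltr l * g)).toWord = block ws l ++ (blowup ws g).toWord := by
  rw [_root_.map_mul, blowup_ltr, toWord_mul_of_getLast, h.toWord_mk_block]
  intro m hm hc
  rw [h.toWord_mk_block] at hm
  refine hg _ hc ?_
  rw [block_bar, head?_invRev, hm]
  rfl

variable [DecidableEq β]

/-- Distinct letters have blocks with distinct first letters, so consecutive blocks of a reduced
word do not cancel. -/
theorem blowup_mem_cyl (h : IsBlowup ws) (g : FreeGroup β) : ∀ (l : β × Bool) (m : α × Bool),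
    g ∈ cyl l → (block ws l).head? = some m → blowup ws g ∈ cyl m := by
  induction g using ltr_mul_induction with
  | one => exact fun l m hl => absurd hl (one_notMem_cyl l)
  | mul n g hn ih =>
    intro l m hl hm
    obtain rfl := eq_of_mem_cyl hl (ltr_mul_mem_cyl_iff.mpr hn)
    rw [mem_cyl, h.toWord_blowup_ltr_mul_aux, List.head?_append_of_ne_nil _ (h.block_ne_nil _), hm]
    intro k hk hk'
    rcases eq_one_or_exists_mem_cyl g with rfl | ⟨p, hp⟩
    · rw [_root_.map_one] at hk
      exact one_notMem_cyl _ hk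
    · obtain ⟨q, hq⟩ := h.exists_head p
      have := eq_of_mem_cyl hk (ih p q hp hq)
      rw [this, ← hq] at hk'
      exact hn (h.head_inj _ _ hk' ▸ hp)

theorem blowup_mem_cyl_iff (h : IsBlowup ws) {g : FreeGroup β} {l : β × Bool} {m : α × Bool}
    (hm : (block ws l).head? = some m) : blowup ws g ∈ cyl m ↔ g ∈ cyl l := by
  refine ⟨fun hg => ?_, fun hg => h.blowup_mem_cyl g l m hg hm⟩
  rcases eq_one_or_exists_mem_cyl g with rfl | ⟨p, hp⟩
  · rw [_root_.map_one] at hg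
    exact absurd hg (one_notMem_cyl _)
  · obtain ⟨q, hq⟩ := h.exists_head p
    have := eq_of_mem_cyl hg (h.blowup_mem_cyl g p q hp hq)
    rw [this, ← hq] at hm
    exact h.head_inj _ _ hm ▸ hp

theorem toWord_blowup_ltr_mul (h : IsBlowup ws) {l : β × Bool} {g : FreeGroup β}
    (hg : g ∉ cyl (bar l)) :
    (blowup ws (ltr l * g)).toWord = block ws l ++ (blowup ws g).toWord :=
  h.toWord_blowup_ltr_mul_aux fun _ hm hm' => hg ((h.blowup_mem_cyl_iff hm'.symm).mp hm)

theorem blowup_mem_cone_iff (h : IsBlowup ws) {g : FreeGroup β} {Z : Set (α × Bool)} :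
    blowup ws g ∈ cone Z ↔ g ∈ cone (pullLetters ws Z) := by
  rcases eq_one_or_exists_mem_cyl g with rfl | ⟨l, hl⟩
  · simp [one_notMem_cone]
  · obtain ⟨m, hm⟩ := h.exists_head l
    rw [mem_cone_iff_of_mem_cyl hl, mem_cone_iff_of_mem_cyl (h.blowup_mem_cyl g l m hl hm)]
    simp only [pullLetters, hm, Option.some_inj, Set.mem_ofPred_eq, exists_eq_right']

theorem blowup_injective (h : IsBlowup ws) : Function.Injective (blowup ws) := by
  rw [injective_iff_map_eq_one]
  intro g hg
  rcases eq_one_or_exists_mem_cyl g with rfl | ⟨l, hl⟩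
  · rfl
  · obtain ⟨m, hm⟩ := h.exists_head l
    have := h.blowup_mem_cyl g l m hl hm
    rw [hg] at this
    exact absurd this (one_notMem_cyl _)

/-- What an element of the image looks like from the point in the middle of a block. -/
theorem inv_take_mul_blowup_mem_cyl (h : IsBlowup ws) {b : β} {i : ℕ} {y z : α × Bool}
    (hy : (ws b)[i]? = some y) (hz : (ws b)[i + 1]? = some z) (g : FreeGroup β) :
    (g ∈ cyl (b, true) → (mk ((ws b).take (i + 1)))⁻¹ * blowup ws g ∈ cyl z) ∧
    (g ∉ cyl (b, true) → (mk ((ws b).take (i + 1)))⁻¹ * blowup ws g ∈ cyl (bar y)) := by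
  obtain ⟨hi, rfl⟩ := List.getElem?_eq_some_iff.mp hy
  obtain ⟨hi', rfl⟩ := List.getElem?_eq_some_iff.mp hz
  constructor
  · intro hg
    obtain ⟨k, rfl⟩ : ∃ k, g = ltr (b, true) * k := ⟨(ltr (b, true))⁻¹ * g, by simp⟩
    rw [ltr_mul_mem_cyl_iff] at hg
    have h1 := h.toWord_blowup_ltr_mul hg
    rw [block_true, ← List.take_append_drop (i + 1) (ws b), List.append_assoc] at h1
    have h2 : (mk ((ws b).take (i + 1)))⁻¹ * blowup ws (ltr (b, true) * k) =
        mk ((ws b).drop (i + 1) ++ (blowup ws k).toWord) := by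
      rw [inv_mul_eq_iff_eq_mul, mul_mk, ← h1, mk_toWord]
    have h3 : IsReduced ((ws b).drop (i + 1) ++ (blowup ws k).toWord) := by
      have : IsReduced (blowup ws (ltr (b, true) * k)).toWord := isReduced_toWord
      rw [h1] at this
      exact this.infix (List.suffix_append _ _).isInfix
    rw [h2, mem_cyl, toWord_mk, h3.reduce_eq, List.drop_eq_getElem_cons hi']
    rfl
  -- The image of `g` does not start with the first letter of the block, so nothing cancels and the
  -- prefix is read backwards from its last letter.
  · intro hg
    have hred : IsReduced ((ws b).take (i + 1)) :=
      (h.reduced b).infix (List.take_prefix _ _).isInfix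
    have h0 : ((mk ((ws b).take (i + 1)))⁻¹).toWord = invRev ((ws b).take (i + 1)) := by
      rw [toWord_inv, toWord_mk, hred.reduce_eq]
    have hne : invRev ((ws b).take (i + 1)) ≠ [] := by
      intro e
      have := congrArg List.length e
      simp [invRev_length] at this
      exact h.ne_nil b this
    rw [mem_cyl, toWord_mul_of_getLast, h0, List.head?_append_of_ne_nil _ hne, head?_invRev,
      List.getLast?_take]
    · simp [hi]
    · intro m hm hc
      rw [h0, getLast?_invRev] at hm
      have h1 : (block ws (b, true)).head? = some (bar m) := by
        rw [block_true]
        rw [List.head?_take] at hm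
        simp only [Nat.add_eq_zero_iff, one_ne_zero, and_false, if_false, Option.map_eq_some_iff] at hm
        obtain ⟨n, hn, rfl⟩ := hm
        rw [hn, bar_bar]
      exact hg ((h.blowup_mem_cyl_iff h1).mp hc)

/-- A prefix of a substituted word ends between two blocks or inside a block. -/
theorem exists_of_prefix (h : IsBlowup ws) (g : FreeGroup β) : ∀ (w₁ w₂ : List (α × Bool)),
    (blowup ws g).toWord = w₁ ++ w₂ → ∃ k : FreeGroup β, mk w₁ = blowup ws k ∨
      ∃ (b : β) (i : ℕ), i + 1 < (ws b).length ∧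
        mk w₁ = blowup ws k * mk ((ws b).take (i + 1)) := by
  induction g using ltr_mul_induction with
  | one =>
    intro w₁ w₂ hw
    rw [_root_.map_one, toWord_one, eq_comm, List.append_eq_nil_iff] at hw
    exact ⟨1, Or.inl (by rw [hw.1, _root_.map_one]; rfl)⟩
  | mul l g hl ih =>
    intro w₁ w₂ hw
    rw [h.toWord_blowup_ltr_mul hl, List.append_eq_append_iff] at hw
    rcases hw with ⟨t, rfl, ht⟩ | ⟨t, ht, -⟩
    · obtain ⟨k, hk⟩ := ih t w₂ ht
      refine ⟨ltr l * k, hk.imp ?_ ?_⟩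
      · intro hk
        rw [← mul_mk, hk, _root_.map_mul, blowup_ltr]
      · rintro ⟨b, i, hi, hk⟩
        exact ⟨b, i, hi, by rw [← mul_mk, hk, _root_.map_mul, blowup_ltr, mul_assoc]⟩
    -- The prefix ends within the first block, at one of its ends or properly inside.
    · have key : ∀ (b : β) (t₁ t₂ : List (α × Bool)), ws b = t₁ ++ t₂ →
          mk t₁ = 1 ∨ t₂ = [] ∨
            ∃ i, i + 1 < (ws b).length ∧ t₁ = (ws b).take (i + 1) := by
        intro b t₁ t₂ hb
        cases t₁ with
        | nil => exact Or.inl rfl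
        | cons n t₁ =>
          cases t₂ with
          | nil => exact Or.inr (Or.inl rfl)
          | cons p t₂ =>
            refine Or.inr (Or.inr ⟨t₁.length, by simp [hb], ?_⟩)
            rw [hb, ← List.length_cons, List.take_left]
      obtain ⟨b, s⟩ := l
      cases s
      -- The block of an inverse letter is read backwards, so the end point is reached from the
      -- vertex `b⁻¹` along a prefix of `ws b`.
      · have hb : ws b = invRev t ++ invRev w₁ := by
          rw [← invRev_append, ← ht, block_false, invRev_invRev]
        have hw₁ : mk w₁ = (mk (ws b))⁻¹ * mk (invRev t) := by
          rw [eq_inv_mul_iff_mul_eq, hb, ← mul_mk, ← inv_mk (L := w₁), inv_mul_cancel_right]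
        rcases key b _ _ hb with h1 | h1 | ⟨i, hi, h1⟩
        · exact ⟨(of b)⁻¹, Or.inl (by rw [hw₁, h1, _root_.map_inv, blowup_of, mul_one])⟩
        · refine ⟨1, Or.inl ?_⟩
          rw [_root_.map_one, hw₁, hb, h1, List.append_nil, inv_mul_cancel]
        · exact ⟨(of b)⁻¹, Or.inr ⟨b, i, hi, by rw [hw₁, h1, _root_.map_inv, blowup_of]⟩⟩
      · rw [block_true] at ht
        rcases key b _ _ ht with h1 | h1 | ⟨i, hi, h1⟩
        · exact ⟨1, Or.inl (by rw [h1, _root_.map_one])⟩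
        · exact ⟨of b, Or.inl (by rw [blowup_of, ht, h1, List.append_nil])⟩
        · exact ⟨1, Or.inr ⟨b, i, hi, by rw [h1, _root_.map_one, one_mul]⟩⟩

end IsBlowup

end FreeGroup

/-! ### The subdivided rose of a substitution -/

namespace XDigraph

open FreeGroup

-- The petals are indexed by a type in the lowest universe, so that `ULift` can place the rose in
-- the universe of a given digraph.
variable {X : Type u} {β : Type}

/-- The `i`-th vertex on the petal of `b`. -/
def petalPoint (ws : β → List (X × Bool)) (b : β) (i : ℕ) :
    ULift.{v} (Option {p : β × ℕ // 0 < p.2 ∧ p.2 < (ws p.1).length}) :=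
  if h : 0 < i ∧ i < (ws b).length then ⟨some ⟨(b, i), h⟩⟩ else ⟨none⟩

/-- The rose whose petals are subdivided and labelled by the words `ws b`. -/
def subdividedRose (ws : β → List (X × Bool)) : XDigraph.{u, v} X where
  V := ULift.{v} (Option {p : β × ℕ // 0 < p.2 ∧ p.2 < (ws p.1).length})
  E := ULift.{v} (Σ b : β, Fin (ws b).length)
  src := fun e => if ((ws e.down.1).get e.down.2).2 then petalPoint ws e.down.1 e.down.2
    else petalPoint ws e.down.1 (e.down.2 + 1)
  tgt := fun e => if ((ws e.down.1).get e.down.2).2 then petalPoint ws e.down.1 (e.down.2 + 1)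
    else petalPoint ws e.down.1 e.down.2
  label := fun e => ((ws e.down.1).get e.down.2).1

/-- The common point of the petals. -/
def roseBase (ws : β → List (X × Bool)) : (subdividedRose.{u, v} ws).V := ⟨none⟩

theorem petalPoint_zero (ws : β → List (X × Bool)) (b : β) :
    petalPoint.{u, v} ws b 0 = roseBase ws := by simp [petalPoint, roseBase]

theorem petalPoint_length (ws : β → List (X × Bool)) (b : β) :
    petalPoint.{u, v} ws b (ws b).length = roseBase ws := by simp [petalPoint, roseBase]

theorem petalPoint_eq_iff {ws : β → List (X × Bool)} {b c : β} {i j : ℕ} (h : 0 < i)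
    (h' : i < (ws b).length) (hj : petalPoint.{u, v} ws b i = petalPoint.{u, v} ws c j) :
    b = c ∧ i = j := by
  by_cases hc : 0 < j ∧ j < (ws c).length
  · have : (⟨some ⟨(b, i), h, h'⟩⟩ : (subdividedRose.{u, v} ws).V) = ⟨some ⟨(c, j), hc⟩⟩ := by
      simpa [petalPoint, h, h', hc] using hj
    simpa using this
  · simp [petalPoint, h, h', hc] at hj

theorem subdividedRose_step (ws : β → List (X × Bool)) {b : β} {i : ℕ} {l : X × Bool}
    (hi : (ws b)[i]? = some l) :
    (subdividedRose.{u, v} ws).Step (petalPoint ws b i) l (petalPoint ws b (i + 1)) := by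
  obtain ⟨h, rfl⟩ := List.getElem?_eq_some_iff.mp hi
  refine ⟨⟨⟨b, ⟨i, h⟩⟩⟩, rfl, ?_⟩
  cases hs : ((ws b)[i]).2 <;> simp [subdividedRose, hs]

/-- Every edge, crossed in either direction, is a step along a petal. -/
theorem subdividedRose_edge_ends (ws : β → List (X × Bool)) (e : (subdividedRose.{u, v} ws).E) :
    ∃ (b : β) (i : ℕ) (l : X × Bool), (ws b)[i]? = some l ∧
      e.down.1 = b ∧ (e.down.2 : ℕ) = i ∧ (subdividedRose.{u, v} ws).label e = l.1 ∧
      ((l.2 = true ∧ (subdividedRose.{u, v} ws).src e = petalPoint ws b i ∧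
        (subdividedRose.{u, v} ws).tgt e = petalPoint ws b (i + 1)) ∨
       (l.2 = false ∧ (subdividedRose.{u, v} ws).tgt e = petalPoint ws b i ∧
        (subdividedRose.{u, v} ws).src e = petalPoint ws b (i + 1))) := by
  obtain ⟨⟨b, i, hi⟩⟩ := e
  refine ⟨b, i, (ws b)[i], by simp [hi], rfl, rfl, rfl, ?_⟩
  cases hs : ((ws b)[i]).2 <;> simp [subdividedRose, hs]

theorem subdividedRose_isPath_take (ws : β → List (X × Bool)) (b : β) (i : ℕ)
    (hi : i ≤ (ws b).length) :
    (subdividedRose.{u, v} ws).IsPath (roseBase ws) ((ws b).take i) (petalPoint ws b i) := by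
  induction i with
  | zero => rw [petalPoint_zero]; exact IsPath.nil _
  | succ i ih =>
    rw [List.take_add_one, List.getElem?_eq_getElem hi]
    exact (ih (by omega)).append
      (isPath_singleton_iff.mpr (subdividedRose_step ws (List.getElem?_eq_getElem hi)))

theorem subdividedRose_isPath_petal (ws : β → List (X × Bool)) (b : β) :
    (subdividedRose.{u, v} ws).IsPath (roseBase ws) (ws b) (roseBase ws) := by
  have := subdividedRose_isPath_take.{u, v} ws b _ le_rfl
  rwa [List.take_length, petalPoint_length] at this

theorem petalPoint_eq_base_iff {ws : β → List (X × Bool)} {b : β} {i : ℕ} :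
    petalPoint.{u, v} ws b i = roseBase ws ↔ ¬ (0 < i ∧ i < (ws b).length) := by
  by_cases h : 0 < i ∧ i < (ws b).length
  · rw [petalPoint, dif_pos h]
    simp only [h, and_self, not_true_eq_false, iff_false]
    intro e
    have := congrArg ULift.down e
    simp [roseBase] at this
  · rw [petalPoint, dif_neg h]
    simp [h, roseBase]

/-- The directions at the base of the rose read the first letters of the blocks. -/
theorem head?_block_of_dart {ws : β → List (X × Bool)} {b : β} {i : ℕ} {l : X × Bool} (s : Bool)
    (hi : (ws b)[i]? = some l)
    (hb : petalPoint.{u, v} ws b (if s then i else i + 1) = roseBase ws) :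
    (block ws (b, s)).head? = some (if s then l else FreeGroup.bar l) ∧
      i = if s then 0 else (ws b).length - 1 := by
  obtain ⟨hlt, rfl⟩ := List.getElem?_eq_some_iff.mp hi
  rw [petalPoint_eq_base_iff] at hb
  cases s
  · simp only [Bool.false_eq_true, if_false] at hb ⊢
    have h3 : i = (ws b).length - 1 := by omega
    refine ⟨?_, h3⟩
    rw [block_false, head?_invRev, List.getLast?_eq_getElem?, ← h3, hi]
    rfl
  · simp only [if_true] at hb ⊢
    have : i = 0 := by omega
    subst this
    exact ⟨by rw [block_true, List.head?_eq_getElem?, hi], rfl⟩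

theorem _root_.FreeGroup.IsReduced.getElem?_succ_ne_bar {w : List (X × Bool)} (h : IsReduced w)
    {i : ℕ} {l m : X × Bool} (hl : w[i + 1]? = some l) (hm : w[i]? = some m) :
    l ≠ FreeGroup.bar m := by
  obtain ⟨h1, rfl⟩ := List.getElem?_eq_some_iff.mp hl
  obtain ⟨h2, rfl⟩ := List.getElem?_eq_some_iff.mp hm
  have h3 : IsReduced ([w[i], w[i + 1]]) := by
    refine h.infix ⟨w.take i, w.drop (i + 2), ?_⟩
    rw [List.append_assoc]
    conv_rhs => rw [← List.take_append_drop i w, List.drop_eq_getElem_cons h2,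
      List.drop_eq_getElem_cons h1]
    rfl
  exact (isReduced_cons_cons_iff_ne_bar.mp h3).1

/-- Directions at the base are told apart by the first letters of the blocks, directions at an
interior point by the reducedness of the word on the petal. A flag says whether the edge is viewed
from its start or from its end along the petal. -/
theorem subdividedRose_dart_inj {ws : β → List (X × Bool)} (h : IsBlowup ws) {b c : β} {i j : ℕ}
    {l m : X × Bool} (s t : Bool) (hl : (ws b)[i]? = some l) (hm : (ws c)[j]? = some m)
    (hst : petalPoint.{u, v} ws b (if s then i else i + 1) =
      petalPoint.{u, v} ws c (if t then j else j + 1))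
    (hlm : (if s then l else FreeGroup.bar l) = (if t then m else FreeGroup.bar m)) :
    b = c ∧ i = j := by
  by_cases hb : petalPoint.{u, v} ws b (if s then i else i + 1) = roseBase ws
  · obtain ⟨h1, h2⟩ := head?_block_of_dart s hl hb
    obtain ⟨h3, h4⟩ := head?_block_of_dart t hm (hst ▸ hb)
    have := h.head_inj _ _ (h1.trans ((congrArg some hlm).trans h3.symm))
    simp only [Prod.mk.injEq] at this
    obtain ⟨rfl, rfl⟩ := this
    exact ⟨rfl, h2.trans h4.symm⟩
  · rw [petalPoint_eq_base_iff, not_not] at hb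
    obtain ⟨rfl, hij⟩ := petalPoint_eq_iff hb.1 hb.2 hst
    cases s <;> cases t <;> simp only [if_true, if_false, Bool.false_eq_true] at hlm hij
    · exact ⟨rfl, by omega⟩
    · subst hij
      exact absurd hlm.symm ((h.reduced _).getElem?_succ_ne_bar hm hl)
    · subst hij
      exact absurd hlm ((h.reduced _).getElem?_succ_ne_bar hl hm)
    · exact ⟨rfl, hij⟩

theorem subdividedRose_isFolded {ws : β → List (X × Bool)} (h : IsBlowup ws) :
    (subdividedRose.{u, v} ws).IsFolded := by
  have hext : ∀ e f : (subdividedRose.{u, v} ws).E, e.down.1 = f.down.1 →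
      (e.down.2 : ℕ) = f.down.2 → e = f := by
    rintro ⟨b, i⟩ ⟨c, j⟩ h1 h2
    simp only at h1
    subst h1
    obtain rfl : i = j := Fin.ext h2
    rfl
  constructor
  · intro e f hs hlab
    obtain ⟨b, i, l, hl, rfl, rfl, hel, he⟩ := subdividedRose_edge_ends ws e
    obtain ⟨c, j, m, hm, rfl, rfl, hfl, hf⟩ := subdividedRose_edge_ends ws f
    have hlm : l.1 = m.1 := by rw [← hel, ← hfl, hlab]
    obtain ⟨l, ls⟩ := l
    obtain ⟨m, ms⟩ := m
    -- With the sign of the letter as the flag, the chosen end is the source; the negated sign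
    -- selects the target.
    have := subdividedRose_dart_inj h ls ms hl hm
    refine (fun h => hext e f h.1 h.2) (this ?_ ?_)
    · rcases he with ⟨h1, h2, -⟩ | ⟨h1, -, h2⟩ <;> rcases hf with ⟨h3, h4, -⟩ | ⟨h3, -, h4⟩ <;>
        simp only at h1 h3 <;> subst h1 <;> subst h3 <;>
        exact h2.symm.trans (hs.trans h4)
    · simp only at hlm
      subst hlm
      cases ls <;> cases ms <;> simp [FreeGroup.bar]
  · intro e f hs hlab
    obtain ⟨b, i, l, hl, rfl, rfl, hel, he⟩ := subdividedRose_edge_ends ws e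
    obtain ⟨c, j, m, hm, rfl, rfl, hfl, hf⟩ := subdividedRose_edge_ends ws f
    have hlm : l.1 = m.1 := by rw [← hel, ← hfl, hlab]
    obtain ⟨l, ls⟩ := l
    obtain ⟨m, ms⟩ := m
    have := subdividedRose_dart_inj h (!ls) (!ms) hl hm
    refine (fun h => hext e f h.1 h.2) (this ?_ ?_)
    · rcases he with ⟨h1, -, h2⟩ | ⟨h1, h2, -⟩ <;> rcases hf with ⟨h3, -, h4⟩ | ⟨h3, h4, -⟩ <;>
        simp only at h1 h3 <;> subst h1 <;> subst h3 <;>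
        exact h2.symm.trans (hs.trans h4)
    · simp only at hlm
      subst hlm
      cases ls <;> cases ms <;> simp [FreeGroup.bar]

/-- The image of the substitution homomorphism labels loops at the base of the rose. -/
theorem subdividedRose_isPath_blowup [DecidableEq X] {ws : β → List (X × Bool)} (h : IsBlowup ws)
    (g : FreeGroup β) :
    (subdividedRose.{u, v} ws).IsPath (roseBase ws) (blowup ws g).toWord (roseBase ws) := by
  have hf := subdividedRose_isFolded.{u, v} h
  induction g using FreeGroup.induction_on with
  | C1 => rw [_root_.map_one, toWord_one]; exact IsPath.nil _
  | of b =>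
    rw [blowup_of]
    exact hf.isPath_toWord_mk (subdividedRose_isPath_petal ws b)
  | inv_of b hb => rw [_root_.map_inv]; exact isPath_inv hb
  | mul g k hg hk => rw [_root_.map_mul]; exact hf.isPath_mul hg hk

end XDigraph

/-! ### Cosets split by a cone, after a substitution -/

namespace FreeGroup

variable {α : Type u} {β : Type}

/-- The pairs of directions at the interior vertices of a path that reads `w`. -/
def turns (w : List (α × Bool)) : List ((α × Bool) × (α × Bool)) :=
  List.zipWith (fun y z => (bar y, z)) w w.tail

/-- The set of letters `Z` separates the two directions of a turn. -/
def SeparatesTurn (Z : Set (α × Bool)) (p : (α × Bool) × (α × Bool)) : Prop :=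
  ¬ (p.1 ∈ Z ↔ p.2 ∈ Z)

open Classical in
/-- The number of turns in a list that `Z` separates. -/
noncomputable def turnCount (Z : Set (α × Bool)) (t : List ((α × Bool) × (α × Bool))) : ℕ :=
  t.countP fun p => SeparatesTurn Z p

theorem length_turns (w : List (α × Bool)) : (turns w).length = w.length - 1 := by
  simp [turns]

theorem getElem_turns {w : List (α × Bool)} {i : ℕ} (h : i + 1 < w.length)
    (h' : i < (turns w).length) : (turns w)[i] = (bar w[i], w[i + 1]) := by
  simp [turns]

theorem countP_eq_sum_fin {γ : Type*} (t : List γ) (p : γ → Prop) [DecidablePred p] :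
    t.countP (fun x => p x) = ∑ i : Fin t.length, if p (t.get i) then 1 else 0 := by
  induction t with
  | nil => simp
  | cons a t ih =>
    rw [List.countP_cons, ih]
    simp only [List.length_cons, Fin.sum_univ_succ, List.get_eq_getElem, Fin.val_zero,
      List.getElem_cons_zero, Fin.val_succ, List.getElem_cons_succ, decide_eq_true_eq]
    rw [add_comm]
    rfl

variable [DecidableEq α] [DecidableEq β] {ws : β → List (α × Bool)}

theorem _root_.Set.Infinite.exists_ne {γ : Type*} {s : Set γ} (hs : s.Infinite) (a : γ) :
    ∃ x ∈ s, x ≠ a := by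
  obtain ⟨x, hx⟩ := (hs.sdiff (Set.finite_singleton a)).nonempty
  exact ⟨x, hx.1, hx.2⟩

theorem IsBlowup.image_inter_cone (h : IsBlowup ws) (Q : Set (FreeGroup β)) (Z : Set (α × Bool)) :
    blowup ws '' Q ∩ cone Z = blowup ws '' (Q ∩ cone (pullLetters ws Z)) := by
  ext x
  constructor
  · rintro ⟨⟨q, hq, rfl⟩, hx⟩
    exact ⟨q, ⟨hq, h.blowup_mem_cone_iff.mp hx⟩, rfl⟩
  · rintro ⟨q, ⟨hq, hx⟩, rfl⟩
    exact ⟨⟨q, hq, rfl⟩, h.blowup_mem_cone_iff.mpr hx⟩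

theorem IsBlowup.image_diff_cone (h : IsBlowup ws) (Q : Set (FreeGroup β)) (Z : Set (α × Bool)) :
    blowup ws '' Q \ cone Z = blowup ws '' (Q \ cone (pullLetters ws Z)) := by
  ext x
  constructor
  · rintro ⟨⟨q, hq, rfl⟩, hx⟩
    exact ⟨q, ⟨hq, fun h' => hx (h.blowup_mem_cone_iff.mpr h')⟩, rfl⟩
  · rintro ⟨q, ⟨hq, hx⟩, rfl⟩
    exact ⟨⟨q, hq, rfl⟩, fun h' => hx (h.blowup_mem_cone_iff.mp h')⟩

/-- The coset seen from the interior vertex after the `i`-th edge of the petal of `b`. -/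
def shiftedImage (ws : β → List (α × Bool)) (b : β) (i : ℕ) (Q : Set (FreeGroup β)) :
    Set (FreeGroup α) :=
  (mk ((ws b).take (i + 1)))⁻¹ • (blowup ws '' Q)

/-- From an interior point of the petal of `b`, the image of `q` lies forward or backward according
to whether `q` starts with `b`. So a cone that separates these two directions cuts the shifted set
as the cylinder of `b` cuts `Q`, up to complement, and any other cone does not cut it. -/
theorem IsBlowup.shiftedImage_split_iff (h : IsBlowup ws) {b : β} {i : ℕ}
    (hi : i + 1 < (ws b).length) (Q : Set (FreeGroup β)) (Z : Set (α × Bool)) :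
    ((shiftedImage ws b i Q ∩ cone Z).Infinite ∧ (shiftedImage ws b i Q \ cone Z).Infinite) ↔
      SeparatesTurn Z (bar (ws b)[i], (ws b)[i + 1]) ∧
        (Q ∩ cyl (b, true)).Infinite ∧ (Q \ cyl (b, true)).Infinite := by
  set p := mk ((ws b).take (i + 1)) with hp
  have hmem : ∀ q, p⁻¹ * blowup ws q ∈ cone Z ↔
      (q ∈ cyl (b, true) ∧ (ws b)[i + 1] ∈ Z) ∨ (q ∉ cyl (b, true) ∧ bar (ws b)[i] ∈ Z) := by
    intro q
    have := h.inv_take_mul_blowup_mem_cyl (List.getElem?_eq_getElem (by omega))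
      (List.getElem?_eq_getElem hi) q
    by_cases hq : q ∈ cyl (b, true)
    · rw [hp, mem_cone_iff_of_mem_cyl (this.1 hq)]
      simp [hq]
    · rw [hp, mem_cone_iff_of_mem_cyl (this.2 hq)]
      simp [hq]
  have hinj : Function.Injective fun q => p⁻¹ * blowup ws q :=
    (mul_right_injective _).comp h.blowup_injective
  have hS : shiftedImage ws b i Q = (fun q => p⁻¹ * blowup ws q) '' Q := by
    rw [shiftedImage, ← Set.image_smul, Set.image_image]
    rfl
  have e1 : shiftedImage ws b i Q ∩ cone Z = (fun q => p⁻¹ * blowup ws q) '' (Q ∩ {q |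
      (q ∈ cyl (b, true) ∧ (ws b)[i + 1] ∈ Z) ∨ (q ∉ cyl (b, true) ∧ bar (ws b)[i] ∈ Z)}) := by
    rw [hS]
    ext x
    constructor
    · rintro ⟨⟨q, hq, rfl⟩, hx⟩
      exact ⟨q, ⟨hq, (hmem q).mp hx⟩, rfl⟩
    · rintro ⟨q, ⟨hq, hx⟩, rfl⟩
      exact ⟨⟨q, hq, rfl⟩, (hmem q).mpr hx⟩
  have e2 : shiftedImage ws b i Q \ cone Z = (fun q => p⁻¹ * blowup ws q) '' (Q \ {q |
      (q ∈ cyl (b, true) ∧ (ws b)[i + 1] ∈ Z) ∨ (q ∉ cyl (b, true) ∧ bar (ws b)[i] ∈ Z)}) := by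
    rw [hS]
    ext x
    constructor
    · rintro ⟨⟨q, hq, rfl⟩, hx⟩
      exact ⟨q, ⟨hq, fun h' => hx ((hmem q).mpr h')⟩, rfl⟩
    · rintro ⟨q, ⟨hq, hx⟩, rfl⟩
      exact ⟨⟨q, hq, rfl⟩, fun h' => hx ((hmem q).mp h')⟩
  rw [e1, e2, Set.infinite_image_iff hinj.injOn, Set.infinite_image_iff hinj.injOn]
  by_cases h1 : (ws b)[i + 1] ∈ Z <;> by_cases h2 : bar (ws b)[i] ∈ Z
  · have : {q : FreeGroup β | (q ∈ cyl (b, true) ∧ (ws b)[i + 1] ∈ Z) ∨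
        (q ∉ cyl (b, true) ∧ bar (ws b)[i] ∈ Z)} = Set.univ := by ext q; simp [h1, h2, em]
    rw [this]
    simp [SeparatesTurn, h1, h2]
  · have : {q : FreeGroup β | (q ∈ cyl (b, true) ∧ (ws b)[i + 1] ∈ Z) ∨
        (q ∉ cyl (b, true) ∧ bar (ws b)[i] ∈ Z)} = cyl (b, true) := by ext q; simp [h1, h2]
    rw [this]
    simp [SeparatesTurn, h1, h2]
  · have : {q : FreeGroup β | (q ∈ cyl (b, true) ∧ (ws b)[i + 1] ∈ Z) ∨
        (q ∉ cyl (b, true) ∧ bar (ws b)[i] ∈ Z)} = (cyl (b, true))ᶜ := by ext q; simp [h1, h2]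
    rw [this]
    simp [SeparatesTurn, h1, h2, Set.sdiff_eq, and_comm]
  · have : {q : FreeGroup β | (q ∈ cyl (b, true) ∧ (ws b)[i + 1] ∈ Z) ∨
        (q ∉ cyl (b, true) ∧ bar (ws b)[i] ∈ Z)} = ∅ := by ext q; simp [h1, h2]
    rw [this]
    simp [SeparatesTurn, h1, h2]

open XDigraph in
/-- Points of different shifted images are different. -/
theorem IsBlowup.eq_of_inv_take_mul_eq (h : IsBlowup ws) {b c : β} {i j : ℕ}
    (hi : i ≤ (ws b).length) (hj : j ≤ (ws c).length) {q r : FreeGroup β}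
    (e : (mk ((ws b).take i))⁻¹ * blowup ws q = (mk ((ws c).take j))⁻¹ * blowup ws r) :
    petalPoint.{u, 0} ws b i = petalPoint.{u, 0} ws c j := by
  have hf := subdividedRose_isFolded.{u, 0} h
  have h1 := hf.isPath_toWord_mk (subdividedRose_isPath_take.{u, 0} ws b i hi)
  have h2 := hf.isPath_toWord_mk (subdividedRose_isPath_take.{u, 0} ws c j hj)
  have h3 := subdividedRose_isPath_blowup.{u, 0} h (q * r⁻¹)
  have h4 := hf.isPath_mul (hf.isPath_mul (isPath_inv h1) h3) h2
  have : (mk ((ws b).take i))⁻¹ * blowup ws (q * r⁻¹) * mk ((ws c).take j) = 1 := by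
    rw [_root_.map_mul, ← mul_assoc, e, _root_.map_inv]
    group
  rw [this, toWord_one] at h4
  exact isPath_nil_iff.mp h4

/-- The cosets to be counted correspond to vertices of a subdivided graph: old vertices see the cone
through the first letters of the blocks, and an edge `b` acquires one interior vertex for each turn
of `ws b`, which counts if the turn is separated. -/
theorem IsBlowup.splitCount_map [Fintype β] (h : IsBlowup ws) (J : Subgroup (FreeGroup β))
    (Z : Set (α × Bool)) :
    splitCount (J.map (blowup ws)) (cone Z) = splitCount J (cone (pullLetters ws Z)) +
      ∑ b, (turnCount Z (turns (ws b)) : ℕ∞) * splitCount J (cyl (b, true)) := by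
  classical
  let I := Σ b : β, Fin (turns (ws b)).length
  have hI : ∀ x : I, (x.2 : ℕ) + 1 < (ws x.1).length := fun x => by
    have h1 := x.2.2
    have h2 := length_turns (ws x.1)
    omega
  -- `A₀` collects the split cosets based at the base of the rose, and `A x` those based at the
  -- interior point `x` of a petal.
  let A₀ : Set (Set (FreeGroup α)) :=
    (fun Q => blowup ws '' Q) '' splitCosets J (cone (pullLetters ws Z))
  let A : I → Set (Set (FreeGroup α)) := fun x =>
    if SeparatesTurn Z ((turns (ws x.1)).get x.2) then
      shiftedImage ws x.1 x.2 '' splitCosets J (cyl (x.1, true)) else ∅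
  have himg : ∀ k : FreeGroup β, blowup ws '' (k • (J : Set (FreeGroup β))) =
      blowup ws k • ((J.map (blowup ws) : Subgroup (FreeGroup α)) : Set (FreeGroup α)) := by
    intro k
    rw [Subgroup.coe_map]
    ext x
    simp only [Set.mem_image, Set.mem_smul_set, smul_eq_mul]
    constructor
    · rintro ⟨_, ⟨j, hj, rfl⟩, rfl⟩
      exact ⟨_, ⟨j, hj, rfl⟩, (_root_.map_mul _ _ _).symm⟩
    · rintro ⟨_, ⟨j, hj, rfl⟩, rfl⟩
      exact ⟨_, ⟨j, hj, rfl⟩, _root_.map_mul _ _ _⟩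
  have hA₀ : ∀ k : FreeGroup β, blowup ws '' (k • (J : Set (FreeGroup β))) ∈
      splitCosets (J.map (blowup ws)) (cone Z) ↔
        k • (J : Set (FreeGroup β)) ∈ splitCosets J (cone (pullLetters ws Z)) := by
    intro k
    simp only [splitCosets, Set.mem_ofPred_eq, h.image_inter_cone, h.image_diff_cone,
      Set.infinite_image_iff h.blowup_injective.injOn]
    refine and_congr_left fun _ => ?_
    exact ⟨fun _ => ⟨k, rfl⟩, fun _ => ⟨_, himg k⟩⟩
  have hturn : ∀ x : I, (turns (ws x.1)).get x.2 =
      (bar ((ws x.1)[(x.2 : ℕ)]'(by have := hI x; omega)), (ws x.1)[(x.2 : ℕ) + 1]'(hI x)) :=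
    fun x => getElem_turns (hI x) _
  have hA : ∀ (x : I) (k : FreeGroup β), shiftedImage ws x.1 x.2 (k • (J : Set (FreeGroup β))) ∈
      splitCosets (J.map (blowup ws)) (cone Z) ↔
        SeparatesTurn Z ((turns (ws x.1)).get x.2) ∧
        k • (J : Set (FreeGroup β)) ∈ splitCosets J (cyl (x.1, true)) := by
    intro x k
    rw [splitCosets, Set.mem_ofPred_eq, h.shiftedImage_split_iff (hI x), hturn, splitCosets,
      Set.mem_ofPred_eq]
    have h1 : ∃ g, shiftedImage ws x.1 x.2 (k • (J : Set (FreeGroup β))) =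
        g • ((J.map (blowup ws) : Subgroup (FreeGroup α)) : Set (FreeGroup α)) :=
      ⟨_, by rw [shiftedImage, himg, smul_smul]⟩
    have h2 : ∃ g, k • (J : Set (FreeGroup β)) = g • (J : Set (FreeGroup β)) := ⟨k, rfl⟩
    tauto
  have hunion : splitCosets (J.map (blowup ws)) (cone Z) = A₀ ∪ ⋃ x, A x := by
    ext C
    constructor
    · intro hC
      obtain ⟨⟨g, hg⟩, hC1, hC2⟩ := id hC
      -- Elements on the two sides of the cone have different first letters, so `c₂⁻¹ * c₁` is
      -- written without cancellation. It lies in the image, and the end of its prefix `c₂⁻¹` tells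
      -- where on the rose `C` is based.
      obtain ⟨c₁, ⟨hc₁, hc₁Z⟩⟩ := hC1.nonempty
      obtain ⟨c₂, ⟨hc₂, hc₂Z⟩, hc₂1⟩ := hC2.exists_ne 1
      have hCc : C = c₂ • ((J.map (blowup ws) : Subgroup (FreeGroup α)) : Set (FreeGroup α)) := by
        rw [hg] at hc₂ ⊢
        exact (leftCoset_eq_iff _).mpr ((mem_leftCoset_iff _).mp hc₂)
      have h3 : c₂⁻¹ * c₁ ∈ J.map (blowup ws) := by
        rw [hCc] at hc₁
        exact (mem_leftCoset_iff _).mp hc₁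
      obtain ⟨j, -, hj⟩ := h3
      obtain ⟨z, hz, hz'⟩ := hc₁Z
      have h4 : (c₂⁻¹ * c₁).toWord = c₂⁻¹.toWord ++ c₁.toWord := by
        refine toWord_mul_of_getLast fun m hm hm' => ?_
        rw [toWord_inv, getLast?_invRev, Option.map_eq_some_iff] at hm
        obtain ⟨n, hn, rfl⟩ := hm
        rw [bar_bar] at hm'
        exact hc₂Z ⟨z, hz, (eq_of_mem_cyl hm' hz') ▸ hn⟩
      rw [← hj] at h4
      obtain ⟨k, hk | ⟨b, i, hi, hk⟩⟩ := h.exists_of_prefix j _ _ h4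
      · left
        have h5 : C = blowup ws '' (k⁻¹ • (J : Set (FreeGroup β))) := by
          rw [himg, hCc, _root_.map_inv, ← hk, mk_toWord, inv_inv]
        rw [h5, hA₀] at hC
        exact ⟨_, hC, h5.symm⟩
      · right
        have hi' : i < (turns (ws b)).length := by rw [length_turns]; omega
        have h5 : C = shiftedImage ws b i (k⁻¹ • (J : Set (FreeGroup β))) := by
          rw [shiftedImage, himg, hCc, smul_smul, _root_.map_inv, ← mul_inv_rev, ← hk, mk_toWord,
            inv_inv]
        rw [h5] at hC
        have h6 := (hA ⟨b, ⟨i, hi'⟩⟩ k⁻¹).mp hC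
        refine Set.mem_iUnion.mpr ⟨⟨b, ⟨i, hi'⟩⟩, ?_⟩
        simp only [A]
        rw [if_pos h6.1]
        exact ⟨_, h6.2, h5.symm⟩
    · rintro (⟨Q, hQ, rfl⟩ | hC)
      · obtain ⟨k, rfl⟩ := hQ.1
        exact (hA₀ k).mpr hQ
      · obtain ⟨x, hx⟩ := Set.mem_iUnion.mp hC
        simp only [A] at hx
        split_ifs at hx with hs
        · obtain ⟨Q, hQ, rfl⟩ := hx
          obtain ⟨k, rfl⟩ := hQ.1
          exact (hA x k).mpr ⟨hs, hQ⟩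
        · exact absurd hx (Set.notMem_empty _)
  have hne : ∀ {x : I} {C}, C ∈ A x → ∃ Q, (∃ q, q ∈ Q) ∧ C = shiftedImage ws x.1 x.2 Q := by
    intro x C hC
    simp only [A] at hC
    split_ifs at hC with hs
    · obtain ⟨Q, hQ, rfl⟩ := hC
      obtain ⟨q, hq⟩ := hQ.2.1.nonempty
      exact ⟨Q, ⟨q, hq.1⟩, rfl⟩
    · exact absurd hC (Set.notMem_empty _)
  -- No coset is counted twice: a common point would identify two points of the rose, by
  -- `eq_of_inv_take_mul_eq`.
  have hdisj : Disjoint A₀ (⋃ x, A x) := by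
    rw [Set.disjoint_left]
    rintro _ ⟨Q, -, rfl⟩ hC
    obtain ⟨x, hx⟩ := Set.mem_iUnion.mp hC
    obtain ⟨R, ⟨r, hr⟩, hR⟩ := hne hx
    simp only at hR
    have : (mk ((ws x.1).take (x.2 + 1)))⁻¹ * blowup ws r ∈ blowup ws '' Q := by
      rw [hR]
      exact Set.smul_mem_smul_set ⟨r, hr, rfl⟩
    obtain ⟨q, -, hq⟩ := this
    have h1 := h.eq_of_inv_take_mul_eq (b := x.1) (c := x.1) (i := x.2 + 1) (j := 0) (q := r) (r := q)
      (hI x).le (Nat.zero_le _) (by rw [← hq, List.take_zero]; simp [← one_eq_mk])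
    have := (XDigraph.petalPoint_eq_iff (Nat.succ_pos _) (hI x) h1).2
    omega
  have hpair : Pairwise (Function.onFun Disjoint A) := by
    intro x y hxy
    rw [Function.onFun, Set.disjoint_left]
    intro C hx hy
    obtain ⟨Q, ⟨q, hq⟩, hQ⟩ := hne hx
    obtain ⟨R, ⟨r, hr⟩, hR⟩ := hne hy
    have : (mk ((ws x.1).take (x.2 + 1)))⁻¹ * blowup ws q ∈ C := by
      rw [hQ]
      exact Set.smul_mem_smul_set ⟨q, hq, rfl⟩
    rw [hR] at this
    obtain ⟨_, ⟨r', hr', rfl⟩, e⟩ := this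
    have h1 := h.eq_of_inv_take_mul_eq (hI x).le (hI y).le e.symm
    obtain ⟨h2, h3⟩ := XDigraph.petalPoint_eq_iff (Nat.succ_pos _) (hI x) h1
    obtain ⟨b, i⟩ := x
    obtain ⟨c, j⟩ := y
    simp only at h2 h3
    subst h2
    exact hxy (by rw [Fin.ext (Nat.succ_injective h3)])
  have himginj : Function.Injective fun Q : Set (FreeGroup β) => blowup ws '' Q :=
    Set.image_injective.mpr h.blowup_injective
  rw [splitCount, hunion, Set.encard_union_eq hdisj, Set.encard_iUnion_of_finite hpair,
    finsum_eq_sum_of_fintype, himginj.encard_image, splitCount, Fintype.sum_sigma]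
  congr 1
  refine Finset.sum_congr rfl fun b _ => ?_
  rw [turnCount, countP_eq_sum_fin, Nat.cast_sum, Finset.sum_mul]
  refine Finset.sum_congr rfl fun i _ => ?_
  simp only [A]
  split_ifs with hs
  · have hinj : Function.Injective (shiftedImage ws b i) :=
      (MulAction.injective _).comp himginj
    rw [hinj.encard_image, Nat.cast_one, one_mul, splitCount]
  · simp

end FreeGroup

/-! ### Adjoining one word to a part of a basis -/

namespace FreeGroup

variable {α : Type u} {κ : Type}

/-- The turns of a cyclic word. -/
def cyclicTurns (w : List (α × Bool)) : List ((α × Bool) × (α × Bool)) :=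
  turns (w.getLast?.toList ++ w)

theorem cyclicTurns_eq {w : List (α × Bool)} {y z : α × Bool} (hy : w.getLast? = some y)
    (hz : w.head? = some z) : cyclicTurns w = (bar y, z) :: turns w := by
  cases w with
  | nil => simp at hz
  | cons a w =>
    obtain rfl : a = z := by simpa using hz
    rw [cyclicTurns, hy]
    rfl

theorem turns_cons_cons (x y : α × Bool) (w : List (α × Bool)) :
    turns (x :: y :: w) = (bar x, y) :: turns (y :: w) := rfl

theorem turns_singleton (x : α × Bool) : turns [x] = [] := rfl

theorem turnCount_nil (Z : Set (α × Bool)) : turnCount Z [] = 0 := rfl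

theorem turnCount_cons_of_separates {Z : Set (α × Bool)} {p : (α × Bool) × (α × Bool)} (h : SeparatesTurn Z p)
    (t : List ((α × Bool) × (α × Bool))) : turnCount Z (p :: t) = turnCount Z t + 1 := by
  simp [turnCount, h]

theorem turnCount_cons_of_not {Z : Set (α × Bool)} {p : (α × Bool) × (α × Bool)} (h : ¬ SeparatesTurn Z p)
    (t : List ((α × Bool) × (α × Bool))) : turnCount Z (p :: t) = turnCount Z t := by
  simp [turnCount, h]

theorem turnCount_ne_zero {Z : Set (α × Bool)} {p : (α × Bool) × (α × Bool)} (h : SeparatesTurn Z p)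
    {t : List ((α × Bool) × (α × Bool))} (hp : p ∈ t) : turnCount Z t ≠ 0 := by
  rw [turnCount, ← Nat.pos_iff_ne_zero, List.countP_pos_iff]
  exact ⟨p, hp, by simpa using h⟩

theorem exists_of_turnCount_ne_zero {Z : Set (α × Bool)} {t : List ((α × Bool) × (α × Bool))}
    (h : turnCount Z t ≠ 0) : ∃ p ∈ t, SeparatesTurn Z p := by
  rw [turnCount, ← Nat.pos_iff_ne_zero, List.countP_pos_iff] at h
  obtain ⟨p, hp, h⟩ := h
  exact ⟨p, hp, by simpa using h⟩

theorem turnCount_congr {Z W : Set (α × Bool)} {t : List ((α × Bool) × (α × Bool))}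
    (h : ∀ p ∈ t, (p.1 ∈ Z ↔ p.1 ∈ W) ∧ (p.2 ∈ Z ↔ p.2 ∈ W)) : turnCount Z t = turnCount W t := by
  refine List.countP_congr fun p hp => ?_
  have h1 := (h p hp).1
  have h2 := (h p hp).2
  have : SeparatesTurn Z p ↔ SeparatesTurn W p := by
    unfold SeparatesTurn
    tauto
  simpa using this

theorem exists_mem_turns_snd {x y : α × Bool} {w : List (α × Bool)} (hx : x ∈ w) :
    ∃ p ∈ turns (y :: w), p.2 = x := by
  induction w generalizing y with
  | nil => simp at hx
  | cons a w ih =>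
    rw [turns_cons_cons]
    rcases List.mem_cons.mp hx with rfl | hx
    · exact ⟨_, List.mem_cons_self, rfl⟩
    · obtain ⟨p, hp, e⟩ := ih (y := a) hx
      exact ⟨p, List.mem_cons_of_mem _ hp, e⟩

theorem exists_mem_turns_fst {x : α × Bool} {w : List (α × Bool)} (hx : x ∈ w.dropLast) :
    ∃ p ∈ turns w, p.1 = bar x := by
  induction w with
  | nil => simp at hx
  | cons a w ih =>
    cases w with
    | nil => simp at hx
    | cons b w =>
      rw [turns_cons_cons]
      rw [List.dropLast_cons_cons] at hx
      rcases List.mem_cons.mp hx with rfl | hx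
      · exact ⟨_, List.mem_cons_self, rfl⟩
      · obtain ⟨p, hp, e⟩ := ih hx
        exact ⟨p, List.mem_cons_of_mem _ hp, e⟩

theorem mem_of_mem_turns {p : (α × Bool) × (α × Bool)} {w : List (α × Bool)} (hp : p ∈ turns w) :
    bar p.1 ∈ w ∧ p.2 ∈ w := by
  induction w with
  | nil => simp [turns] at hp
  | cons a w ih =>
    cases w with
    | nil => simp [turns] at hp
    | cons b w =>
      rw [turns_cons_cons] at hp
      rcases List.mem_cons.mp hp with rfl | hp
      · simp
      · exact ⟨List.mem_cons_of_mem _ (ih hp).1, List.mem_cons_of_mem _ (ih hp).2⟩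

theorem ne_of_mem_turns {p : (α × Bool) × (α × Bool)} {w : List (α × Bool)} (hw : IsReduced w)
    (hp : p ∈ turns w) : p.1 ≠ p.2 := by
  induction w with
  | nil => simp [turns] at hp
  | cons a w ih =>
    cases w with
    | nil => simp [turns] at hp
    | cons b w =>
      rw [turns_cons_cons] at hp
      rw [isReduced_cons_cons_iff_ne_bar] at hw
      rcases List.mem_cons.mp hp with rfl | hp
      · exact hw.1.symm
      · exact ih hw.2 hp

/-- By symmetry an unseparated turn `(bar x, y)` means `x ∈ Z ↔ y ∈ Z`, which propagates along the
word. -/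
theorem turnCount_eq_zero_of_symmetric {Z : Set (α × Bool)} {w : List (α × Bool)} {x : α × Bool}
    (hZ : ∀ l ∈ x :: w, l ∈ Z ↔ bar l ∈ Z) (h : turnCount Z (turns (x :: w)) = 0) :
    ∀ l ∈ w, l ∈ Z ↔ x ∈ Z := by
  induction w generalizing x with
  | nil => simp
  | cons y w ih =>
    rw [turns_cons_cons] at h
    by_cases hs : SeparatesTurn Z (bar x, y)
    · rw [turnCount_cons_of_separates hs] at h
      exact absurd h (Nat.succ_ne_zero _)
    · rw [turnCount_cons_of_not hs] at h
      simp only [SeparatesTurn, not_not] at hs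
      have hxy : y ∈ Z ↔ x ∈ Z := hs.symm.trans (hZ x List.mem_cons_self).symm
      intro l hl
      rcases List.mem_cons.mp hl with rfl | hl
      · exact hxy
      · exact (ih (fun m hm => hZ m (List.mem_cons_of_mem _ hm)) h l hl).trans hxy

/-- The count is subadditive, and a turn between `l` and `y` is counted for each of the singletons
but not for the pair. -/
theorem turnCount_pair {l y : α × Bool} (hly : l ≠ y) {t : List ((α × Bool) × (α × Bool))}
    (ht : ∀ p ∈ t, p.1 ≠ p.2) (hp : (l, y) ∈ t ∨ (y, l) ∈ t) :
    turnCount {l, y} t + 2 ≤ turnCount {l} t + turnCount {y} t := by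
  have key : ∀ t : List ((α × Bool) × (α × Bool)), (∀ p ∈ t, p.1 ≠ p.2) →
      turnCount {l, y} t ≤ turnCount {l} t + turnCount {y} t := by
    intro t
    induction t with
    | nil => simp [turnCount]
    | cons p t ih =>
      intro ht
      have := ih fun q hq => ht q (List.mem_cons_of_mem _ hq)
      by_cases h : SeparatesTurn {l, y} p
      · have h' : SeparatesTurn {l} p ∨ SeparatesTurn {y} p := by
          simp only [SeparatesTurn, Set.mem_insert_iff, Set.mem_singleton_iff] at h ⊢
          tauto
        rw [turnCount_cons_of_separates h]
        rcases h' with h' | h'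
        · rw [turnCount_cons_of_separates h']
          have : turnCount {y} t ≤ turnCount {y} (p :: t) := by
            by_cases h : SeparatesTurn {y} p <;>
              simp [turnCount_cons_of_separates, turnCount_cons_of_not, h]
          omega
        · rw [turnCount_cons_of_separates h']
          have : turnCount {l} t ≤ turnCount {l} (p :: t) := by
            by_cases h : SeparatesTurn {l} p <;>
              simp [turnCount_cons_of_separates, turnCount_cons_of_not, h]
          omega
      · rw [turnCount_cons_of_not h]
        have h1 : turnCount {y} t ≤ turnCount {y} (p :: t) := by
          by_cases h : SeparatesTurn {y} p <;>
            simp [turnCount_cons_of_separates, turnCount_cons_of_not, h]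
        have h2 : turnCount {l} t ≤ turnCount {l} (p :: t) := by
          by_cases h : SeparatesTurn {l} p <;>
            simp [turnCount_cons_of_separates, turnCount_cons_of_not, h]
        omega
  have hperm : ∀ (q : (α × Bool) × (α × Bool)), q ∈ t → ¬ SeparatesTurn {l, y} q →
      SeparatesTurn {l} q → SeparatesTurn {y} q →
      turnCount {l, y} t + 2 ≤ turnCount {l} t + turnCount {y} t := by
    classical
    intro q hq h1 h2 h3
    have hc : ∀ Z : Set (α × Bool), turnCount Z t = turnCount Z (q :: t.erase q) := fun Z =>
      (List.perm_cons_erase hq).countP_eq _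
    rw [hc, hc {l}, hc {y}, turnCount_cons_of_not h1, turnCount_cons_of_separates h2,
      turnCount_cons_of_separates h3]
    have := key (t.erase q) fun p hp => ht p (List.mem_of_mem_erase hp)
    omega
  rcases hp with hp | hp
  · exact hperm _ hp (by simp [SeparatesTurn]) (by simp [SeparatesTurn, hly.symm])
      (by simp [SeparatesTurn, hly])
  · exact hperm _ hp (by simp [SeparatesTurn]) (by simp [SeparatesTurn, hly.symm])
      (by simp [SeparatesTurn, hly])

/-- The words that keep the generators `f j` and adjoin the word `w` as an additional generator. -/
def augment (f : κ → α) (w : List (α × Bool)) : Option κ → List (α × Bool)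
  | some j => [(f j, true)]
  | none => w

/-- A cyclically reduced non-empty word that avoids the generators `f j`. -/
structure IsComplementaryWord (f : κ → α) (w : List (α × Bool)) : Prop where
  intro ::
  cyclicallyReduced : IsCyclicallyReduced w
  ne_nil : w ≠ []
  notMem_range : ∀ l ∈ w, l.1 ∉ Set.range f

theorem mem_pullLetters_of_head {β : Type*} {ws : β → List (α × Bool)} {Z : Set (α × Bool)} {l : β × Bool}
    {m : α × Bool} (h : (block ws l).head? = some m) : l ∈ pullLetters ws Z ↔ m ∈ Z := by
  constructor
  · rintro ⟨n, hn, e⟩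
    rw [h, Option.some.injEq] at e
    rwa [e]
  · exact fun hm => ⟨m, hm, h⟩

theorem block_augment_some (f : κ → α) (w : List (α × Bool)) (j : κ) (s : Bool) :
    block (augment f w) (some j, s) = [(f j, s)] := by
  cases s <;> rfl

theorem some_mem_pullLetters {f : κ → α} {w : List (α × Bool)} {Z : Set (α × Bool)} {j : κ} {s : Bool} :
    (some j, s) ∈ pullLetters (augment f w) Z ↔ (f j, s) ∈ Z :=
  mem_pullLetters_of_head (by rw [block_augment_some]; rfl)

theorem none_true_mem_pullLetters {f : κ → α} {w : List (α × Bool)} {Z : Set (α × Bool)} {z : α × Bool}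
    (hz : w.head? = some z) : (none, true) ∈ pullLetters (augment f w) Z ↔ z ∈ Z :=
  mem_pullLetters_of_head hz

theorem none_false_mem_pullLetters {f : κ → α} {w : List (α × Bool)} {Z : Set (α × Bool)} {y : α × Bool}
    (hy : w.getLast? = some y) : (none, false) ∈ pullLetters (augment f w) Z ↔ bar y ∈ Z := by
  have : block (augment f w) (none, false) = invRev w := rfl
  exact mem_pullLetters_of_head (by rw [this, head?_invRev, hy]; rfl)

namespace IsComplementaryWord

variable {f : κ → α} {w : List (α × Bool)}

theorem exists_ends (h : IsComplementaryWord f w) :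
    ∃ y z, w.getLast? = some y ∧ w.head? = some z ∧ z ≠ bar y ∧ y.1 ∉ Set.range f ∧
      z.1 ∉ Set.range f := by
  have hy := List.getLast?_eq_some_getLast h.ne_nil
  have hz := List.head?_eq_some_head h.ne_nil
  refine ⟨_, _, hy, hz, fun e => ?_, h.notMem_range _ (List.getLast_mem _),
    h.notMem_range _ (List.head_mem _)⟩
  have := h.cyclicallyReduced.2 _ hy _ hz (by rw [e]; rfl)
  rw [e] at this
  simp [bar] at this

/-- Cyclic reducedness makes the two ends of the petal of `w` distinct directions, and neither
belongs to a generator `f j`. -/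
theorem isBlowup (h : IsComplementaryWord f w) (hf : Function.Injective f) :
    IsBlowup (augment f w) := by
  obtain ⟨y, z, hy, hz, hyz, hyf, hzf⟩ := h.exists_ends
  refine ⟨?_, ?_, ?_⟩
  · rintro (_ | j)
    · exact h.cyclicallyReduced.1
    · simp [augment]
  · rintro (_ | j)
    · exact h.ne_nil
    · simp [augment]
  · have h1 : (block (augment f w) (none, true)).head? = some z := hz
    have h2 : (block (augment f w) (none, false)).head? = some (bar y) := by
      have : block (augment f w) (none, false) = invRev w := rfl
      simp [this, head?_invRev, hy]
    rintro ⟨_ | i, s⟩ ⟨_ | j, s'⟩ e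
    · cases s <;> cases s' <;> simp_all
    · rw [block_augment_some] at e
      cases s <;> simp only [h1, h2, List.head?_cons, Option.some.injEq] at e
      · exact absurd ⟨j, by rw [← bar_fst y, e]⟩ hyf
      · exact absurd ⟨j, by rw [e]⟩ hzf
    · rw [block_augment_some] at e
      cases s' <;> simp only [h1, h2, List.head?_cons, Option.some.injEq] at e
      · exact absurd ⟨i, by rw [← bar_fst y, ← e]⟩ hyf
      · exact absurd ⟨i, by rw [← e]⟩ hzf
    · rw [block_augment_some, block_augment_some] at e
      simp only [List.head?_cons, Option.some.injEq, Prod.mk.injEq] at e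
      rw [hf e.1, e.2]

theorem isReduced_cons (h : IsComplementaryWord f w) {y : α × Bool} (hy : w.getLast? = some y) :
    IsReduced (y :: w) := by
  obtain ⟨y', z, hy', hz, hyz, -⟩ := h.exists_ends
  obtain rfl : y = y' := by rw [hy] at hy'; exact Option.some.inj hy'
  cases w with
  | nil => simp
  | cons a w =>
    obtain rfl : a = z := by simpa using hz
    rw [isReduced_cons_cons_iff_ne_bar]
    exact ⟨hyz, h.cyclicallyReduced.1⟩

theorem cyclicTurns_eq_cons (hy : w.getLast? = some y) : cyclicTurns w = turns (y :: w) := by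
  rw [cyclicTurns, hy]
  rfl

theorem ne_of_mem_cyclicTurns (h : IsComplementaryWord f w) {p : (α × Bool) × (α × Bool)}
    (hp : p ∈ cyclicTurns w) : p.1 ≠ p.2 := by
  obtain ⟨y, z, hy, -⟩ := h.exists_ends
  rw [cyclicTurns_eq_cons hy] at hp
  exact ne_of_mem_turns (h.isReduced_cons hy) hp

theorem mem_of_mem_cyclicTurns (h : IsComplementaryWord f w) {p : (α × Bool) × (α × Bool)}
    (hp : p ∈ cyclicTurns w) : bar p.1 ∈ w ∧ p.2 ∈ w := by
  obtain ⟨y, z, hy, -⟩ := h.exists_ends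
  have hyw : y ∈ w := List.mem_of_getLast? hy
  rw [cyclicTurns_eq_cons hy] at hp
  have := mem_of_mem_turns hp
  simp only [List.mem_cons] at this
  refine ⟨this.1.elim (fun e => e ▸ hyw) id, this.2.elim (fun e => e ▸ hyw) id⟩

/-- Each generator that occurs in a cyclically reduced word is seen from one of the turns. -/
theorem turnCount_singleton_ne_zero (h : IsComplementaryWord f w) {l : α × Bool}
    (hl : l ∈ w ∨ bar l ∈ w) : turnCount {l} (cyclicTurns w) ≠ 0 := by
  obtain ⟨y, z, hy, -⟩ := h.exists_ends
  rcases hl with hl | hl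
  · obtain ⟨p, hp, e⟩ := exists_mem_turns_snd (y := y) hl
    rw [← cyclicTurns_eq_cons hy] at hp
    have := h.ne_of_mem_cyclicTurns hp
    refine turnCount_ne_zero ?_ hp
    simp [SeparatesTurn, e, e ▸ this]
  · have : ∃ p ∈ turns (y :: w), p.1 = bar (bar l) := by
      refine exists_mem_turns_fst ?_
      cases w with
      | nil => simp at hl
      | cons a w =>
        rw [List.dropLast_cons_cons]
        by_cases e : bar l = y
        · simp [e]
        · refine List.mem_cons_of_mem _ ?_
          have := List.mem_dropLast_of_mem_of_ne_getLast hl (by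
            rw [List.getLast?_eq_some_getLast (List.cons_ne_nil a w)] at hy
            rwa [Option.some.inj hy])
          exact this
    obtain ⟨p, hp, e⟩ := this
    rw [bar_bar] at e
    rw [← cyclicTurns_eq_cons hy] at hp
    have := h.ne_of_mem_cyclicTurns hp
    refine turnCount_ne_zero ?_ hp
    have h2 : p.2 ≠ l := fun e' => this (e.trans e'.symm)
    simp [SeparatesTurn, e, h2]

variable [DecidableEq α] [DecidableEq κ] [Fintype κ]

theorem splitCount_map (h : IsComplementaryWord f w) (hf : Function.Injective f)
    (J : Subgroup (FreeGroup (Option κ))) (Z : Set (α × Bool)) :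
    splitCount (J.map (blowup (augment f w))) (cone Z) =
      splitCount J (cone (pullLetters (augment f w) Z)) +
        (turnCount Z (turns w) : ℕ∞) * splitCount J (cyl (none, true)) := by
  rw [(h.isBlowup hf).splitCount_map, Fintype.sum_option]
  simp [augment, turns_singleton, turnCount_nil]

end IsComplementaryWord

end FreeGroup

/-! ### Weighted split counts, free factors spanned by generators -/

namespace FreeGroup

section

variable {β : Type u}

theorem Separates.exists_mem_bar_notMem {Z : Set (β × Bool)} {b : β} (h : Separates Z b) :
    ∃ v ∈ Z, bar v ∉ Z ∧ v.1 = b := by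
  by_cases h1 : (b, true) ∈ Z
  · exact ⟨_, h1, fun h2 => h ⟨fun _ => h2, fun _ => h1⟩, rfl⟩
  · refine ⟨(b, false), ?_, h1, rfl⟩
    by_contra h2
    exact h ⟨fun h3 => absurd h3 h1, fun h3 => absurd h3 h2⟩

variable [DecidableEq β] [Fintype β]

/-- A weighted version of `totalSplit`. -/
noncomputable def weightedSplit (g : β → ℕ) (H : Subgroup (FreeGroup β)) : ℕ∞ :=
  ∑ b, (g b : ℕ∞) * splitCount H (cyl (b, true))

theorem weightedSplit_one (H : Subgroup (FreeGroup β)) :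
    weightedSplit (fun _ => 1) H = totalSplit H := by
  simp [weightedSplit, totalSplit]

/-- Only the term of the multiplier changes. The identity is stated without subtraction, which
misbehaves in `ℕ∞`. -/
theorem weightedSplit_map_whitehead_symm (g : β → ℕ) {Z : Set (β × Bool)} {v : β × Bool} (hv : v ∈ Z)
    (hv' : bar v ∉ Z) (H : Subgroup (FreeGroup β)) :
    weightedSplit g (H.map (whitehead Z v).symm.toMonoidHom) +
        g v.1 * splitCount H (cyl (v.1, true)) =
      weightedSplit g H + g v.1 * splitCount H (cone Z) := by
  rw [weightedSplit, weightedSplit, ← Finset.add_sum_erase _ _ (Finset.mem_univ v.1),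
    ← Finset.add_sum_erase (a := v.1) _ (fun b => (g b : ℕ∞) * splitCount H (cyl (b, true)))
      (Finset.mem_univ v.1),
    splitCount_map_whitehead_symm_self hv hv' H (l := (v.1, true)) rfl]
  have : ∀ b ∈ Finset.univ.erase v.1,
      (g b : ℕ∞) * splitCount (H.map (whitehead Z v).symm.toMonoidHom) (cyl (b, true)) =
        (g b : ℕ∞) * splitCount H (cyl (b, true)) := fun b hb => by
    rw [splitCount_map_whitehead_symm_of_ne hv hv' H (l := (b, true)) (Finset.ne_of_mem_erase hb)]
  rw [Finset.sum_congr rfl this]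
  ring

theorem weightedSplit_conj (g : β → ℕ) (H : Subgroup (FreeGroup β)) (x : FreeGroup β) :
    weightedSplit g (H.map (MulAut.conj x).toMonoidHom) = weightedSplit g H := by
  refine Finset.sum_congr rfl fun b _ => ?_
  rw [splitCount_conj (almostInvariant_cyl _)]

/-- If a Whitehead move does not decrease the weight, then the cut is at least as large as the
generator that it replaces. -/
theorem le_of_weightedSplit_le {g : β → ℕ} {Z : Set (β × Bool)} {v : β × Bool} (hv : v ∈ Z)
    (hv' : bar v ∉ Z) {H : Subgroup (FreeGroup β)} (hg : g v.1 ≠ 0) (hfin : weightedSplit g H ≠ ⊤)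
    (h : weightedSplit g H ≤ weightedSplit g (H.map (whitehead Z v).symm.toMonoidHom)) :
    splitCount H (cyl (v.1, true)) ≤ splitCount H (cone Z) := by
  have h1 := add_le_add_left h (g v.1 * splitCount H (cyl (v.1, true)))
  rw [weightedSplit_map_whitehead_symm g hv hv', ENat.add_le_add_iff_left hfin,
    ENat.mul_le_mul_left_iff (by exact_mod_cast hg) (by simp)] at h1
  exact h1

end

/-! ### Subgroups generated by letters -/

section

variable {α : Type u} [DecidableEq α]

/-- The elements whose reduced words use only generators in `S`. -/
def letterSubgroup (S : Set α) : Subgroup (FreeGroup α) where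
  carrier := {g | ∀ l ∈ g.toWord, l.1 ∈ S}
  one_mem' := by simp
  mul_mem' := fun {g h} hg hh l hl => by
    have := (toWord_mul_sublist g h).subset hl
    rcases List.mem_append.mp this with h | h
    · exact hg l h
    · exact hh l h
  inv_mem' := fun {g} hg l hl => by
    rw [toWord_inv] at hl
    simp only [invRev, List.mem_reverse, List.mem_map] at hl
    obtain ⟨m, hm, rfl⟩ := hl
    exact hg m hm

theorem mk_mem_closure {S : Set α} {w : List (α × Bool)} (hw : ∀ l ∈ w, l.1 ∈ S) :
    mk w ∈ Subgroup.closure (of '' S) := by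
  induction w with
  | nil => exact one_mem _
  | cons l w ih =>
    rw [mk_cons]
    refine mul_mem ?_ (ih fun m hm => hw m (List.mem_cons_of_mem _ hm))
    have : of l.1 ∈ Subgroup.closure (of '' S) :=
      Subgroup.subset_closure ⟨_, hw l List.mem_cons_self, rfl⟩
    obtain ⟨a, s⟩ := l
    cases s
    · rw [ltr_false]
      exact inv_mem this
    · exact this

theorem closure_eq_letterSubgroup (S : Set α) : Subgroup.closure (of '' S) = letterSubgroup S := by
  refine le_antisymm ((Subgroup.closure_le _).mpr ?_) fun g hg => ?_
  · rintro _ ⟨a, ha, rfl⟩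
    intro l hl
    rw [toWord_of, List.mem_singleton] at hl
    rwa [hl]
  · rw [← mk_toWord (x := g)]
    exact mk_mem_closure hg

theorem mk_mem_letterSubgroup {S : Set α} {w : List (α × Bool)} (hw : ∀ l ∈ w, l.1 ∈ S) :
    mk w ∈ letterSubgroup S := closure_eq_letterSubgroup S ▸ mk_mem_closure hw

theorem ltr_mem_letterSubgroup {S : Set α} {l : α × Bool} (hl : l.1 ∈ S) :
    ltr l ∈ letterSubgroup S := mk_mem_letterSubgroup (by simpa using hl)

theorem eqOn_letterSubgroup {S : Set α} {G : Type*} [Group G] {f g : FreeGroup α →* G}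
    (h : ∀ a ∈ S, f (of a) = g (of a)) {x : FreeGroup α} (hx : x ∈ letterSubgroup S) : f x = g x := by
  rw [← closure_eq_letterSubgroup] at hx
  refine MonoidHom.eqOn_closure ?_ hx
  rintro _ ⟨a, ha, rfl⟩
  exact h a ha

/-- Conjugation of a free factor extends to an automorphism that fixes the other generators. -/
theorem exists_conj_letterSubgroup {S : Set α} {g : FreeGroup α} (hg : g ∈ letterSubgroup S) :
    ∃ γ : FreeGroup α ≃* FreeGroup α, (∀ a ∉ S, γ (of a) = of a) ∧
      ∀ x ∈ letterSubgroup S, γ x = g⁻¹ * x * g := by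
  classical
  have key : ∀ k : FreeGroup α, ∀ x ∈ letterSubgroup S,
      twistHom (fun l => if l.1 ∈ S then k else 1) x = k * x * k⁻¹ := by
    intro k x hx
    refine eqOn_letterSubgroup (g := (MulAut.conj k).toMonoidHom) (fun a ha => ?_) hx
    simp [twistHom_of, ha]
  let c : α × Bool → FreeGroup α := fun l => if l.1 ∈ S then g⁻¹ else 1
  have hc : (fun l => (c l)⁻¹) = fun l => if l.1 ∈ S then g else 1 := by
    funext l
    by_cases h : l.1 ∈ S <;> simp [c, h]
  refine ⟨twistEquiv c (fun l => ?_) (fun l => ?_), fun a ha => ?_, fun x hx => ?_⟩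
  · by_cases h : l.1 ∈ S
    · have : c l = g⁻¹ := if_pos h
      rw [this, key _ _ (inv_mem hg)]
      group
    · have : c l = 1 := if_neg h
      rw [this, _root_.map_one]
  · rw [hc]
    by_cases h : l.1 ∈ S
    · have : c l = g⁻¹ := if_pos h
      rw [this, key _ _ (inv_mem hg)]
      group
    · have : c l = 1 := if_neg h
      rw [this, _root_.map_one]
  · rw [twistEquiv_apply, twistHom_of]
    simp [c, ha]
  · rw [twistEquiv_apply, key _ _ hx, inv_inv]

theorem infinite_cyl (l : α × Bool) : (cyl l).Infinite := by
  have key : ∀ n : ℕ, (ltr l ^ n).toWord = List.replicate n l := by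
    intro n
    induction n with
    | zero => simp
    | succ n ih =>
      rw [pow_succ', toWord_ltr_mul, ih]
      · rfl
      · rw [mem_cyl, ih]
        cases n
        · simp
        · simpa [List.replicate_succ] using (bar_ne l).symm
  refine Set.infinite_of_injective_forall_mem (f := fun n : ℕ => ltr l ^ (n + 1)) (fun m n h => ?_)
    fun n => ?_
  · have := congrArg (fun g => g.toWord.length) h
    simpa [key] using this
  · rw [mem_cyl, key]
    rfl

theorem splitCount_top {D : Set (FreeGroup α)} (h : D.Infinite) (h' : Dᶜ.Infinite) :
    splitCount ⊤ D = 1 := by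
  rw [splitCount, Set.encard_eq_one]
  refine ⟨Set.univ, ?_⟩
  ext C
  simp only [splitCosets, Set.mem_ofPred_eq, Set.mem_singleton_iff, Subgroup.coe_top,
    Set.smul_set_univ, exists_const]
  constructor
  · exact fun h => h.1
  · rintro rfl
    exact ⟨rfl, by rwa [Set.univ_inter], by rwa [← Set.compl_eq_univ_sdiff]⟩

theorem splitCount_top_cyl (l : α × Bool) : splitCount ⊤ (cyl l) = 1 := by
  refine splitCount_top (infinite_cyl l) ((infinite_cyl (bar l)).mono fun g hg hg' => ?_)
  exact bar_ne l (eq_of_mem_cyl hg hg')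

end

end FreeGroup

/-! ### Moves that preserve a decomposition with one adjoined word -/

namespace FreeGroup

variable {α : Type u} [DecidableEq α]

/-- In rank one a set of letters is, up to complement, empty or a single letter. The value `c` is
left open so that a difference of turn counts can be inserted. -/
theorem splitCount_top_cone_option (P : Set (Option Empty × Bool)) (c : ℕ)
    (h : Separates P none → c = 1) (h' : ¬ Separates P none → c = 0) :
    splitCount ⊤ (cone P) = c := by
  have hl : ∀ l : Option Empty × Bool, l = (none, true) ∨ l = (none, false) := by
    rintro ⟨_ | ⟨⟨⟩⟩, _ | _⟩ <;> simp
  have hset : ∀ Q : Set (Option Empty × Bool),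
      (∀ s, (none, s) ∈ P ↔ (none, s) ∈ Q) → P = Q := fun Q hQ => by
    ext l
    rcases hl l with rfl | rfl <;> exact hQ _
  by_cases h1 : (none, true) ∈ P <;> by_cases h2 : (none, false) ∈ P
  · rw [h' (by simp [Separates, h1, h2]), hset ∅ᶜ (by rintro (_ | _) <;> simp [h1, h2]),
      splitCount_cone_compl, cone_empty]
    simp [splitCount, splitCosets]
  · rw [h (by simp [Separates, h1, h2]), hset {(none, true)} (by rintro (_ | _) <;> simp [h1, h2]),
      cone_singleton, splitCount_top_cyl, Nat.cast_one]
  · rw [h (by simp [Separates, h1, h2]), hset {(none, false)} (by rintro (_ | _) <;> simp [h1, h2]),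
      cone_singleton, splitCount_top_cyl, Nat.cast_one]
  · rw [h' (by simp [Separates, h1, h2]), hset ∅ (by rintro (_ | _) <;> simp [h1, h2]), cone_empty]
    simp [splitCount, splitCosets]

theorem map_zpowers_mk (w : List (α × Bool)) (φ : FreeGroup α →* FreeGroup α) :
    (Subgroup.zpowers (mk w)).map φ = Subgroup.zpowers (φ (mk w)) :=
  MonoidHom.map_zpowers _ _

namespace IsComplementaryWord

variable {κ : Type} {f : κ → α} {w : List (α × Bool)}

/-- The two letters of `none` form the turn from the end of `w` to its beginning, which is the one
cyclic turn missing from `turns w`. -/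
theorem separates_pullLetters_none (h : IsComplementaryWord f w) (Z : Set (α × Bool)) :
    (Separates (pullLetters (augment f w) Z) none →
      turnCount Z (cyclicTurns w) = turnCount Z (turns w) + 1) ∧
    (¬ Separates (pullLetters (augment f w) Z) none →
      turnCount Z (cyclicTurns w) = turnCount Z (turns w)) := by
  obtain ⟨y, z, hy, hz, -⟩ := h.exists_ends
  rw [Separates, none_true_mem_pullLetters hz, none_false_mem_pullLetters hy,
    cyclicTurns_eq hy hz]
  refine ⟨fun h => turnCount_cons_of_separates ?_ _, fun h => turnCount_cons_of_not ?_ _⟩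
  · exact fun h' => h h'.symm
  · exact fun h' => h fun h'' => h' h''.symm

/-- The cyclic group is the image of the whole free group of rank one under the substitution of `w`,
so the formula for substitutions applies. -/
theorem splitCount_zpowers (h : IsComplementaryWord f w) (Z : Set (α × Bool)) :
    splitCount (Subgroup.zpowers (mk w)) (cone Z) = turnCount Z (cyclicTurns w) := by
  have h' : IsComplementaryWord (Empty.elim : Empty → α) w :=
    ⟨h.cyclicallyReduced, h.ne_nil, fun _ _ ⟨x, _⟩ => x.elim⟩
  have hJ : Subgroup.zpowers (mk w) =
      (⊤ : Subgroup (FreeGroup (Option Empty))).map (blowup (augment Empty.elim w)) := by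
    rw [← MonoidHom.range_eq_map, blowup, range_lift_eq_closure, Subgroup.zpowers_eq_closure]
    congr 1
    ext x
    constructor
    · rintro rfl
      exact ⟨none, rfl⟩
    · rintro ⟨_ | ⟨⟨⟩⟩, rfl⟩
      rfl
  have hs := h'.separates_pullLetters_none Z
  rw [hJ, h'.splitCount_map (fun x => x.elim), splitCount_top_cyl, mul_one,
    splitCount_top_cone_option _ (turnCount Z (cyclicTurns w) - turnCount Z (turns w))]
  · by_cases hP : Separates (pullLetters (augment Empty.elim w) Z) none
    · rw [hs.1 hP, Nat.add_sub_cancel_left, ← Nat.cast_add, add_comm]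
    · rw [hs.2 hP, Nat.sub_self, Nat.cast_zero, zero_add]
  · intro hP
    rw [hs.1 hP, Nat.add_sub_cancel_left]
  · intro hP
    rw [hs.2 hP, Nat.sub_self]

theorem mk_mem (h : IsComplementaryWord f w) : mk w ∈ letterSubgroup (Set.range f)ᶜ :=
  mk_mem_letterSubgroup h.notMem_range

theorem turnCount_inter (h : IsComplementaryWord f w) (Z : Set (α × Bool)) :
    turnCount (Z ∩ {l | l.1 ∉ Set.range f}) (cyclicTurns w) = turnCount Z (cyclicTurns w) := by
  refine turnCount_congr fun p hp => ?_
  have := h.mem_of_mem_cyclicTurns hp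
  have h1 : (bar p.1).1 ∉ Set.range f := h.notMem_range _ this.1
  have h2 : p.2.1 ∉ Set.range f := h.notMem_range _ this.2
  exact ⟨⟨fun h => h.1, fun h => ⟨h, h1⟩⟩, ⟨fun h => h.1, fun h => ⟨h, h2⟩⟩⟩

/-- A cyclically reduced conjugate of a non-trivial element of the complementary free factor. -/
theorem _root_.FreeGroup.exists_isComplementaryWord {x : FreeGroup α}
    (hx : x ∈ letterSubgroup (Set.range f)ᶜ) (hx1 : x ≠ 1) :
    ∃ w, IsComplementaryWord f w ∧ ∃ g ∈ letterSubgroup (Set.range f)ᶜ, x = g * mk w * g⁻¹ := by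
  have e := reduceCyclically.conj_conjugator_reduceCyclically x.toWord
  have hl : ∀ l ∈ reduceCyclically.conjugator x.toWord ++ reduceCyclically x.toWord, l.1 ∈ (Set.range f)ᶜ :=
    fun l hl => hx l (e ▸ List.mem_append_left _ hl)
  have e' : x = mk (reduceCyclically.conjugator x.toWord) * mk (reduceCyclically x.toWord) *
      (mk (reduceCyclically.conjugator x.toWord))⁻¹ := by
    rw [inv_mk, mul_mk, mul_mk, e, mk_toWord]
  refine ⟨reduceCyclically x.toWord, ⟨reduceCyclically.isCyclicallyReduced isReduced_toWord,
    fun h => hx1 ?_, fun l h => hl l (List.mem_append_right _ h)⟩, _,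
    mk_mem_letterSubgroup fun l h => hl l (List.mem_append_left _ h), e'⟩
  rw [h, ← one_eq_mk, mul_one, mul_inv_cancel] at e'
  exact e'

variable [Fintype α]

/-- A Whitehead move on the adjoined word, followed by a cyclic reduction. -/
theorem exists_move (h : IsComplementaryWord f w) (hmk : mk w ≠ 1) {Z : Set (α × Bool)} {b : α}
    (hb : b ∉ Set.range f) (hZ : Separates Z b) :
    ∃ (w' : List (α × Bool)) (ψ : FreeGroup α ≃* FreeGroup α), IsComplementaryWord f w' ∧
      (∀ j, ψ (of (f j)) = of (f j)) ∧ ψ (mk w) = mk w' ∧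
      (totalSplit (Subgroup.zpowers (mk w)) ≤ totalSplit (Subgroup.zpowers (mk w')) →
        turnCount {(b, true)} (cyclicTurns w) ≤ turnCount Z (cyclicTurns w)) := by
  have hZ' : Separates (Z ∩ {l | l.1 ∉ Set.range f}) b := by
    have : ∀ s, (b, s) ∈ Z ∩ {l | l.1 ∉ Set.range f} ↔ (b, s) ∈ Z := fun s =>
      ⟨fun h => h.1, fun h => ⟨h, hb⟩⟩
    rwa [Separates, this, this]
  obtain ⟨v, hv, hv', rfl⟩ := hZ'.exists_mem_bar_notMem
  -- The cut is restricted so that the automorphism fixes every `f j`; the turns of `w` do not see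
  -- the difference.
  set Y := Z ∩ {l | l.1 ∉ Set.range f} with hY
  have hvK : ltr v ∈ letterSubgroup (Set.range f)ᶜ := ltr_mem_letterSubgroup hb
  have hm : ∀ l, whiteheadMultiplier Y v l ∈ letterSubgroup (Set.range f)ᶜ := by
    intro l
    unfold whiteheadMultiplier
    split_ifs
    · exact inv_mem hvK
    · exact one_mem _
  have hK : (whitehead Y v).symm (mk w) ∈ letterSubgroup (Set.range f)ᶜ := by
    have : (letterSubgroup (Set.range f)ᶜ).map (whitehead Y v).symm.toMonoidHom ≤
        letterSubgroup (Set.range f)ᶜ := by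
      rw [← closure_eq_letterSubgroup, MonoidHom.map_closure, Subgroup.closure_le,
        closure_eq_letterSubgroup]
      rintro _ ⟨_, ⟨a, ha, rfl⟩, rfl⟩
      change (whitehead Y v).symm (of a) ∈ letterSubgroup (Set.range f)ᶜ
      rw [whitehead_symm_of]
      exact mul_mem (mul_mem (inv_mem (hm _)) (ltr_mem_letterSubgroup (l := (a, true)) ha)) (hm _)
    exact this ⟨_, h.mk_mem, rfl⟩
  obtain ⟨w', hw', g, hg, e⟩ := exists_isComplementaryWord hK (by simpa using hmk)
  -- Conjugation within the complementary factor, extended by the identity on the `f j`, makes the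
  -- image of `w` cyclically reduced.
  obtain ⟨γ, hγ, hγ'⟩ := exists_conj_letterSubgroup hg
  have hψ : ((whitehead Y v).symm.trans γ) (mk w) = mk w' := by
    rw [MulEquiv.trans_apply, hγ' _ hK, e]
    group
  refine ⟨w', (whitehead Y v).symm.trans γ, hw', fun j => ?_, hψ, fun hle => ?_⟩
  · rw [MulEquiv.trans_apply, whitehead_symm_of_notMem _ (fun h => h.2 ⟨j, rfl⟩)
      (fun h => h.2 ⟨j, rfl⟩), hγ _ (fun h => h ⟨j, rfl⟩)]
  · have h1 : Subgroup.zpowers (mk w') = ((Subgroup.zpowers (mk w)).map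
        (whitehead Y v).symm.toMonoidHom).map (MulAut.conj g⁻¹).toMonoidHom := by
      rw [map_zpowers_mk, MonoidHom.map_zpowers]
      congr 1
      change _ = g⁻¹ * (whitehead Y v).symm (mk w) * g⁻¹⁻¹
      rw [e]
      group
    rw [h1, ← weightedSplit_one, ← weightedSplit_one, weightedSplit_conj] at hle
    have h2 := le_of_weightedSplit_le hv hv' one_ne_zero ?_ hle
    · rw [← cone_singleton, h.splitCount_zpowers, h.splitCount_zpowers, Nat.cast_le, hY,
        h.turnCount_inter] at h2
      exact h2
    · refine WithTop.sum_ne_top.mpr fun b _ => ?_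
      rw [← cone_singleton, h.splitCount_zpowers, Nat.cast_one, one_mul]
      exact ENat.natCast_ne_top _

/-- As `τ` fixes the additional letter, the extension can fix all generators outside the range, and
so `mk w`; each `f j` goes where `τ` sends its letter. The same recipe for `τ.symm` gives the
inverse. -/
theorem exists_extension (h : IsComplementaryWord f w) (hf : Function.Injective f)
    (τ : FreeGroup (Option κ) ≃* FreeGroup (Option κ)) (hτ : τ (of none) = of none) :
    ∃ ψ : FreeGroup α ≃* FreeGroup α,
      ∀ x, ψ (blowup (augment f w) x) = blowup (augment f w) (τ x) := by
  classical
  let L : (FreeGroup (Option κ) ≃* FreeGroup (Option κ)) → FreeGroup α →* FreeGroup α := fun σ =>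
    lift fun a => if ha : ∃ j, f j = a then blowup (augment f w) (σ (of (some ha.choose))) else of a
  have hL1 : ∀ σ j, L σ (of (f j)) = blowup (augment f w) (σ (of (some j))) := by
    intro σ j
    have ha : ∃ i, f i = f j := ⟨j, rfl⟩
    have : ha.choose = j := hf ha.choose_spec
    simp only [L, lift_apply_of]
    rw [dif_pos ha, this]
  have hL2 : ∀ σ, ∀ a ∉ Set.range f, L σ (of a) = of a := by
    intro σ a ha
    simp only [L, lift_apply_of]
    exact dif_neg ha
  have hL3 : ∀ σ : FreeGroup (Option κ) ≃* FreeGroup (Option κ), σ (of none) = of none →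
      ∀ x, L σ (blowup (augment f w) x) = blowup (augment f w) (σ x) := by
    intro σ hσ x
    have : (L σ).comp (blowup (augment f w)) = (blowup (augment f w)).comp σ.toMonoidHom := by
      refine FreeGroup.ext_hom _ _ fun a => ?_
      rcases a with _ | j
      · change L σ (blowup (augment f w) (of none)) = blowup (augment f w) (σ (of none))
        rw [hσ, blowup_of]
        exact eqOn_letterSubgroup (g := MonoidHom.id _) (hL2 σ) h.mk_mem
      · change L σ (blowup (augment f w) (of (some j))) = blowup (augment f w) (σ (of (some j)))
        rw [← hL1, blowup_of]
        rfl
    exact DFunLike.congr_fun this x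
  have hτ' : τ.symm (of none) = of none := by rw [MulEquiv.symm_apply_eq, hτ]
  have hinv : ∀ σ : FreeGroup (Option κ) ≃* FreeGroup (Option κ), σ.symm (of none) = of none →
      (L σ.symm).comp (L σ) = MonoidHom.id _ := by
    intro σ hσ
    refine FreeGroup.ext_hom _ _ fun a => ?_
    by_cases ha : a ∈ Set.range f
    · obtain ⟨j, rfl⟩ := ha
      rw [MonoidHom.comp_apply, hL1, hL3 _ hσ, MulEquiv.symm_apply_apply, blowup_of]
      rfl
    · rw [MonoidHom.comp_apply, hL2 _ _ ha, hL2 _ _ ha]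
      rfl
  exact ⟨MonoidHom.toMulEquiv (L τ) (L τ.symm) (hinv τ hτ') (hinv τ.symm hτ), hL3 τ hτ⟩

end IsComplementaryWord

end FreeGroup

/-! ### A minimal position with one adjoined word -/

namespace FreeGroup

theorem _root_.ENat.exists_forall_le {ι : Type*} [Nonempty ι] (g : ι → ℕ∞) : ∃ i, ∀ j, g i ≤ g j := by
  obtain ⟨_, ⟨i, rfl⟩, h⟩ := wellFounded_lt.has_min (Set.range g) (Set.range_nonempty g)
  exact ⟨i, fun j => not_lt.mp (h _ ⟨j, rfl⟩)⟩

variable {α : Type u} [DecidableEq α]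

namespace IsComplementaryWord

variable {κ : Type} {f : κ → α} {w : List (α × Bool)}

theorem turnCount_singleton_congr (h : IsComplementaryWord f w) {l m : α × Bool} (e : l.1 = m.1) :
    turnCount {l} (cyclicTurns w) = turnCount {m} (cyclicTurns w) := by
  have := splitCount_cyl_of_fst_eq (Subgroup.zpowers (FreeGroup.mk w)) e
  rw [← cone_singleton, ← cone_singleton, h.splitCount_zpowers, h.splitCount_zpowers] at this
  exact_mod_cast this

/-- Suppose that `Z` cuts the cyclic word only at the turn between its ends. If `Z` is symmetric on
the generators outside the range, membership is constant along `w`, and that turn is not cut either.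
Otherwise minimality makes some generator `b` occur just once; joining to it a neighbouring letter
gives a cut smaller than that letter alone. -/
theorem turnCount_turns_ne_zero (h : IsComplementaryWord f w)
    (hU : ∀ (Z : Set (α × Bool)) (b : α), b ∉ Set.range f → Separates Z b →
      turnCount {(b, true)} (cyclicTurns w) ≤ turnCount Z (cyclicTurns w))
    (hocc : ∀ b ∉ Set.range f, ∃ l ∈ w, l.1 = b)
    (htwo : ∀ b, ∃ b' ∉ Set.range f, b' ≠ b) {Z : Set (α × Bool)}
    (hZ : Separates (pullLetters (augment f w) Z) none) : turnCount Z (turns w) ≠ 0 := by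
  intro hT
  have hc := (h.separates_pullLetters_none Z).1 hZ
  rw [hT, zero_add] at hc
  obtain ⟨y, z, hy, hz, -⟩ := h.exists_ends
  have hyw : y ∈ w := List.mem_of_getLast? hy
  by_cases hsym : ∀ b ∉ Set.range f, ¬ Separates Z b
  · have hs : ∀ l ∈ w, l ∈ Z ↔ bar l ∈ Z := fun l hl => by
      have := hsym _ (h.notMem_range l hl)
      rwa [separates_iff_letter, not_not] at this
    have hyz : y ∈ Z ↔ z ∈ Z := by
      cases w with
      | nil => simp at hz
      | cons x w =>
        obtain rfl : x = z := by simpa using hz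
        rcases List.mem_cons.mp hyw with rfl | hyw
        · rfl
        · exact turnCount_eq_zero_of_symmetric hs hT y hyw
    rw [Separates, none_true_mem_pullLetters hz, none_false_mem_pullLetters hy, ← hs y hyw] at hZ
    exact hZ hyz.symm
  · push Not at hsym
    obtain ⟨b, hb, hbZ⟩ := hsym
    have hone : ∀ l : α × Bool, l.1 = b → turnCount {l} (cyclicTurns w) = 1 := by
      intro l hl
      obtain ⟨m, hm, hmb⟩ := hocc b hb
      have h1 := h.turnCount_singleton_ne_zero (l := m) (Or.inl hm)
      have h2 := hU Z b hb hbZ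
      rw [hc, h.turnCount_singleton_congr (m := m) hmb.symm] at h2
      rw [h.turnCount_singleton_congr (hl.trans hmb.symm)]
      omega
    have hpair : ∃ y : α × Bool, y.1 ∉ Set.range f ∧ (b, true) ≠ y ∧
        (((b, true), y) ∈ cyclicTurns w ∨ (y, (b, true)) ∈ cyclicTurns w) := by
      obtain ⟨⟨p, q⟩, hp, hs⟩ := exists_of_turnCount_ne_zero (Z := {(b, true)}) (t := cyclicTurns w)
        (by rw [hone (b, true) rfl]; exact one_ne_zero)
      have hne := h.ne_of_mem_cyclicTurns hp
      have hmem := h.mem_of_mem_cyclicTurns hp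
      by_cases e : p = (b, true)
      · subst e
        exact ⟨q, h.notMem_range q hmem.2, hne, Or.inl hp⟩
      · have e' : q = (b, true) := by
          by_contra e'
          exact hs (by simp [e, e'])
        subst e'
        exact ⟨p, h.notMem_range (bar p) hmem.1, fun h => e h.symm, Or.inr hp⟩
    obtain ⟨x, hx, hbx, hp⟩ := hpair
    have hle := turnCount_pair hbx (fun p hp => h.ne_of_mem_cyclicTurns hp) hp
    rw [hone (b, true) rfl] at hle
    -- If the neighbour is the inverse letter, then no turn separates the letters of `b` from the
    -- rest, so `w` involves `b` only, against `hocc` and `htwo`.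
    by_cases hxb : x.1 = b
    · rw [hone x hxb] at hle
      have h0 : turnCount {(b, true), x} (cyclicTurns w) = 0 := by omega
      have hx' : x = (b, false) := by
        rcases eq_or_eq_bar_of_fst_eq (m := (b, true)) hxb with e | e
        · exact absurd e.symm hbx
        · exact e
      subst hx'
      have hW : ∀ l : α × Bool, l ∈ ({(b, true), (b, false)} : Set (α × Bool)) ↔ l.1 = b := by
        rintro ⟨a, _ | _⟩ <;> simp
      rw [cyclicTurns_eq_cons hy] at h0
      have hall := turnCount_eq_zero_of_symmetric (fun l _ => by rw [hW, hW, bar_fst]) h0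
      obtain ⟨b', hb', hne⟩ := htwo b
      obtain ⟨m, hm, rfl⟩ := hocc b hb
      obtain ⟨m', hm', rfl⟩ := hocc b' hb'
      exact hne ((hW _).mp ((hall _ hm').mpr ((hall _ hm).mp ((hW _).mpr rfl))))
    · have h1 : Separates {(b, true), x} x.1 := by
        rw [separates_iff_letter x]
        have h2 : bar x ≠ (b, true) := fun e => hxb (by rw [← bar_fst x, e])
        simp [h2, bar_ne]
      have h2 := hU _ _ hx h1
      rw [h.turnCount_singleton_congr (l := (x.1, true)) (m := x) rfl] at h2
      omega

variable [DecidableEq κ] [Fintype κ]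

theorem splitCount_map_cyl_range (h : IsComplementaryWord f w) (hf : Function.Injective f)
    (J : Subgroup (FreeGroup (Option κ))) (j : κ) :
    splitCount (J.map (blowup (augment f w))) (cyl (f j, true)) =
      splitCount J (cyl (some j, true)) := by
  obtain ⟨y, z, hy, hz, hyz, hyf, hzf⟩ := h.exists_ends
  have h1 : pullLetters (augment f w) {(f j, true)} = {(some j, true)} := by
    ext ⟨_ | i, s⟩
    · cases s
      · rw [none_false_mem_pullLetters hy]
        have : bar y ≠ (f j, true) := fun e => hyf ⟨j, by rw [← bar_fst y, e]⟩
        simp [this]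
      · rw [none_true_mem_pullLetters hz]
        have : z ≠ (f j, true) := fun e => hzf ⟨j, by rw [e]⟩
        simp [this]
    · rw [some_mem_pullLetters]
      simp [hf.eq_iff]
  have h2 : turnCount {(f j, true)} (turns w) = 0 := by
    by_contra h3
    obtain ⟨p, hp, hs⟩ := exists_of_turnCount_ne_zero h3
    have := mem_of_mem_turns hp
    refine hs ⟨fun e => absurd ⟨j, ?_⟩ (h.notMem_range _ this.1),
      fun e => absurd ⟨j, ?_⟩ (h.notMem_range _ this.2)⟩
    · rw [bar_fst, e]
    · rw [e]
  rw [← cone_singleton, h.splitCount_map hf, h1, h2, cone_singleton, Nat.cast_zero, zero_mul, add_zero]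

/-- Each occurrence of `b` in the cyclic word is traversed once for each edge of the additional
letter. The interior turns of the petal miss the turn between its ends; the pulled-back cone
accounts for it. -/
theorem splitCount_map_cyl_compl (h : IsComplementaryWord f w) (hf : Function.Injective f)
    (J : Subgroup (FreeGroup (Option κ))) {b : α} (hb : b ∉ Set.range f) :
    splitCount (J.map (blowup (augment f w))) (cyl (b, true)) =
      turnCount {(b, true)} (cyclicTurns w) * splitCount J (cyl (none, true)) := by
  obtain ⟨y, z, hy, hz, hyz, hyf, hzf⟩ := h.exists_ends
  have hsep := h.separates_pullLetters_none {(b, true)}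
  have hsome : ∀ i s, (some i, s) ∉ pullLetters (augment f w) {(b, true)} := by
    intro i s hi
    rw [some_mem_pullLetters, Set.mem_singleton_iff, Prod.mk.injEq] at hi
    exact hb ⟨i, hi.1⟩
  have htrue := none_true_mem_pullLetters (f := f) (Z := {(b, true)}) hz
  have hfalse := none_false_mem_pullLetters (f := f) (Z := {(b, true)}) hy
  rw [← cone_singleton (b, true), h.splitCount_map hf]
  by_cases hs : Separates (pullLetters (augment f w) {(b, true)}) none
  · rw [hsep.1 hs]
    have : splitCount J (cone (pullLetters (augment f w) {(b, true)})) =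
        splitCount J (cyl (none, true)) := by
      by_cases ht : ((none, true) : Option κ × Bool) ∈ pullLetters (augment f w) {(b, true)}
      · have : pullLetters (augment f w) {(b, true)} = {(none, true)} := by
          ext ⟨_ | i, _ | _⟩
          · simpa using fun h => hs ⟨fun _ => h, fun _ => ht⟩
          · simpa using ht
          · simpa using hsome i _
          · simpa using hsome i _
        rw [this, cone_singleton]
      · have : pullLetters (augment f w) {(b, true)} = {(none, false)} := by
          ext ⟨_ | i, _ | _⟩
          · simp only [Set.mem_singleton_iff, iff_true]
            by_contra hn
            exact hs ⟨fun h => absurd h ht, fun h => absurd h hn⟩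
          · simpa using ht
          · simpa using hsome i _
          · simpa using hsome i _
        rw [this, cone_singleton]
        exact splitCount_cyl_of_fst_eq _ rfl
    rw [this]
    push_cast
    ring
  · have : pullLetters (augment f w) {(b, true)} = ∅ := by
      have hn : ((none, true) : Option κ × Bool) ∉ pullLetters (augment f w) {(b, true)} := by
        intro ht
        rw [Separates, not_not] at hs
        have hz' := htrue.mp ht
        have hy' := hfalse.mp (hs.mp ht)
        rw [Set.mem_singleton_iff] at hz' hy'
        exact hyz (hz'.trans hy'.symm)
      ext ⟨_ | i, _ | _⟩
      · rw [Separates, not_not] at hs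
        simpa using fun h => hn (hs.mpr h)
      · simpa using hn
      · simpa using hsome i _
      · simpa using hsome i _
    rw [hsep.2 hs, this, cone_empty]
    simp [splitCount, splitCosets]

variable [Fintype α]

/-- Edges of the additional letter are multiplied by the cyclic length of `w`, which is the sum of
these turn counts. -/
theorem totalSplit_map (h : IsComplementaryWord f w) (hf : Function.Injective f)
    (J : Subgroup (FreeGroup (Option κ))) :
    totalSplit (J.map (blowup (augment f w))) = weightedSplit
      (fun o => o.elim (∑ a, turnCount {(a, true)} (cyclicTurns w)) fun _ => 1) J := by
  have key : ∀ a, splitCount (J.map (blowup (augment f w))) (cyl (a, true)) =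
      turnCount {(a, true)} (cyclicTurns w) * splitCount J (cyl (none, true)) +
        ∑ j, if f j = a then splitCount J (cyl (some j, true)) else 0 := by
    intro a
    by_cases ha : a ∈ Set.range f
    · obtain ⟨j, rfl⟩ := ha
      have : turnCount {(f j, true)} (cyclicTurns w) = 0 := by
        by_contra h3
        obtain ⟨p, hp, hs⟩ := exists_of_turnCount_ne_zero h3
        have := h.mem_of_mem_cyclicTurns hp
        refine hs ⟨fun e => absurd ⟨j, ?_⟩ (h.notMem_range _ this.1),
          fun e => absurd ⟨j, ?_⟩ (h.notMem_range _ this.2)⟩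
        · rw [bar_fst, e]
        · rw [e]
      rw [h.splitCount_map_cyl_range hf, this]
      simp [hf.eq_iff]
    · rw [h.splitCount_map_cyl_compl hf J ha, Finset.sum_eq_zero, add_zero]
      exact fun j _ => if_neg fun e => ha ⟨j, e⟩
  rw [totalSplit, Finset.sum_congr rfl fun a _ => key a, Finset.sum_add_distrib, Finset.sum_comm,
    weightedSplit, Fintype.sum_option, ← Finset.sum_mul]
  simp

end IsComplementaryWord

end FreeGroup

/-! ### The minimal position -/

namespace FreeGroup

variable {α : Type u} [DecidableEq α] [Fintype α] {κ : Type} [DecidableEq κ] [Fintype κ] {f : κ → α}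

theorem totalSplit_ne_top_iff {H : Subgroup (FreeGroup α)} :
    totalSplit H ≠ ⊤ ↔ ∀ a, splitCount H (cyl (a, true)) ≠ ⊤ := by
  rw [totalSplit]
  exact WithTop.sum_ne_top.trans ⟨fun h a => h a (Finset.mem_univ a), fun h a _ => h a⟩

theorem map_trans_toMonoidHom {G : Type*} [Group G] (H : Subgroup G) (φ ψ : G ≃* G) :
    H.map (φ.trans ψ).toMonoidHom = (H.map φ.toMonoidHom).map ψ.toMonoidHom := by
  rw [Subgroup.map_map]
  rfl

/-- The count of a cone is a count for `J` plus the contribution of the turns inside `w`. For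
generators outside the range the minimality of `w` bounds the turns; for the `f j` the minimality of
`J` bounds the cone. -/
theorem locallyMinimal_map_augment {w : List (α × Bool)} (h : IsComplementaryWord f w)
    (hf : Function.Injective f) {J : Subgroup (FreeGroup (Option κ))}
    (hU : ∀ (Z : Set (α × Bool)) (b : α), b ∉ Set.range f → Separates Z b →
      turnCount {(b, true)} (cyclicTurns w) ≤ turnCount Z (cyclicTurns w))
    (hJ : ∀ (Z : Set (Option κ × Bool)), Separates Z none →
      splitCount J (cyl (none, true)) ≤ splitCount J (cone Z))
    (hJ' : ∀ (Z : Set (Option κ × Bool)) (j : κ), ¬ Separates Z none → Separates Z (some j) →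
      splitCount J (cyl (some j, true)) ≤ splitCount J (cone Z))
    (hocc : ∀ b ∉ Set.range f, ∃ l ∈ w, l.1 = b) (htwo : ∀ b, ∃ b' ∉ Set.range f, b' ≠ b) :
    LocallyMinimal (J.map (blowup (augment f w))) := by
  intro Z a hZ
  have hs := h.separates_pullLetters_none Z
  set P := pullLetters (augment f w) Z with hP
  rw [h.splitCount_map hf]
  by_cases ha : a ∈ Set.range f
  · obtain ⟨j, rfl⟩ := ha
    rw [h.splitCount_map_cyl_range hf]
    have hPj : Separates P (some j) := by
      rwa [Separates, hP, some_mem_pullLetters, some_mem_pullLetters]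
    by_cases hn : Separates P none
    · have hT := h.turnCount_turns_ne_zero hU hocc htwo hn
      obtain ⟨v, hv, hv', hv1⟩ := hn.exists_mem_bar_notMem
      have hd : ∀ l : Option κ × Bool, l.1 = none → l ∉ P \ {v} := by
        intro l hl hlP
        rcases eq_or_eq_bar_of_fst_eq (hl.trans hv1.symm) with rfl | rfl
        · exact hlP.2 rfl
        · exact hv' hlP.1
      have h1 : ¬ Separates (P \ {v}) none := by
        rw [Separates, not_not]
        exact ⟨fun h => absurd h (hd _ rfl), fun h => absurd h (hd _ rfl)⟩
      have h2 : Separates (P \ {v}) (some j) := by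
        have : ∀ s, (some j, s) ∈ P \ {v} ↔ (some j, s) ∈ P := fun s =>
          ⟨fun h => h.1, fun h => ⟨h, fun e => by
            rw [Set.mem_singleton_iff] at e
            rw [← e] at hv1
            exact absurd hv1 (by simp)⟩⟩
        rwa [Separates, this, this]
      refine (hJ' _ j h1 h2).trans ?_
      rw [cone_diff, cone_singleton]
      refine (splitCount_diff_le _ _ _).trans (add_le_add_right ?_ _)
      rw [splitCount_cyl_of_fst_eq J (m := (none, true)) hv1]
      have : (1 : ℕ∞) ≤ (turnCount Z (turns w) : ℕ∞) := by
        exact_mod_cast Nat.one_le_iff_ne_zero.mpr hT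
      simpa using mul_le_mul_left this (splitCount J (cyl (none, true)))
    · exact (hJ' P j hn hPj).trans le_self_add
  · rw [h.splitCount_map_cyl_compl hf J ha]
    have h1 : (turnCount {(a, true)} (cyclicTurns w) : ℕ∞) ≤ turnCount Z (cyclicTurns w) := by
      exact_mod_cast hU Z a ha hZ
    refine (mul_le_mul_left h1 _).trans ?_
    by_cases hn : Separates P none
    · rw [hs.1 hn, Nat.cast_add, Nat.cast_one, add_mul, one_mul, add_comm]
      exact add_le_add_left (hJ P hn) _
    · rw [hs.2 hn]
      exact le_add_self

/-- A subgroup that can be moved into the subgroup generated by part of the basis and one complementary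
element can be moved there in a minimal position. -/
theorem exists_minimal_le_range_augment (hf : Function.Injective f) (hB : ∃ b, b ∉ Set.range f)
    {H : Subgroup (FreeGroup α)}
    (hfin : ∀ φ : FreeGroup α ≃* FreeGroup α, totalSplit (H.map φ.toMonoidHom) ≠ ⊤)
    (hfree : ∀ (φ : FreeGroup α ≃* FreeGroup α) (b : α),
      ¬ H.map φ.toMonoidHom ≤ Subgroup.closure (of '' {b}ᶜ))
    {w₀ : List (α × Bool)} (hw₀ : IsComplementaryWord f w₀) {φ₀ : FreeGroup α ≃* FreeGroup α}
    (h₀ : H.map φ₀.toMonoidHom ≤ (blowup (augment f w₀)).range) :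
    ∃ (φ : FreeGroup α ≃* FreeGroup α) (w : List (α × Bool)), IsComplementaryWord f w ∧
      H.map φ.toMonoidHom ≤ (blowup (augment f w)).range ∧
      ∀ φ' : FreeGroup α ≃* FreeGroup α,
        totalSplit (H.map φ.toMonoidHom) ≤ totalSplit (H.map φ'.toMonoidHom) := by
  obtain ⟨b₀, hb₀⟩ := hB
  by_cases htwo : ∀ b, ∃ b' ∉ Set.range f, b' ≠ b
  swap
  -- With a single generator outside the range, the word `b₀` gives the whole group, so any `φ` of
  -- least total will do.
  · push Not at htwo
    obtain ⟨b, hb⟩ := htwo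
    obtain rfl := hb b₀ hb₀
    obtain ⟨φ, hφ⟩ := ENat.exists_forall_le fun φ : FreeGroup α ≃* FreeGroup α =>
      totalSplit (H.map φ.toMonoidHom)
    refine ⟨φ, [(b₀, true)], ⟨IsCyclicallyReduced.singleton, by simp, by simpa using hb₀⟩, ?_, hφ⟩
    have : (blowup (augment f [(b₀, true)])).range = ⊤ := by
      rw [blowup, range_lift_eq_closure, eq_top_iff, ← closure_range_of, Subgroup.closure_le]
      rintro _ ⟨a, rfl⟩
      refine Subgroup.subset_closure ?_
      by_cases ha : a ∈ Set.range f
      · obtain ⟨j, rfl⟩ := ha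
        exact ⟨some j, rfl⟩
      · rw [hb a ha]
        exact ⟨none, rfl⟩
    rw [this]
    exact le_top
  -- the words that occur, and the subgroups that occur with a given word
  let State : List (α × Bool) → Subgroup (FreeGroup (Option κ)) → (FreeGroup α ≃* FreeGroup α) → Prop :=
    fun w J φ => J.map (blowup (augment f w)) = H.map φ.toMonoidHom
  have hs₀ : State w₀ ((H.map φ₀.toMonoidHom).comap (blowup (augment f w₀))) φ₀ :=
    Subgroup.map_comap_eq_self h₀
  have : Nonempty {w // IsComplementaryWord f w ∧ ∃ J φ, State w J φ} := ⟨w₀, hw₀, _, _, hs₀⟩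
  -- The word is minimised first, over all positions; the subgroup is minimised afterwards with that
  -- word fixed.
  obtain ⟨⟨w, hw, J₀, φ₁, hs₁⟩, hmin⟩ := ENat.exists_forall_le
    fun w : {w // IsComplementaryWord f w ∧ ∃ J φ, State w J φ} =>
      totalSplit (Subgroup.zpowers (mk w.1))
  have : Nonempty {p : Subgroup (FreeGroup (Option κ)) × (FreeGroup α ≃* FreeGroup α) //
    State w p.1 p.2} := ⟨(J₀, φ₁), hs₁⟩
  obtain ⟨⟨⟨J, φ⟩, hs⟩, hminJ⟩ := ENat.exists_forall_le
    fun p : {p : Subgroup (FreeGroup (Option κ)) × (FreeGroup α ≃* FreeGroup α) // State w p.1 p.2} =>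
      totalSplit (p.1.1.map (blowup (augment f w)))
  simp only at hs hmin hminJ
  have hw1 : mk w ≠ 1 := fun e => hw.ne_nil (by
    rw [← hw.cyclicallyReduced.1.reduce_eq, ← toWord_mk, e, toWord_one])
  -- A move of the word keeps `J₀` and leads to another admissible word, which cannot be shorter.
  have hU : ∀ (Z : Set (α × Bool)) (b : α), b ∉ Set.range f → Separates Z b →
      turnCount {(b, true)} (cyclicTurns w) ≤ turnCount Z (cyclicTurns w) := by
    intro Z b hb hZ
    obtain ⟨w', ψ, hw', hψ, hψw, hle⟩ := hw.exists_move hw1 hb hZ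
    refine hle (hmin ⟨w', hw', J₀, φ₁.trans ψ, ?_⟩)
    simp only [State] at hs₁ ⊢
    rw [map_trans_toMonoidHom, ← hs₁, Subgroup.map_map]
    congr 1
    refine FreeGroup.ext_hom _ _ fun a => ?_
    rw [MonoidHom.comp_apply, blowup_of, blowup_of]
    rcases a with _ | j
    · exact hψw.symm
    · exact (hψ j).symm
  let g : Option κ → ℕ := fun o => o.elim (∑ a, turnCount {(a, true)} (cyclicTurns w)) fun _ => 1
  have hg : ∀ o, g o ≠ 0 := by
    rintro (_ | j)
    · obtain ⟨l, hl⟩ := List.exists_mem_of_ne_nil _ hw.ne_nil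
      have h1 := hw.turnCount_singleton_ne_zero (Or.inl hl)
      rw [hw.turnCount_singleton_congr (l := l) (m := (l.1, true)) rfl] at h1
      intro h2
      exact h1 (Finset.sum_eq_zero_iff.mp h2 l.1 (Finset.mem_univ _))
    · exact one_ne_zero
  have hgfin : weightedSplit g J ≠ ⊤ := by
    rw [← hw.totalSplit_map hf, hs]
    exact hfin φ
  -- A Whitehead automorphism that fixes the additional letter extends to the large free group, so
  -- it leads to another admissible subgroup and cannot decrease the weight.
  have hmove : ∀ (Z : Set (Option κ × Bool)) (v : Option κ × Bool), v ∈ Z → bar v ∉ Z →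
      (whitehead Z v).symm (of none) = of none →
      splitCount J (cyl (v.1, true)) ≤ splitCount J (cone Z) := by
    intro Z v hv hv' hnone
    refine le_of_weightedSplit_le hv hv' (hg _) hgfin ?_
    obtain ⟨ψ, hψ⟩ := hw.exists_extension hf (whitehead Z v).symm hnone
    rw [← hw.totalSplit_map hf, ← hw.totalSplit_map hf]
    refine hminJ ⟨(J.map (whitehead Z v).symm.toMonoidHom, φ.trans ψ), ?_⟩
    simp only [State] at hs ⊢
    rw [map_trans_toMonoidHom, ← hs, Subgroup.map_map, Subgroup.map_map]
    congr 1
    ext1 a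
    exact (hψ _).symm
  -- The multiplier is the additional letter, and a Whitehead automorphism fixes its multiplier.
  have hJ : ∀ (Z : Set (Option κ × Bool)), Separates Z none →
      splitCount J (cyl (none, true)) ≤ splitCount J (cone Z) := by
    intro Z hZ
    obtain ⟨v, hv, hv', hv1⟩ := hZ.exists_mem_bar_notMem
    have := hmove Z v hv hv' (whitehead_symm_of_self _ hv1.symm)
    rwa [hv1] at this
  -- After passing to the complement if necessary, `Z` contains neither letter of `none`, which is
  -- then fixed.
  have hJ' : ∀ (Z : Set (Option κ × Bool)) (j : κ), ¬ Separates Z none → Separates Z (some j) →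
      splitCount J (cyl (some j, true)) ≤ splitCount J (cone Z) := by
    intro Z j hn hj
    have key : ∀ Z : Set (Option κ × Bool), (none, true) ∉ Z → (none, false) ∉ Z →
        Separates Z (some j) → splitCount J (cyl (some j, true)) ≤ splitCount J (cone Z) := by
      intro Z h1 h2 hj
      obtain ⟨v, hv, hv', hv1⟩ := hj.exists_mem_bar_notMem
      have := hmove Z v hv hv' (whitehead_symm_of_notMem _ h1 h2)
      rwa [hv1] at this
    rw [Separates, not_not] at hn
    by_cases h1 : (none, true) ∈ Z
    · rw [← splitCount_cone_compl]
      refine key _ (fun h => h h1) (fun h => h (hn.mp h1)) fun h => hj ?_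
      simp only [Set.mem_compl_iff] at h
      tauto
    · exact key Z h1 (fun h => h1 (hn.mpr h)) hj
  -- Otherwise the moved subgroup would lie in the free factor spanned by the other generators.
  have hocc : ∀ b ∉ Set.range f, ∃ l ∈ w, l.1 = b := by
    intro b hb
    by_contra! hno
    refine hfree φ b ?_
    rw [← hs]
    refine (Subgroup.map_le_range _ _).trans (range_lift_le ?_)
    rintro _ ⟨_ | j, rfl⟩
    · exact mk_mem_closure fun l hl => hno l hl
    · exact mk_mem_closure (by
        simp only [augment, List.mem_singleton, forall_eq]
        exact fun e => hb ⟨j, e⟩)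
  have hLM := locallyMinimal_map_augment hw hf hU hJ hJ' hocc htwo
  refine ⟨φ, w, hw, ?_, fun φ' => ?_⟩
  · rw [← hs]
    exact Subgroup.map_le_range _ _
  · have h1 := hLM.totalSplit_le (by rw [hs]; exact totalSplit_ne_top_iff.mp (hfin φ))
      (φ.symm.trans φ')
    rw [hs] at h1
    refine h1.trans_eq ?_
    rw [← map_trans_toMonoidHom]
    congr 2
    ext x
    simp

end FreeGroup

/-! ### Leaves and marked digraphs -/

namespace XDigraph

open FreeGroup

variable {X : Type u} {S : XDigraph.{u, v} X}

theorem IsLeaf.step_unique {x y z : S.V} (h : S.IsLeaf x) {l m : X × Bool} (hl : S.Step x l y)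
    (hm : S.Step x m z) : l = m := by
  obtain ⟨e, he, hl⟩ := hl
  obtain ⟨f, hf, hm⟩ := hm
  have hone : ∀ {s : Set S.E} {e : S.E}, e ∈ s → 1 ≤ s.encard := fun h =>
    Set.one_le_encard_iff_nonempty.mpr ⟨_, h⟩
  have htwo : ∀ {s : Set S.E} {e f : S.E}, e ∈ s → f ∈ s → e ≠ f → s.encard ≤ 1 → False :=
    fun he hf hne hs => hne (Set.encard_le_one_iff.mp hs _ _ he hf)
  unfold IsLeaf at h
  have h1 : (S.outLink x).encard ≤ 1 := h ▸ le_self_add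
  have h2 : (S.inLink x).encard ≤ 1 := h ▸ le_add_self
  have hmix : ∀ {e f : S.E}, S.src e = x → S.tgt f = x → False := fun he hf => by
    have := add_le_add (hone (s := S.outLink x) he) (hone (s := S.inLink x) hf)
    rw [h] at this
    exact absurd this (by decide)
  by_contra hne
  rcases hl with ⟨hl, hl1, -⟩ | ⟨hl, hl1, -⟩ <;> rcases hm with ⟨hm, hm1, -⟩ | ⟨hm, hm1, -⟩
  · refine htwo (s := S.outLink x) hl1 hm1 (fun h => hne ?_) h1
    subst h
    exact Prod.ext (he.symm.trans hf) (hl.trans hm.symm)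
  · exact hmix hl1 hm1
  · exact hmix hm1 hl1
  · refine htwo (s := S.inLink x) hl1 hm1 (fun h => hne ?_) h2
    subst h
    exact Prod.ext (he.symm.trans hf) (hl.trans hm.symm)

theorem IsFolded.exists_step_ne (hS : S.IsFolded) {x y : S.V} (h : ¬ S.IsLeaf x) {l : X × Bool}
    (hl : S.Step x l y) : ∃ m ≠ l, ∃ z, S.Step x m z := by
  by_contra! hno
  refine h ?_
  have hout : ∀ e ∈ S.outLink x, (S.label e, true) = l := fun e he => by
    by_contra hne
    exact hno _ hne _ ⟨e, rfl, Or.inl ⟨rfl, he, rfl⟩⟩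
  have hin : ∀ e ∈ S.inLink x, (S.label e, false) = l := fun e he => by
    by_contra hne
    exact hno _ hne _ ⟨e, rfl, Or.inr ⟨rfl, he, rfl⟩⟩
  obtain ⟨e, he, ⟨hl1, he1, -⟩ | ⟨hl1, he1, -⟩⟩ := hl
  · have h1 : S.outLink x = {e} := by
      ext f
      refine ⟨fun hf => hS.1 f e (hf.trans he1.symm) ?_, fun hf => hf ▸ he1⟩
      rw [he, ← hout f hf]
    have h2 : S.inLink x = ∅ := by
      refine Set.eq_empty_of_forall_notMem fun f hf => ?_
      rw [← hin f hf] at hl1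
      exact absurd hl1 (by simp)
    rw [IsLeaf, h1, h2]
    simp
  · have h1 : S.inLink x = {e} := by
      ext f
      refine ⟨fun hf => hS.2 f e (hf.trans he1.symm) ?_, fun hf => hf ▸ he1⟩
      rw [he, ← hin f hf]
    have h2 : S.outLink x = ∅ := by
      refine Set.eq_empty_of_forall_notMem fun f hf => ?_
      rw [← hout f hf] at hl1
      exact absurd hl1 (by simp)
    rw [IsLeaf, h1, h2]
    simp

/-- Elements of a free group attached to the vertices that satisfy the relations given by the edges,
modulo a subgroup. -/
def IsPotential (S : XDigraph.{u, v} X) (r : S.V → FreeGroup X) (H : Subgroup (FreeGroup X)) : Prop :=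
  ∀ e : S.E, r (S.src e) * of (S.label e) * (r (S.tgt e))⁻¹ ∈ H

theorem IsPotential.of_step {r : S.V → FreeGroup X} {H : Subgroup (FreeGroup X)}
    (h : S.IsPotential r H) {x y : S.V} {l : X × Bool} (hl : S.Step x l y) :
    r x * ltr l * (r y)⁻¹ ∈ H := by
  obtain ⟨a, s⟩ := l
  obtain ⟨e, rfl, ⟨rfl, rfl, rfl⟩ | ⟨rfl, rfl, rfl⟩⟩ := hl
  · exact h e
  · have := inv_mem (h e)
    rw [ltr_false]
    convert this using 1
    group

theorem IsPotential.of_isPath {r : S.V → FreeGroup X} {H : Subgroup (FreeGroup X)}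
    (h : S.IsPotential r H) {x y : S.V} {w : List (X × Bool)} (hw : S.IsPath x w y) :
    r x * FreeGroup.mk w * (r y)⁻¹ ∈ H := by
  induction w generalizing x with
  | nil =>
    rw [isPath_nil_iff] at hw
    subst hw
    simp [← one_eq_mk]
  | cons l w ih =>
    obtain ⟨z, hl, hw⟩ := isPath_cons_iff.mp hw
    have := mul_mem (h.of_step hl) (ih hw)
    rw [mk_cons]
    convert this using 1
    group

variable [DecidableEq X]

/-- Elements `r x` attached to the vertices such that the paths from `x` to `y` read the elements `g` for
which `r x * g * (r y)⁻¹` lies in `H`. -/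
def IsMarking (S : XDigraph.{u, v} X) (r : S.V → FreeGroup X) (H : Subgroup (FreeGroup X)) : Prop :=
  ∀ x y g, S.IsPath x g.toWord y ↔ r x * g * (r y)⁻¹ ∈ H

theorem exists_isMarking_of_represents (hconn : S.IsConnected) (hfold : S.IsFolded)
    {H : Subgroup (FreeGroup X)} (h : S.Represents H) : ∃ r, S.IsMarking r H := by
  obtain ⟨x₀, g, h⟩ := h
  choose w hw using hconn x₀
  let p : S.V → FreeGroup X := fun x => FreeGroup.mk (w x)
  have hp : ∀ x, S.IsPath x₀ (p x).toWord x := fun x => hfold.isPath_toWord_mk (hw x)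
  refine ⟨fun x => g⁻¹ * p x, fun x y k => ?_⟩
  have h1 : g⁻¹ * p x * k * (g⁻¹ * p y)⁻¹ ∈ H ↔
      p x * k * (p y)⁻¹ ∈ H.map (MulAut.conj g).toMonoidHom := by
    rw [Subgroup.mem_map_equiv]
    have : (MulAut.conj g).symm (p x * k * (p y)⁻¹) = g⁻¹ * p x * k * (g⁻¹ * p y)⁻¹ := by
      rw [MulAut.conj_symm_apply]
      group
    rw [this]
  rw [h1, h]
  constructor
  · exact fun hk => hfold.isPath_mul (hfold.isPath_mul (hp x) hk) (isPath_inv (hp y))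
  · intro hk
    have := hfold.isPath_mul (hfold.isPath_mul (isPath_inv (hp x)) hk) (hp y)
    convert this using 2
    group

namespace IsMarking

variable {r : S.V → FreeGroup X} {H : Subgroup (FreeGroup X)}

theorem isConnected (h : S.IsMarking r H) : S.IsConnected := fun x y =>
  ⟨((r x)⁻¹ * r y).toWord, (h x y _).mpr (by
    have : r x * ((r x)⁻¹ * r y) * (r y)⁻¹ = 1 := by group
    rw [this]
    exact one_mem _)⟩

theorem isPotential (h : S.IsMarking r H) : S.IsPotential r H := fun e => by
  refine (h _ _ _).mp ?_
  rw [toWord_of]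
  exact isPath_singleton_iff.mpr (step_edge S e)

theorem exists_step (h : S.IsMarking r H) (hH : H ≠ ⊥) (x : S.V) : ∃ l y, S.Step x l y := by
  obtain ⟨k, hk, hk1⟩ := H.bot_or_exists_ne_one.resolve_left hH
  have hp : S.IsPath x ((r x)⁻¹ * k * r x).toWord x := by
    rw [h]
    convert hk using 1
    group
  cases hw : ((r x)⁻¹ * k * r x).toWord with
  | nil =>
    rw [toWord_eq_nil_iff] at hw
    refine absurd ?_ hk1
    have : k = r x * ((r x)⁻¹ * k * r x) * (r x)⁻¹ := by group
    rw [this, hw]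
    group
  | cons l w =>
    rw [hw] at hp
    obtain ⟨y, hy, -⟩ := isPath_cons_iff.mp hp
    exact ⟨l, y, hy⟩

end IsMarking

theorem IsFolded.exists_long_path (hS : S.IsFolded) (hred : S.IsCyclicallyReduced) {l : X × Bool}
    {x y : S.V} (hl : S.Step x l y) (n : ℕ) :
    ∃ w z, S.IsPath x w z ∧ IsReduced w ∧ w.length = n + 1 ∧ w.head? = some l := by
  -- The last letter is kept apart because the next one must avoid its inverse; a vertex that is no
  -- leaf offers such a letter.
  have key : ∃ w m z, S.IsPath x (w ++ [m]) z ∧ IsReduced (w ++ [m]) ∧ w.length = n ∧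
      (w ++ [m]).head? = some l := by
    induction n with
    | zero => exact ⟨[], l, y, isPath_singleton_iff.mpr hl, by simp, rfl, rfl⟩
    | succ n ih =>
      obtain ⟨w, m, z, hp, hr, hn, hh⟩ := ih
      obtain ⟨z', h1, h2⟩ := isPath_append_iff.mp hp
      rw [isPath_singleton_iff] at h2
      obtain ⟨m', hm', z'', h3⟩ := hS.exists_step_ne (hred z) h2.bar
      refine ⟨w ++ [m], m', z'', hp.append (isPath_singleton_iff.mpr h3), ?_, by simp [hn], ?_⟩
      · refine IsReduced.append_overlap hr ?_ (by simp)
        change IsReduced (m :: m' :: [])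
        rw [isReduced_cons_cons_iff_ne_bar]
        exact ⟨hm', by simp⟩
      · rw [List.head?_append, hh]
        rfl
  obtain ⟨w, m, z, hp, hr, hn, hh⟩ := key
  exact ⟨_, z, hp, hr, by simp [hn], hh⟩

theorem _root_.AlmostInvariant.infinite_mul {G : Type*} [Group G] {E Q : Set G} (hE : AlmostInvariant E)
    (hQ : (Q ∩ E).Infinite) (a : G) : (Q ∩ {g | g ∈ E ∧ g * a ∈ E}).Infinite := by
  refine (hQ.sdiff (hE a)).mono ?_
  rintro g ⟨⟨h1, h2⟩, h3⟩
  simp only [rightBoundary, Set.mem_ofPred_eq, not_not] at h3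
  exact ⟨h1, h2, h3.mp h2⟩

/-! ### Vertices as cosets, and the number of edges -/

namespace IsMarking

variable {r : S.V → FreeGroup X} {H : Subgroup (FreeGroup X)}

/-- The coset attached to a vertex. -/
def coset (r : S.V → FreeGroup X) (H : Subgroup (FreeGroup X)) (x : S.V) : Set (FreeGroup X) :=
  (r x)⁻¹ • (H : Set (FreeGroup X))

theorem mem_coset {x : S.V} {g : FreeGroup X} : g ∈ coset r H x ↔ r x * g ∈ H := by
  rw [coset, Set.mem_smul_set_iff_inv_smul_mem, inv_inv]
  rfl

theorem coset_injective (h : S.IsMarking r H) : Function.Injective (coset r H) := by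
  intro x y hxy
  have h1 : (r y)⁻¹ ∈ coset r H x := by
    rw [hxy, mem_coset, mul_inv_cancel]
    exact one_mem _
  rw [mem_coset] at h1
  refine isPath_nil_iff.mp ?_
  rw [← toWord_one, h, mul_one]
  exact h1

/-- There are reduced paths of every positive length that start with `l`, so infinitely many
elements are read from `x` to one vertex `z`. Multiplying on the right by `(r z)⁻¹` moves them into
the coset, and all but finitely many keep their first letter. -/
theorem infinite_coset_inter_cyl [Finite S.V] (h : S.IsMarking r H) (hfold : S.IsFolded)
    (hred : S.IsCyclicallyReduced) {x y : S.V} {l : X × Bool} (hl : S.Step x l y) :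
    (coset r H x ∩ cyl l).Infinite := by
  have h1 : (⋃ z : S.V, {g : FreeGroup X | S.IsPath x g.toWord z} ∩ cyl l).Infinite := by
    choose w z hw hr hn hh using hfold.exists_long_path hred hl
    refine Set.infinite_of_injective_forall_mem (f := fun n => FreeGroup.mk (w n)) (fun m n e => ?_)
      fun n => ?_
    · have e' := congrArg (fun g => g.toWord.length) e
      simp only [toWord_mk, (hr _).reduce_eq, hn] at e'
      omega
    · refine Set.mem_iUnion.mpr ⟨z n, ?_, ?_⟩
      · exact hfold.isPath_toWord_mk (hw n)
      · rw [mem_cyl, toWord_mk, (hr n).reduce_eq, hh]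
  obtain ⟨z, hz⟩ : ∃ z : S.V, ({g : FreeGroup X | S.IsPath x g.toWord z} ∩ cyl l).Infinite := by
    by_contra! hfin
    exact h1 (Set.finite_iUnion hfin)
  have h2 := (almostInvariant_cyl l).infinite_mul hz (r z)⁻¹
  refine (h2.image (f := fun g => g * (r z)⁻¹) (mul_left_injective _).injOn).mono ?_
  rintro _ ⟨g, ⟨hg, hg1, hg2⟩, rfl⟩
  refine ⟨?_, hg2⟩
  rw [mem_coset, ← mul_assoc]
  exact (h _ _ _).mp hg

/-- Two elements of the coset on different sides of the cylinder give, after a shift by `r x₀`, a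
loop at `x₀` whose two halves do not cancel. The vertex between the halves has the given coset and
an edge reading `l`. -/
theorem exists_mem_coset_of_split [Nonempty S.V] (h : S.IsMarking r H) {l : X × Bool}
    {C : Set (FreeGroup X)} (hC : C ∈ splitCosets H (cyl l)) :
    ∃ x y, S.Step x l y ∧ C = coset r H x := by
  obtain ⟨x₀⟩ := ‹Nonempty S.V›
  obtain ⟨⟨g, rfl⟩, h1, h2⟩ := hC
  have h1' := (almostInvariant_cyl l).infinite_mul h1 (r x₀)
  have h2' := (almostInvariant_cyl l).compl.infinite_mul (Q := g • (H : Set (FreeGroup X)))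
    (by rwa [← Set.sdiff_eq]) (r x₀)
  obtain ⟨k₁, hk₁, -, hk₁'⟩ := h1'.nonempty
  obtain ⟨k₂, hk₂, -, hk₂'⟩ := h2'.nonempty
  have hk : k₂⁻¹ * k₁ ∈ H := by
    have e1 := (mem_leftCoset_iff g).mp hk₁
    have e2 := (mem_leftCoset_iff g).mp hk₂
    have := mul_mem (inv_mem e2) e1
    convert this using 1
    group
  have h3 : S.IsPath x₀ ((k₂ * r x₀)⁻¹ * (k₁ * r x₀)).toWord x₀ := by
    rw [h]
    convert hk using 1
    group
  rw [toWord_mul_of_getLast] at h3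
  · obtain ⟨x, -, h4⟩ := isPath_append_iff.mp h3
    have h5 := (h _ _ _).mp h4
    have h6 : r x * k₁ ∈ H := by
      convert h5 using 1
      group
    have hstep : ∃ y, S.Step x l y := by
      cases hw : (k₁ * r x₀).toWord with
      | nil =>
        rw [mem_cyl, hw] at hk₁'
        simp at hk₁'
      | cons m w =>
        rw [mem_cyl, hw] at hk₁'
        obtain rfl : m = l := by simpa using hk₁'
        rw [hw] at h4
        obtain ⟨y, hy, -⟩ := isPath_cons_iff.mp h4
        exact ⟨y, hy⟩
    obtain ⟨y, hy⟩ := hstep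
    refine ⟨x, y, hy, ?_⟩
    rw [coset, leftCoset_eq_iff]
    have e1 := (mem_leftCoset_iff g).mp hk₁
    have := mul_mem e1 (inv_mem h6)
    convert this using 1
    group
  · intro m hm hm'
    rw [toWord_inv, getLast?_invRev, Option.map_eq_some_iff] at hm
    obtain ⟨n, hn, rfl⟩ := hm
    rw [bar_bar] at hm'
    have := eq_of_mem_cyl hm' hk₁'
    subst this
    exact hk₂' hn

/-- A vertex with an edge reading `l` is no leaf, so it has another direction as well; both are
followed by infinitely many elements of the coset. -/
theorem splitCosets_eq [Finite S.V] [Nonempty S.V] (h : S.IsMarking r H) (hfold : S.IsFolded)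
    (hred : S.IsCyclicallyReduced) (l : X × Bool) :
    splitCosets H (cyl l) = coset r H '' {x | ∃ y, S.Step x l y} := by
  ext C
  constructor
  · intro hC
    obtain ⟨x, y, hy, rfl⟩ := h.exists_mem_coset_of_split hC
    exact ⟨x, ⟨y, hy⟩, rfl⟩
  · rintro ⟨x, ⟨y, hy⟩, rfl⟩
    refine ⟨⟨_, rfl⟩, h.infinite_coset_inter_cyl hfold hred hy, ?_⟩
    obtain ⟨m, hm, z, hz⟩ := hfold.exists_step_ne (hred x) hy
    refine (h.infinite_coset_inter_cyl hfold hred hz).mono fun g hg => ⟨hg.1, fun hg' => hm ?_⟩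
    exact eq_of_mem_cyl hg.2 hg'

/-- By foldedness an edge labelled `a` is determined by its initial vertex, and these vertices
correspond to the cosets split by the cylinder of `a`. -/
theorem card_eq_totalSplit [Fintype X] [Finite S.V] [Finite S.E] [Nonempty S.V]
    (h : S.IsMarking r H) (hfold : S.IsFolded) (hred : S.IsCyclicallyReduced) :
    (Nat.card S.E : ℕ∞) = totalSplit H := by
  have key : ∀ a : X, splitCount H (cyl (a, true)) = {e : S.E | S.label e = a}.encard := by
    intro a
    have h1 : {x : S.V | ∃ y, S.Step x (a, true) y} = S.src '' {e : S.E | S.label e = a} := by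
      ext x
      constructor
      · rintro ⟨y, e, he, ⟨-, h1, -⟩ | ⟨h1, -⟩⟩
        · exact ⟨e, he, h1⟩
        · simp at h1
      · rintro ⟨e, rfl, rfl⟩
        exact ⟨_, step_edge S e⟩
    rw [splitCount, h.splitCosets_eq hfold hred, h.coset_injective.encard_image, h1,
      Set.InjOn.encard_image]
    exact fun e he f hf hef => hfold.1 e f hef (he.trans hf.symm)
  rw [totalSplit, Finset.sum_congr rfl fun a _ => key a, ← finsum_eq_sum_of_fintype,
    ← Set.encard_iUnion_of_finite]
  · have : (⋃ a, {e : S.E | S.label e = a}) = Set.univ := by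
      ext e
      simp
    rw [this, Set.encard_univ, ENat.card_eq_coe_natCard]
  · intro a b hab
    rw [Function.onFun, Set.disjoint_left]
    intro e he he'
    exact hab (he.symm.trans he')

end IsMarking

end XDigraph

/-! ### Markings of automorphic images -/

namespace XDigraph

open FreeGroup

variable {X : Type u} {S G : XDigraph.{u, v} X}

/-! #### Folding -/

/-- The class of a vertex in the folded graph. -/
def toFold (G : XDigraph.{u, v} X) (x : G.V) : (fold G).V := Quotient.mk G.foldSetoidV x

theorem toFold_eq_iff {x y : G.V} : G.toFold x = G.toFold y ↔ FoldRel G x y := Quotient.eq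

theorem toFold_out (q : (fold G).V) : G.toFold (Quotient.out q) = q := Quotient.out_eq q

theorem fold_isFolded (G : XDigraph.{u, v} X) : (fold G).IsFolded := by
  constructor
  · intro e f
    induction e using Quotient.inductionOn with | h e
    induction f using Quotient.inductionOn with | h f
    intro h1 h2
    exact Quotient.sound ⟨h2, toFold_eq_iff.mp h1⟩
  · intro e f
    induction e using Quotient.inductionOn with | h e
    induction f using Quotient.inductionOn with | h f
    intro h1 h2
    exact Quotient.sound ⟨h2, FoldRel.into e f h2 (toFold_eq_iff.mp h1)⟩

theorem Step.toFold {x y : G.V} {l : X × Bool} (h : G.Step x l y) :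
    (fold G).Step (G.toFold x) l (G.toFold y) := by
  obtain ⟨e, h1, ⟨h2, rfl, rfl⟩ | ⟨h2, rfl, rfl⟩⟩ := h
  · exact ⟨Quotient.mk _ e, h1, Or.inl ⟨h2, rfl, rfl⟩⟩
  · exact ⟨Quotient.mk _ e, h1, Or.inr ⟨h2, rfl, rfl⟩⟩

theorem IsPath.toFold {x y : G.V} {w : List (X × Bool)} (h : G.IsPath x w y) :
    (fold G).IsPath (G.toFold x) w (G.toFold y) := by
  induction w generalizing x with
  | nil => rw [isPath_nil_iff.mp h]; exact IsPath.nil _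
  | cons l w ih =>
    obtain ⟨z, h1, h2⟩ := isPath_cons_iff.mp h
    exact isPath_cons_iff.mpr ⟨_, h1.toFold, ih h2⟩

/-- Edges with the same label impose the same relation, so a fold only identifies vertices whose
elements define the same right coset of `K`. -/
theorem IsPotential.of_foldRel {ρ : G.V → FreeGroup X} {K : Subgroup (FreeGroup X)}
    (h : G.IsPotential ρ K) {x y : G.V} (hxy : FoldRel G x y) : ρ x * (ρ y)⁻¹ ∈ K := by
  induction hxy with
  | refl x => rw [mul_inv_cancel]; exact one_mem _
  | symm _ ih =>
    have := inv_mem ih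
    rwa [mul_inv_rev, inv_inv] at this
  | trans _ _ ih ih' =>
    have := mul_mem ih ih'
    convert this using 1
    group
  | out e f hl _ ih =>
    have := mul_mem (mul_mem (inv_mem (h e)) ih) (h f)
    rw [hl] at this
    convert this using 1
    group
  | into e f hl _ ih =>
    have := mul_mem (mul_mem (h e) ih) (inv_mem (h f))
    rw [hl] at this
    convert this using 1
    group

theorem IsPotential.fold {ρ : G.V → FreeGroup X} {K : Subgroup (FreeGroup X)}
    (h : G.IsPotential ρ K) : (fold G).IsPotential (fun q => ρ (Quotient.out q)) K := by
  intro e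
  induction e using Quotient.inductionOn with | h e
  have h1 := h.of_foldRel (toFold_eq_iff.mp (toFold_out (G.toFold (G.src e))))
  have h2 := h.of_foldRel (toFold_eq_iff.mp (toFold_out (G.toFold (G.tgt e))))
  have := mul_mem (mul_mem h1 (h e)) (inv_mem h2)
  change ρ (Quotient.out (G.toFold (G.src e))) * of (G.label e) *
    (ρ (Quotient.out (G.toFold (G.tgt e))))⁻¹ ∈ K
  convert this using 1
  group

/-! #### Deleting leaves -/

theorem induce_step_iff {W : Set G.V} {x y : W} {l : X × Bool} :
    (G.induce W).Step x l y ↔ G.Step x.1 l y.1 := by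
  constructor
  · rintro ⟨e, h1, ⟨h2, rfl, rfl⟩ | ⟨h2, rfl, rfl⟩⟩
    · exact ⟨e.1, h1, Or.inl ⟨h2, rfl, rfl⟩⟩
    · exact ⟨e.1, h1, Or.inr ⟨h2, rfl, rfl⟩⟩
  · rintro ⟨e, h1, ⟨h2, h3, h4⟩ | ⟨h2, h3, h4⟩⟩
    · exact ⟨⟨e, h3 ▸ x.2, h4 ▸ y.2⟩, h1, Or.inl ⟨h2, Subtype.ext h3, Subtype.ext h4⟩⟩
    · exact ⟨⟨e, h4 ▸ y.2, h3 ▸ x.2⟩, h1, Or.inr ⟨h2, Subtype.ext h3, Subtype.ext h4⟩⟩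

theorem IsFolded.induce (hG : G.IsFolded) (W : Set G.V) : (G.induce W).IsFolded :=
  ⟨fun e f h h' => Subtype.ext (hG.1 e.1 f.1 (congrArg Subtype.val h) h'),
    fun e f h h' => Subtype.ext (hG.2 e.1 f.1 (congrArg Subtype.val h) h')⟩

theorem IsPotential.induce {ρ : G.V → FreeGroup X} {K : Subgroup (FreeGroup X)}
    (h : G.IsPotential ρ K) (W : Set G.V) : (G.induce W).IsPotential (fun x => ρ x.1) K :=
  fun e => h e.1

/-- A reduced path between other vertices does not visit a leaf. -/
theorem IsPath.induce_sdiff_leaf {W : Set G.V} {x : W} (hx : (G.induce W).IsLeaf x)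
    {w : List (X × Bool)} (hw : IsReduced w) {s t : W} (hs : s ≠ x) (ht : t ≠ x)
    (h : (G.induce W).IsPath s w t) :
    (G.induce (W \ {x.1})).IsPath ⟨s.1, s.2, fun e => hs (Subtype.ext e)⟩ w
      ⟨t.1, t.2, fun e => ht (Subtype.ext e)⟩ := by
  induction w generalizing s with
  | nil =>
    obtain rfl := isPath_nil_iff.mp h
    exact IsPath.nil _
  | cons l w ih =>
    obtain ⟨z, h1, h2⟩ := isPath_cons_iff.mp h
    have hz : z ≠ x := by
      rintro rfl
      cases w with
      | nil => exact ht (isPath_nil_iff.mp h2).symm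
      | cons m w =>
        obtain ⟨z', h3, -⟩ := isPath_cons_iff.mp h2
        exact (isReduced_cons_cons_iff_ne_bar.mp hw).1 (hx.step_unique h3 h1.bar)
    have h3 : G.Step s.1 l z.1 := induce_step_iff.mp h1
    exact isPath_cons_iff.mpr ⟨⟨z.1, z.2, fun e => hz (Subtype.ext e)⟩, induce_step_iff.mpr h3,
      ih (hw.infix ⟨[l], [], by simp⟩) hz h2⟩

/-- The neighbour of a leaf differs from it, since a loop would contribute two to the degree; hence
it survives. -/
theorem LeafDeletion.nonempty {W : Set G.V} (h : G.LeafDeletion W) [Nonempty G.V] : W.Nonempty := by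
  cases h with
  | start => exact Set.univ_nonempty
  | @delete W x _ hx =>
    have hother : ∃ y l, (G.induce W).Step x l y := by
      by_contra! hno
      have h1 : (G.induce W).outLink x = ∅ := Set.eq_empty_of_forall_notMem fun e he =>
        hno _ (_, true) ⟨e, rfl, Or.inl ⟨rfl, he, rfl⟩⟩
      have h2 : (G.induce W).inLink x = ∅ := Set.eq_empty_of_forall_notMem fun e he =>
        hno _ (_, false) ⟨e, rfl, Or.inr ⟨rfl, he, rfl⟩⟩
      have h3 : ((G.induce W).outLink x).encard + ((G.induce W).inLink x).encard = 1 := hx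
      rw [h1, h2] at h3
      simp at h3
    obtain ⟨y, l, hy⟩ := hother
    refine ⟨y.1, y.2, fun e => ?_⟩
    obtain rfl : y = x := Subtype.ext e
    exact bar_ne l (hx.step_unique hy.bar hy)

theorem exists_leafDeletion [Finite G.V] :
    ∃ W : Set G.V, G.LeafDeletion W ∧ (G.induce W).IsCyclicallyReduced := by
  have key : ∀ n, ∀ W : Set G.V, W.ncard = n → G.LeafDeletion W →
      ∃ W : Set G.V, G.LeafDeletion W ∧ (G.induce W).IsCyclicallyReduced := by
    intro n
    induction n using Nat.strong_induction_on with
    | _ n ih =>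
      intro W hn hW
      by_cases hred : (G.induce W).IsCyclicallyReduced
      · exact ⟨W, hW, hred⟩
      · rw [IsCyclicallyReduced, not_forall] at hred
        obtain ⟨x, hx⟩ := hred
        rw [not_not] at hx
        refine ih _ ?_ _ rfl (LeafDeletion.delete x hW hx)
        rw [← hn]
        exact Set.ncard_sdiff_singleton_lt_of_mem x.2 (Set.toFinite _)
  exact key _ _ rfl LeafDeletion.start

variable [DecidableEq X]

/-- A marking concerns reduced words only, and a reduced path between remaining vertices never
enters the deleted leaf. -/
theorem LeafDeletion.isMarking {r : G.V → FreeGroup X} {K : Subgroup (FreeGroup X)}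
    (h : G.IsMarking r K) {W : Set G.V} (hW : G.LeafDeletion W) :
    (G.induce W).IsMarking (fun x => r x.1) K := by
  induction hW with
  | start =>
    intro x y g
    constructor
    · intro hp
      have := (h.isPotential.induce Set.univ).of_isPath hp
      rwa [mk_toWord] at this
    · intro hg
      have hp := (h _ _ _).mpr hg
      have key : ∀ (w : List (X × Bool)) (x y : G.V), G.IsPath x w y →
          (G.induce Set.univ).IsPath ⟨x, trivial⟩ w ⟨y, trivial⟩ := by
        intro w
        induction w with
        | nil => intro x y h; rw [isPath_nil_iff.mp h]; exact IsPath.nil _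
        | cons l w ih =>
          intro x y h
          obtain ⟨z, h1, h2⟩ := isPath_cons_iff.mp h
          exact isPath_cons_iff.mpr ⟨⟨z, trivial⟩, induce_step_iff.mpr h1, ih z y h2⟩
      exact key _ _ _ hp
  | @delete W x hW hx ih =>
    intro s t g
    constructor
    · intro hp
      have := (h.isPotential.induce _).of_isPath hp
      rwa [mk_toWord] at this
    · intro hg
      have hp := (ih ⟨s.1, s.2.1⟩ ⟨t.1, t.2.1⟩ g).mpr hg
      have hs : (⟨s.1, s.2.1⟩ : W) ≠ x := fun e =>
        s.2.2 (Set.mem_singleton_iff.mpr (congrArg Subtype.val e))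
      have ht : (⟨t.1, t.2.1⟩ : W) ≠ x := fun e =>
        t.2.2 (Set.mem_singleton_iff.mpr (congrArg Subtype.val e))
      exact hp.induce_sdiff_leaf hx isReduced_toWord hs ht

/-! #### Subdividing -/

section Subdivide

variable (φ : FreeGroup X ≃* FreeGroup X)

theorem imageWord_length_pos (a : X) : 0 < (imageWord φ a).length := by
  rw [List.length_pos_iff, imageWord, Ne, toWord_eq_nil_iff, map_eq_one_iff _ φ.injective]
  exact of_ne_one a

theorem subdivPoint_zero (e : S.E) : subdivPoint φ S e 0 = Sum.inl (S.src e) := by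
  simp [subdivPoint]

theorem subdivPoint_length (e : S.E) :
    subdivPoint φ S e (imageWord φ (S.label e)).length = Sum.inl (S.tgt e) := by
  simp [subdivPoint, imageWord_length_pos]

theorem subdivide_step (e : S.E) {i : ℕ} (hi : i < (imageWord φ (S.label e)).length) :
    (subdivide φ S).Step (subdivPoint φ S e i) (imageWord φ (S.label e))[i]
      (subdivPoint φ S e (i + 1)) := by
  refine ⟨⟨e, i, hi⟩, rfl, ?_⟩
  cases hs : ((imageWord φ (S.label e))[i]).2 <;> simp [subdivide, hs]

theorem subdivide_isPath_take (e : S.E) (i : ℕ) (hi : i ≤ (imageWord φ (S.label e)).length) :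
    (subdivide φ S).IsPath (Sum.inl (S.src e)) ((imageWord φ (S.label e)).take i)
      (subdivPoint φ S e i) := by
  induction i with
  | zero => rw [subdivPoint_zero]; exact IsPath.nil _
  | succ i ih =>
    rw [List.take_add_one, List.getElem?_eq_getElem hi]
    exact (ih (by omega)).append (isPath_singleton_iff.mpr (subdivide_step φ e hi))

theorem subdivide_isPath_imageWord (e : S.E) :
    (subdivide φ S).IsPath (Sum.inl (S.src e)) (imageWord φ (S.label e)) (Sum.inl (S.tgt e)) := by
  have := subdivide_isPath_take φ e _ le_rfl
  rwa [List.take_length, subdivPoint_length] at this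

/-- The potential of the subdivided graph that is induced by a potential. -/
def subdivPotential (r : S.V → FreeGroup X) : (subdivide φ S).V → FreeGroup X :=
  Sum.elim (fun x => φ (r x)) fun p =>
    φ (r (S.src p.1.1)) * FreeGroup.mk ((imageWord φ (S.label p.1.1)).take p.1.2)

variable {φ} {r : S.V → FreeGroup X} {H : Subgroup (FreeGroup X)}

theorem mul_subdivPotential_inv_mem (h : S.IsPotential r H) (e : S.E) (i : ℕ)
    (hi : i ≤ (imageWord φ (S.label e)).length) :
    φ (r (S.src e)) * FreeGroup.mk ((imageWord φ (S.label e)).take i) *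
      (subdivPotential φ r (subdivPoint φ S e i))⁻¹ ∈ H.map φ.toMonoidHom := by
  rcases Nat.eq_zero_or_pos i with rfl | h0
  · rw [subdivPoint_zero, List.take_zero, ← one_eq_mk, mul_one]
    simp only [subdivPotential, Sum.elim_inl, mul_inv_cancel]
    exact one_mem _
  · rcases hi.lt_or_eq with hlt | rfl
    · have : subdivPoint φ S e i = Sum.inr ⟨(e, i), h0, hlt⟩ := by simp [subdivPoint, h0, hlt]
      rw [this]
      simp only [subdivPotential, Sum.elim_inr, mul_inv_cancel]
      exact one_mem _
    · rw [subdivPoint_length, List.take_length, imageWord, mk_toWord]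
      exact ⟨_, h e, by simp [subdivPotential]⟩

theorem IsPotential.subdivide (h : S.IsPotential r H) :
    (subdivide φ S).IsPotential (subdivPotential φ r) (H.map φ.toMonoidHom) := by
  rintro ⟨e, i, hi⟩
  have h1 := mul_subdivPotential_inv_mem (φ := φ) h e i hi.le
  have h2 := mul_subdivPotential_inv_mem (φ := φ) h e (i + 1) hi
  have h3 : FreeGroup.mk ((imageWord φ (S.label e)).take (i + 1)) =
      FreeGroup.mk ((imageWord φ (S.label e)).take i) * ltr (imageWord φ (S.label e))[i] := by
    rw [List.take_add_one, List.getElem?_eq_getElem hi]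
    exact mul_mk.symm
  have hlab : (XDigraph.subdivide φ S).label ⟨e, i, hi⟩ = ((imageWord φ (S.label e))[i]).1 := rfl
  rw [h3] at h2
  have hsrc : (XDigraph.subdivide φ S).src ⟨e, i, hi⟩ = if ((imageWord φ (S.label e))[i]).2 then
    subdivPoint φ S e i else subdivPoint φ S e (i + 1) := rfl
  have htgt : (XDigraph.subdivide φ S).tgt ⟨e, i, hi⟩ = if ((imageWord φ (S.label e))[i]).2 then
    subdivPoint φ S e (i + 1) else subdivPoint φ S e i := rfl
  rw [hlab, hsrc, htgt]
  generalize (imageWord φ (S.label e))[i] = l at h2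
  obtain ⟨a, _ | _⟩ := l
  · rw [ltr_false] at h2
    have := mul_mem (inv_mem h2) h1
    simp only [Bool.false_eq_true, if_false]
    convert this using 1
    group
  · rw [ltr_true] at h2
    have := mul_mem (inv_mem h1) h2
    simp only [if_true]
    convert this using 1
    group

theorem exists_isPath_fold_subdivide (x : (subdivide φ S).V) : ∃ (s : S.V) (k : FreeGroup X),
    subdivPotential φ r x = φ (r s) * k ∧
    (fold (subdivide φ S)).IsPath ((subdivide φ S).toFold (Sum.inl s)) k.toWord ((subdivide φ S).toFold x) := by
  rcases x with s | ⟨⟨e, i⟩, h0, hi⟩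
  · exact ⟨s, 1, by simp [subdivPotential], by rw [toWord_one]; exact IsPath.nil _⟩
  · refine ⟨S.src e, _, rfl, (fold_isFolded _).isPath_toWord_mk ?_⟩
    have := (subdivide_isPath_take φ e i hi.le).toFold
    have h1 : subdivPoint φ S e i = Sum.inr ⟨(e, i), h0, hi⟩ := by
      have h0' : 0 < i := h0
      have hi' : i < (imageWord φ (S.label e)).length := hi
      simp [subdivPoint, h0', hi']
    rwa [h1] at this

theorem IsPath.fold_subdivide {w : List (X × Bool)} {s t : S.V} (h : S.IsPath s w t) :
    (fold (subdivide φ S)).IsPath ((subdivide φ S).toFold (Sum.inl s)) (φ (FreeGroup.mk w)).toWord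
      ((subdivide φ S).toFold (Sum.inl t)) := by
  have hf := fold_isFolded (subdivide φ S)
  have hedge : ∀ e : S.E, (fold (subdivide φ S)).IsPath ((subdivide φ S).toFold (Sum.inl (S.src e)))
      (φ (of (S.label e))).toWord ((subdivide φ S).toFold (Sum.inl (S.tgt e))) := fun e =>
    (subdivide_isPath_imageWord φ e).toFold
  induction w generalizing s with
  | nil =>
    rw [isPath_nil_iff.mp h, ← one_eq_mk, _root_.map_one, toWord_one]
    exact IsPath.nil _
  | cons l w ih =>
    obtain ⟨z, h1, h2⟩ := isPath_cons_iff.mp h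
    rw [mk_cons, _root_.map_mul]
    refine hf.isPath_mul ?_ (ih h2)
    obtain ⟨a, b⟩ := l
    obtain ⟨e, rfl, ⟨rfl, rfl, rfl⟩ | ⟨rfl, rfl, rfl⟩⟩ := h1
    · exact hedge e
    · rw [ltr_false, _root_.map_inv]
      exact isPath_inv (hedge e)

/-- Potentials survive subdivision and folding, which gives one implication. For the other, an
element of the image of `H` comes from a path in `S`, to be completed at its ends by pieces of
subdivided edges. -/
theorem IsMarking.fold_subdivide (h : S.IsMarking r H) : (fold (subdivide φ S)).IsMarking
    (fun q => subdivPotential φ r (Quotient.out q)) (H.map φ.toMonoidHom) := by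
  have hf := fold_isFolded (subdivide φ S)
  intro p q g
  constructor
  · intro hp
    have := (h.isPotential.subdivide (φ := φ)).fold.of_isPath hp
    rwa [mk_toWord] at this
  · intro hg
    obtain ⟨s, k, hs, hsp⟩ := exists_isPath_fold_subdivide (r := r) (Quotient.out p)
    obtain ⟨t, m, ht, htp⟩ := exists_isPath_fold_subdivide (r := r) (Quotient.out q)
    rw [toFold_out] at hsp htp
    simp only [hs, ht] at hg
    have h1 : r s * φ.symm (k * g * m⁻¹) * (r t)⁻¹ ∈ H := by
      rw [Subgroup.mem_map_equiv] at hg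
      convert hg using 1
      simp only [_root_.map_mul, _root_.map_inv, MulEquiv.symm_apply_apply]
      group
    have h2 := ((h _ _ _).mpr h1).fold_subdivide (φ := φ)
    rw [mk_toWord, MulEquiv.apply_symm_apply] at h2
    have h3 := hf.isPath_mul (hf.isPath_mul (isPath_inv hsp) h2) htp
    convert h3 using 2
    group

end Subdivide

/-! #### Automorphic images -/

theorem finite_subdivide_V [Finite S.V] [Finite S.E] (φ : FreeGroup X ≃* FreeGroup X) :
    Finite (subdivide φ S).V := by
  have : Finite {p : S.E × ℕ // 0 < p.2 ∧ p.2 < (imageWord φ (S.label p.1)).length} :=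
    Finite.of_injective (β := Σ e : S.E, Fin (imageWord φ (S.label e)).length)
      (fun p => ⟨p.1.1, p.1.2, p.2.2⟩) (by
        rintro ⟨⟨e, i⟩, h⟩ ⟨⟨f, j⟩, h'⟩ hef
        simp only [Sigma.mk.injEq] at hef
        obtain ⟨rfl, h2⟩ := hef
        simpa using h2)
  exact inferInstanceAs (Finite (S.V ⊕ {p : S.E × ℕ // _}))

theorem finite_subdivide_E [Finite S.E] (φ : FreeGroup X ≃* FreeGroup X) :
    Finite (subdivide φ S).E :=
  inferInstanceAs (Finite (Σ e : S.E, Fin (imageWord φ (S.label e)).length))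

theorem Isomorphic.refl (T : XDigraph.{u, v} X) : T.Isomorphic T :=
  ⟨⟨id, id, fun _ => rfl, fun _ => rfl, fun _ => rfl⟩, Function.bijective_id, Function.bijective_id⟩

section Image

variable [Finite S.V] [Finite S.E] [Nonempty S.V] {r : S.V → FreeGroup X} {H : Subgroup (FreeGroup X)}

theorem IsMarking.leafDeletion_data (h : S.IsMarking r H) (φ : FreeGroup X ≃* FreeGroup X)
    {W : Set (fold (subdivide φ S)).V} (hW : (fold (subdivide φ S)).LeafDeletion W) :
    Finite ((fold (subdivide φ S)).induce W).V ∧ Finite ((fold (subdivide φ S)).induce W).E ∧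
      Nonempty ((fold (subdivide φ S)).induce W).V ∧ ((fold (subdivide φ S)).induce W).IsFolded ∧
      ∃ r', ((fold (subdivide φ S)).induce W).IsMarking r' (H.map φ.toMonoidHom) := by
  have h1 := finite_subdivide_V (S := S) φ
  have h2 := finite_subdivide_E (S := S) φ
  have h3 : Finite (fold (subdivide φ S)).V := inferInstanceAs (Finite (Quotient _))
  have h4 : Finite (fold (subdivide φ S)).E := inferInstanceAs (Finite (Quotient _))
  have h5 : Nonempty (fold (subdivide φ S)).V :=
    ⟨(subdivide φ S).toFold (Sum.inl (Classical.arbitrary S.V))⟩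
  exact ⟨inferInstanceAs (Finite W), inferInstanceAs (Finite {e : (fold (subdivide φ S)).E // _}),
    hW.nonempty.to_subtype, (fold_isFolded _).induce W, _, hW.isMarking h.fold_subdivide⟩

theorem IsMarking.exists_isImage (h : S.IsMarking r H) (φ : FreeGroup X ≃* FreeGroup X) :
    ∃ T : XDigraph.{u, v} X, IsImage φ S T ∧ Finite T.V ∧ Finite T.E ∧ Nonempty T.V ∧ T.IsFolded ∧
      T.IsCyclicallyReduced ∧ ∃ r', T.IsMarking r' (H.map φ.toMonoidHom) := by
  have h1 := finite_subdivide_V (S := S) φ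
  have h3 : Finite (fold (subdivide φ S)).V := inferInstanceAs (Finite (Quotient _))
  obtain ⟨W, hW, hred⟩ := exists_leafDeletion (G := fold (subdivide φ S))
  obtain ⟨a1, a2, a3, a4, a5⟩ := h.leafDeletion_data φ hW
  exact ⟨_, ⟨W, hW, hred, Isomorphic.refl _⟩, a1, a2, a3, a4, hred, a5⟩

/-- The count comes from the subgroup, so it is independent of the order in which leaves are
deleted. -/
theorem IsMarking.card_image_eq [Fintype X] (h : S.IsMarking r H) {φ : FreeGroup X ≃* FreeGroup X}
    {T : XDigraph.{u, v} X} (hT : IsImage φ S T) :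
    (Nat.card T.E : ℕ∞) = totalSplit (H.map φ.toMonoidHom) := by
  obtain ⟨W, hW, hred, f, -, hf⟩ := hT
  obtain ⟨a1, a2, a3, a4, r', a5⟩ := h.leafDeletion_data φ hW
  rw [Nat.card_eq_of_bijective _ hf, a5.card_eq_totalSplit a4 hred]

end Image

end XDigraph

/-! ### Immersions onto graphs with property (S) -/

namespace XDigraph

open FreeGroup

variable {X : Type u}

theorem Hom.step {S T : XDigraph.{u, v} X} (f : Hom S T) {x y : S.V} {l : X × Bool} (h : S.Step x l y) :
    T.Step (f.onV x) l (f.onV y) := by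
  obtain ⟨e, h1, ⟨h2, rfl, rfl⟩ | ⟨h2, rfl, rfl⟩⟩ := h
  · exact ⟨f.onE e, (f.label_onE e).trans h1, Or.inl ⟨h2, f.src_onE e, f.tgt_onE e⟩⟩
  · exact ⟨f.onE e, (f.label_onE e).trans h1, Or.inr ⟨h2, f.tgt_onE e, f.src_onE e⟩⟩

theorem Hom.isPath {S T : XDigraph.{u, v} X} (f : Hom S T) {x y : S.V} {w : List (X × Bool)}
    (h : S.IsPath x w y) : T.IsPath (f.onV x) w (f.onV y) := by
  induction w generalizing x with
  | nil => rw [isPath_nil_iff.mp h]; exact IsPath.nil _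
  | cons l w ih =>
    obtain ⟨z, h1, h2⟩ := isPath_cons_iff.mp h
    exact isPath_cons_iff.mpr ⟨_, f.step h1, ih h2⟩

/-- A path that leaves a set of vertices crosses an edge that leaves it. -/
theorem IsPath.exists_step_out {G : XDigraph.{u, v} X} {W : Set G.V} {x y : G.V} {w : List (X × Bool)}
    (h : G.IsPath x w y) (hx : x ∈ W) (hy : y ∉ W) : ∃ a b l, a ∈ W ∧ b ∉ W ∧ G.Step a l b := by
  induction w generalizing x with
  | nil => exact absurd (isPath_nil_iff.mp h ▸ hx) hy
  | cons l w ih =>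
    obtain ⟨z, h1, h2⟩ := isPath_cons_iff.mp h
    by_cases hz : z ∈ W
    · exact ih h2 hz
    · exact ⟨x, z, l, hx, hz, h1⟩

variable [DecidableEq X]

/-- A connected graph of rank one has a potential in a cyclic group. -/
theorem exists_isPotential_zpowers {G : XDigraph.{u, v} X} [Finite G.V] [Finite G.E] (hG : G.IsConnected)
    (hcard : Nat.card G.E = Nat.card G.V) {B : Set X} (hB : ∀ e, G.label e ∈ B) (p : G.V) :
    ∃ (η : G.V → FreeGroup X) (g : FreeGroup X), η p = 1 ∧ g ∈ letterSubgroup B ∧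
      G.IsPotential η (Subgroup.zpowers g) := by
  classical
  -- A tree with `n + 1` vertices and `n` edges is grown from `p`, with trivial relations along its
  -- edges. Once it contains all vertices, exactly one edge is left over, and its relation is the
  -- generator.
  have key : ∀ n, n + 1 ≤ Nat.card G.V → ∃ (W : Set G.V) (F : Set G.E) (η : G.V → FreeGroup X),
      p ∈ W ∧ W.ncard = n + 1 ∧ F.ncard = n ∧ (∀ e ∈ F, G.src e ∈ W ∧ G.tgt e ∈ W) ∧
      (∀ e ∈ F, η (G.src e) * of (G.label e) * (η (G.tgt e))⁻¹ = 1) ∧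
      (∀ x, η x ∈ letterSubgroup B) ∧ η p = 1 := by
    intro n
    induction n with
    | zero =>
      intro _
      exact ⟨{p}, ∅, fun _ => 1, rfl, by simp, by simp, by simp, by simp, fun _ => one_mem _, rfl⟩
    | succ n ih =>
      intro hn
      obtain ⟨W, F, η, hp, hW, hF, hFW, hη, hηB, hηp⟩ := ih (by omega)
      obtain ⟨y, hy⟩ : ∃ y, y ∉ W := by
        by_contra! hall
        have : W = Set.univ := Set.eq_univ_of_forall hall
        rw [this, Set.ncard_univ] at hW
        omega
      obtain ⟨w, hw⟩ := hG p y
      obtain ⟨a, b, l, ha, hb, hstep⟩ := hw.exists_step_out hp hy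
      have hl : ltr l ∈ letterSubgroup B := by
        obtain ⟨e, he, -⟩ := hstep
        exact ltr_mem_letterSubgroup (he ▸ hB e)
      have hupd : ∀ x ∈ W, Function.update η b (η a * ltr l) x = η x := fun x hx =>
        Function.update_of_ne (by rintro rfl; exact hb hx) _ _
      have hupd' : Function.update η b (η a * ltr l) b = η a * ltr l := Function.update_self _ _ _
      obtain ⟨e, he, hends⟩ := hstep
      have heF : e ∉ F := fun heF => by
        have := hFW e heF
        rcases hends with ⟨-, -, h⟩ | ⟨-, -, h⟩
        · exact hb (h ▸ this.2)
        · exact hb (h ▸ this.1)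
      refine ⟨insert b W, insert e F, Function.update η b (η a * ltr l), Or.inr hp, ?_, ?_, ?_, ?_, ?_, ?_⟩
      · rw [Set.ncard_insert_of_notMem hb, hW]
      · rw [Set.ncard_insert_of_notMem heF, hF]
      · rintro e' (rfl | he')
        · rcases hends with ⟨-, h1, h2⟩ | ⟨-, h1, h2⟩
          · exact ⟨Or.inr (h1 ▸ ha), Or.inl h2⟩
          · exact ⟨Or.inl h2, Or.inr (h1 ▸ ha)⟩
        · exact ⟨Or.inr (hFW e' he').1, Or.inr (hFW e' he').2⟩
      · rintro e' (rfl | he')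
        · obtain ⟨c, s⟩ := l
          simp only at he
          rcases hends with ⟨hs, h1, h2⟩ | ⟨hs, h1, h2⟩ <;> simp only at hs <;> subst hs
          · rw [h1, h2, hupd a ha, hupd', he, ltr_true, mul_inv_cancel]
          · rw [h1, h2, hupd a ha, hupd', he, ltr_false]
            group
        · rw [hupd _ (hFW e' he').1, hupd _ (hFW e' he').2, hη e' he']
      · intro x
        by_cases hx : x = b
        · rw [hx, hupd']
          exact mul_mem (hηB a) hl
        · rw [Function.update_of_ne hx]
          exact hηB x
      · rw [hupd p hp, hηp]
  have hpos : 0 < Nat.card G.V := Nat.card_pos_iff.mpr ⟨⟨p⟩, inferInstance⟩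
  obtain ⟨W, F, η, hp, hW, hF, hFW, hη, hηB, hηp⟩ := key (Nat.card G.V - 1) (by omega)
  have hFc : Fᶜ.ncard = 1 := by
    have := Set.ncard_add_ncard_compl F
    omega
  obtain ⟨e₀, he₀⟩ := Set.ncard_eq_one.mp hFc
  refine ⟨η, η (G.src e₀) * of (G.label e₀) * (η (G.tgt e₀))⁻¹, hηp,
    mul_mem (mul_mem (hηB _) (ltr_mem_letterSubgroup (l := (_, true)) (hB e₀))) (inv_mem (hηB _)),
    fun e => ?_⟩
  by_cases he : e ∈ F
  · rw [hη e he]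
    exact one_mem _
  · have : e ∈ Fᶜ := he
    rw [he₀, Set.mem_singleton_iff] at this
    rw [this]
    exact Subgroup.mem_zpowers _

/-- The fundamental group of a graph with property (S) is generated by part of the basis and one element of the
complementary free factor. -/
theorem PropertyS.exists_isPotential {T : XDigraph.{u, v} X} {A B : Set X} (hT : T.PropertyS A B) :
    ∃ (η : T.V → FreeGroup X) (g : FreeGroup X), g ∈ letterSubgroup B ∧
      T.IsPotential η (Subgroup.closure (of '' A ∪ {g})) := by
  classical
  obtain ⟨⟨⟨p, hpA⟩⟩, hsub⟩ := hT.bouquet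
  obtain ⟨hfV, hfE, ⟨q⟩, hconn, hcard⟩ := hT.rankOne
  -- The potential must be trivial at the vertex `p` of the bouquet, so `p` is the root of the
  -- `B`-graph if it lies there; otherwise `q` is a default root.
  obtain ⟨p', hp'⟩ : ∃ p' : (T.spanned B).V, ∀ h : ∃ e : T.E, T.label e ∈ B ∧ (T.src e = p ∨ T.tgt e = p),
      p' = ⟨p, h⟩ := by
    by_cases h : ∃ e : T.E, T.label e ∈ B ∧ (T.src e = p ∨ T.tgt e = p)
    · exact ⟨⟨p, h⟩, fun _ => rfl⟩
    · exact ⟨q, fun h' => absurd h' h⟩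
  obtain ⟨η, g, hη, hg, hpot⟩ := exists_isPotential_zpowers hconn hcard (B := B) (fun e => e.2) p'
  let η' : T.V → FreeGroup X := fun t =>
    if h : ∃ e : T.E, T.label e ∈ B ∧ (T.src e = t ∨ T.tgt e = t) then η ⟨t, h⟩ else 1
  have hη' : ∀ t (h : ∃ e : T.E, T.label e ∈ B ∧ (T.src e = t ∨ T.tgt e = t)), η' t = η ⟨t, h⟩ :=
    fun t h => dif_pos h
  have hp1 : η' p = 1 := by
    by_cases h : ∃ e : T.E, T.label e ∈ B ∧ (T.src e = p ∨ T.tgt e = p)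
    · rw [hη' p h, ← hp' h, hη]
    · exact dif_neg h
  refine ⟨η', g, hg, fun e => ?_⟩
  by_cases he : T.label e ∈ B
  · rw [hη' _ ⟨e, he, Or.inl rfl⟩, hη' _ ⟨e, he, Or.inr rfl⟩]
    have : Subgroup.zpowers g ≤ Subgroup.closure (of '' A ∪ {g}) := by
      rw [Subgroup.zpowers_le]
      exact Subgroup.subset_closure (Or.inr rfl)
    exact this (hpot ⟨e, he⟩)
  · have heA : T.label e ∈ A := by
      have := hT.isCompl.compl_eq
      rw [← compl_compl A, this]
      exact he
    have hs : T.src e = p :=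
      congrArg Subtype.val (hsub.elim ((T.spanned A).src ⟨e, heA⟩) ⟨p, hpA⟩)
    have ht : T.tgt e = p :=
      congrArg Subtype.val (hsub.elim ((T.spanned A).tgt ⟨e, heA⟩) ⟨p, hpA⟩)
    rw [hs, ht, hp1, one_mul, inv_one, mul_one]
    exact Subgroup.subset_closure (Or.inl ⟨_, heA, rfl⟩)

theorem IsMarking.exists_map_conj_le {S T : XDigraph.{u, v} X} [Nonempty S.V] {r : S.V → FreeGroup X}
    {H : Subgroup (FreeGroup X)} (h : S.IsMarking r H) (f : Hom S T) {η : T.V → FreeGroup X}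
    {K : Subgroup (FreeGroup X)} (hK : T.IsPotential η K) :
    ∃ c, H.map (MulAut.conj c).toMonoidHom ≤ K := by
  obtain ⟨x⟩ := ‹Nonempty S.V›
  refine ⟨η (f.onV x) * (r x)⁻¹, ?_⟩
  rintro _ ⟨k, hk : k ∈ H, rfl⟩
  have h1 : S.IsPath x ((r x)⁻¹ * k * r x).toWord x := by
    rw [h]
    convert hk using 1
    group
  have h2 := hK.of_isPath (f.isPath h1)
  rw [mk_toWord] at h2
  change η (f.onV x) * (r x)⁻¹ * k * (η (f.onV x) * (r x)⁻¹)⁻¹ ∈ K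
  convert h2 using 1
  group

/-- Within the complementary factor `g` is conjugate to a cyclically reduced word, and this
conjugation extends to an automorphism that fixes the `f j`. -/
theorem _root_.FreeGroup.exists_isComplementaryWord_map_le {κ : Type} {f : κ → X}
    {H : Subgroup (FreeGroup X)} {c g : FreeGroup X} (hg : g ∈ letterSubgroup (Set.range f)ᶜ) (hg1 : g ≠ 1)
    (hH : H.map (MulAut.conj c).toMonoidHom ≤ Subgroup.closure (of '' Set.range f ∪ {g})) :
    ∃ (w : List (X × Bool)) (φ : FreeGroup X ≃* FreeGroup X), IsComplementaryWord f w ∧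
      H.map φ.toMonoidHom ≤ (blowup (augment f w)).range := by
  obtain ⟨w, hw, k, hk, e⟩ := exists_isComplementaryWord hg hg1
  obtain ⟨γ, hγ, hγ'⟩ := exists_conj_letterSubgroup hk
  refine ⟨w, (MulAut.conj c).trans γ, hw, ?_⟩
  rw [map_trans_toMonoidHom]
  refine (Subgroup.map_mono hH).trans ?_
  rw [MonoidHom.map_closure, Subgroup.closure_le]
  rintro _ ⟨x, ⟨_, ⟨j, rfl⟩, rfl⟩ | rfl, rfl⟩
  · refine ⟨of (some j), ?_⟩
    rw [blowup_of]
    exact (hγ _ (fun h => h ⟨j, rfl⟩)).symm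
  · refine ⟨of none, ?_⟩
    rw [blowup_of]
    change FreeGroup.mk w = γ x
    rw [hγ' _ hg, e]
    group

theorem _root_.FreeGroup.not_map_le_of_not_le_properFreeFactor {H : Subgroup (FreeGroup X)}
    (h : ∀ K : Subgroup (FreeGroup X), IsProperFreeFactor K → ¬ H ≤ K)
    (φ : FreeGroup X ≃* FreeGroup X) (b : X) :
    ¬ H.map φ.toMonoidHom ≤ Subgroup.closure (of '' {b}ᶜ) := by
  intro hle
  refine h ((Subgroup.closure (of '' {b}ᶜ)).map φ.symm.toMonoidHom)
    ⟨X, (FreeGroupBasis.ofFreeGroup X).map φ.symm, {b}ᶜ, ?_, ?_⟩ fun x hx => ?_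
  · intro e
    exact (e ▸ Set.mem_univ b : b ∈ ({b}ᶜ : Set X)) rfl
  · rw [MonoidHom.map_closure, Set.image_image]
    congr 1
  · exact ⟨φ x, hle ⟨x, hx, rfl⟩, φ.symm_apply_apply x⟩

end XDigraph

/-! ### The immersion of a marked digraph onto a subdivided rose -/

namespace XDigraph

open FreeGroup

variable {X : Type u} {S T : XDigraph.{u, v} X}

theorem IsPath.exists_label_eq {x y : S.V} {w : List (X × Bool)} (h : S.IsPath x w y) :
    ∀ l ∈ w, ∃ e : S.E, S.label e = l.1 := by
  induction w generalizing x with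
  | nil => simp
  | cons m w ih =>
    obtain ⟨z, ⟨e, he, -⟩, h2⟩ := isPath_cons_iff.mp h
    intro l hl
    rcases List.mem_cons.mp hl with rfl | hl
    · exact ⟨e, he⟩
    · exact ih h2 l hl

theorem IsPath.spanned {Y : Set X} {x y : S.V} {w : List (X × Bool)} (h : S.IsPath x w y)
    (hw : ∀ l ∈ w, l.1 ∈ Y) (hx : ∃ e : S.E, S.label e ∈ Y ∧ (S.src e = x ∨ S.tgt e = x))
    (hy : ∃ e : S.E, S.label e ∈ Y ∧ (S.src e = y ∨ S.tgt e = y)) :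
    (S.spanned Y).IsPath ⟨x, hx⟩ w ⟨y, hy⟩ := by
  induction w generalizing x with
  | nil =>
    obtain rfl := isPath_nil_iff.mp h
    exact IsPath.nil _
  | cons l w ih =>
    obtain ⟨z, ⟨e, he, hends⟩, h2⟩ := isPath_cons_iff.mp h
    have hl : S.label e ∈ Y := he ▸ hw l List.mem_cons_self
    have hz : ∃ e : S.E, S.label e ∈ Y ∧ (S.src e = z ∨ S.tgt e = z) :=
      ⟨e, hl, by rcases hends with ⟨-, -, h⟩ | ⟨-, -, h⟩ <;> simp [h]⟩
    refine isPath_cons_iff.mpr ⟨⟨z, hz⟩, ⟨⟨e, hl⟩, he, ?_⟩,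
      ih h2 (fun m hm => hw m (List.mem_cons_of_mem _ hm)) hz⟩
    rcases hends with ⟨h1, h2, h3⟩ | ⟨h1, h2, h3⟩
    · exact Or.inl ⟨h1, Subtype.ext h2, Subtype.ext h3⟩
    · exact Or.inr ⟨h1, Subtype.ext h2, Subtype.ext h3⟩

variable [DecidableEq X]

/-- A marked digraph maps to every folded graph that reads the marked subgroup along loops. -/
theorem IsMarking.exists_hom [Finite S.V] {r : S.V → FreeGroup X} {K : Subgroup (FreeGroup X)}
    (h : S.IsMarking r K) (hfold : S.IsFolded) (hred : S.IsCyclicallyReduced) (hK : K ≠ ⊥)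
    (hT : T.IsFolded) {p : T.V} (hp : ∀ k ∈ K, T.IsPath p k.toWord p) :
    ∃ f : Hom S T, f.IsImmersion := by
  -- Two elements of the coset with different first letters give a reduced loop at `p`. The point
  -- reached after `k₂⁻¹` is the image of `x`; foldedness makes it work for the whole coset.
  have hV : ∀ x : S.V, ∃ t : T.V, ∀ k ∈ coset r K x, T.IsPath t k.toWord p := by
    intro x
    obtain ⟨l, y, hl⟩ := h.exists_step hK x
    obtain ⟨m, hm, z, hz⟩ := hfold.exists_step_ne (hred x) hl
    obtain ⟨k₁, hk₁, hk₁'⟩ := (h.infinite_coset_inter_cyl hfold hred hl).nonempty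
    obtain ⟨k₂, hk₂, hk₂'⟩ := (h.infinite_coset_inter_cyl hfold hred hz).nonempty
    rw [mem_coset] at hk₁ hk₂
    have h1 : k₂⁻¹ * k₁ ∈ K := by
      have := mul_mem (inv_mem hk₂) hk₁
      convert this using 1
      group
    have h2 := hp _ h1
    rw [toWord_mul_of_getLast] at h2
    · obtain ⟨t, -, ht⟩ := isPath_append_iff.mp h2
      refine ⟨t, fun k hk => ?_⟩
      rw [mem_coset] at hk
      have h3 : k₁⁻¹ * k ∈ K := by
        have := mul_mem (inv_mem hk₁) hk
        convert this using 1
        group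
      have := hT.isPath_mul ht (hp _ h3)
      rwa [mul_inv_cancel_left] at this
    · intro n hn hn'
      rw [toWord_inv, getLast?_invRev, Option.map_eq_some_iff] at hn
      obtain ⟨n', hn1, rfl⟩ := hn
      rw [bar_bar] at hn'
      have e1 := eq_of_mem_cyl (g := k₁) hn' hk₁'
      have e2 := eq_of_mem_cyl (g := k₂) hn1 hk₂'
      exact hm (e2.symm.trans e1)
  choose F hF using hV
  -- An element of the coset of the source that starts with the label of `e` must leave the image
  -- vertex along the required edge. Its remaining part leads to `p` and so identifies the end of
  -- that edge.
  have hE : ∀ e : S.E, ∃ e' : T.E, T.src e' = F (S.src e) ∧ T.tgt e' = F (S.tgt e) ∧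
      T.label e' = S.label e := by
    intro e
    obtain ⟨k, hk, hk'⟩ := (h.infinite_coset_inter_cyl hfold hred (step_edge S e)).nonempty
    have h1 := hF _ k hk
    have h2 : (of (S.label e))⁻¹ * k ∈ coset r K (S.tgt e) := by
      rw [mem_coset] at hk ⊢
      have := mul_mem (inv_mem (h.isPotential e)) hk
      convert this using 1
      group
    have h3 := hF _ _ h2
    have hw : k.toWord = (S.label e, true) :: ((of (S.label e))⁻¹ * k).toWord := by
      have : k = ltr (S.label e, true) * ((of (S.label e))⁻¹ * k) := by
        rw [ltr_true, mul_inv_cancel_left]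
      conv_lhs => rw [this]
      rw [toWord_ltr_mul]
      rw [← ltr_mul_mem_cyl_iff, ← this]
      exact hk'
    rw [hw] at h1
    obtain ⟨t, ⟨e', he', hends⟩, ht⟩ := isPath_cons_iff.mp h1
    rcases hends with ⟨-, h4, h5⟩ | ⟨h4, -⟩
    · refine ⟨e', h4, ?_, he'⟩
      rw [h5]
      have h6 := hT.isPath_mul ht (isPath_inv h3)
      rw [mul_inv_cancel, toWord_one] at h6
      exact isPath_nil_iff.mp h6
    · simp at h4
  choose FE hsrc htgt hlab using hE
  refine ⟨⟨F, FE, hsrc, htgt, hlab⟩, fun x => ⟨?_, ?_⟩⟩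
  · intro e he e' he' hee
    refine hfold.1 e e' (he.trans he'.symm) ?_
    rw [← hlab, ← hlab]
    exact congrArg T.label hee
  · intro e he e' he' hee
    refine hfold.2 e e' (he.trans he'.symm) ?_
    rw [← hlab, ← hlab]
    exact congrArg T.label hee

/-- Without edges labelled `a`, all loops at a vertex would read words in the other generators. -/
theorem IsMarking.exists_label_eq [Nonempty S.V] {r : S.V → FreeGroup X} {K : Subgroup (FreeGroup X)}
    (h : S.IsMarking r K) {a : X}
    (hK : ∀ c, ¬ K.map (MulAut.conj c).toMonoidHom ≤ Subgroup.closure (of '' {a}ᶜ)) :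
    ∃ e : S.E, S.label e = a := by
  by_contra! hno
  obtain ⟨x⟩ := ‹Nonempty S.V›
  refine hK (r x)⁻¹ ?_
  rintro _ ⟨k, hk : k ∈ K, rfl⟩
  change (r x)⁻¹ * k * (r x)⁻¹⁻¹ ∈ _
  rw [inv_inv, closure_eq_letterSubgroup]
  have h1 : S.IsPath x ((r x)⁻¹ * k * r x).toWord x := by
    rw [h]
    convert hk using 1
    group
  intro l hl
  obtain ⟨e, he⟩ := h1.exists_label_eq l hl
  exact fun e' => hno e (he.trans e')

/-! ### Covering the petals of the rose -/

section Rose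

variable {β : Type} {ws : β → List (X × Bool)}

/-- The two edges at an interior vertex of a petal. -/
theorem subdividedRose_edge_at {b : β} {i : ℕ} (h : 0 < i) (h' : i < (ws b).length)
    (e : (subdividedRose.{u, v} ws).E) :
    ((subdividedRose.{u, v} ws).src e = petalPoint ws b i ∨
      (subdividedRose.{u, v} ws).tgt e = petalPoint ws b i →
      e.down.1 = b ∧ ((e.down.2 : ℕ) = i ∨ (e.down.2 : ℕ) + 1 = i)) ∧
    ¬ ((subdividedRose.{u, v} ws).src e = petalPoint ws b i ∧
      (subdividedRose.{u, v} ws).tgt e = petalPoint ws b i) := by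
  obtain ⟨c, j, l, hl, rfl, rfl, -, he⟩ := subdividedRose_edge_ends ws e
  have key : ∀ k, petalPoint.{u, v} ws e.down.1 k = petalPoint ws b i → e.down.1 = b ∧ k = i :=
    fun k hk => by
      obtain ⟨h1, h2⟩ := petalPoint_eq_iff h h' hk.symm
      exact ⟨h1.symm, h2.symm⟩
  constructor
  · rintro (h1 | h1) <;> rcases he with ⟨-, h2, h3⟩ | ⟨-, h2, h3⟩
    · exact (key _ (h2.symm.trans h1)).imp_right Or.inl
    · exact (key _ (h3.symm.trans h1)).imp_right Or.inr
    · exact (key _ (h3.symm.trans h1)).imp_right Or.inr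
    · exact (key _ (h2.symm.trans h1)).imp_right Or.inl
  · rintro ⟨h1, h1'⟩
    rcases he with ⟨-, h2, h3⟩ | ⟨-, h2, h3⟩
    · have := (key _ (h2.symm.trans h1)).2
      have := (key _ (h3.symm.trans h1')).2
      omega
    · have := (key _ (h2.symm.trans h1')).2
      have := (key _ (h3.symm.trans h1)).2
      omega

theorem subdividedRose_ends (e : (subdividedRose.{u, v} ws).E) :
    ((subdividedRose.{u, v} ws).src e = petalPoint ws e.down.1 e.down.2 ∧
      (subdividedRose.{u, v} ws).tgt e = petalPoint ws e.down.1 (e.down.2 + 1)) ∨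
    ((subdividedRose.{u, v} ws).tgt e = petalPoint ws e.down.1 e.down.2 ∧
      (subdividedRose.{u, v} ws).src e = petalPoint ws e.down.1 (e.down.2 + 1)) := by
  obtain ⟨c, j, l, hl, rfl, rfl, -, ⟨-, h2, h3⟩ | ⟨-, h2, h3⟩⟩ := subdividedRose_edge_ends ws e
  · exact Or.inl ⟨h2, h3⟩
  · exact Or.inr ⟨h2, h3⟩

/-- A map from a graph without leaves that reaches one edge of a petal covers the petal. -/
theorem Hom.covers_petal (f : Hom S (subdividedRose.{u, v} ws)) (hfold : S.IsFolded)
    (hred : S.IsCyclicallyReduced) {b : β} {e₀ : S.E} (he₀ : (f.onE e₀).down.1 = b) (i : ℕ)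
    (hi : i < (ws b).length) :
    ∃ e, (f.onE e).down.1 = b ∧ ((f.onE e).down.2 : ℕ) = i := by
  -- An interior point of a petal meets just two edges. A vertex above it has two different
  -- directions, which map to different edges, so both are covered.
  have hint : ∀ (x : S.V) (l : X × Bool) (y : S.V) (i : ℕ), S.Step x l y → 0 < i → i < (ws b).length →
      f.onV x = petalPoint ws b i →
      (∃ e, (f.onE e).down.1 = b ∧ ((f.onE e).down.2 : ℕ) = i) ∧
      ∃ e, (f.onE e).down.1 = b ∧ ((f.onE e).down.2 : ℕ) + 1 = i := by
    intro x l y i hl h0 hi hx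
    obtain ⟨m, hm, z, hz⟩ := hfold.exists_step_ne (hred x) hl
    obtain ⟨e, he, hes⟩ := hl
    obtain ⟨e', he', hes'⟩ := hz
    have hs := f.src_onE e
    have ht := f.tgt_onE e
    have hs' := f.src_onE e'
    have ht' := f.tgt_onE e'
    have h1 : (subdividedRose.{u, v} ws).src (f.onE e) = petalPoint ws b i ∨
        (subdividedRose.{u, v} ws).tgt (f.onE e) = petalPoint ws b i := by
      rcases hes with ⟨-, h, -⟩ | ⟨-, h, -⟩
      · exact Or.inl (by rw [hs, h, hx])
      · exact Or.inr (by rw [ht, h, hx])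
    have h1' : (subdividedRose.{u, v} ws).src (f.onE e') = petalPoint ws b i ∨
        (subdividedRose.{u, v} ws).tgt (f.onE e') = petalPoint ws b i := by
      rcases hes' with ⟨-, h, -⟩ | ⟨-, h, -⟩
      · exact Or.inl (by rw [hs', h, hx])
      · exact Or.inr (by rw [ht', h, hx])
    have hne : f.onE e ≠ f.onE e' := by
      intro hee
      have hlab : l.1 = m.1 := by
        rw [← he, ← he', ← f.label_onE, ← f.label_onE, hee]
      refine (subdividedRose_edge_at h0 hi (f.onE e)).2 ?_
      have hlm : l.2 ≠ m.2 := fun h => hm (Prod.ext hlab.symm h.symm)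
      rcases hes with ⟨h2, h3, -⟩ | ⟨h2, h3, -⟩ <;> rcases hes' with ⟨h4, h5, -⟩ | ⟨h4, h5, -⟩
      · exact absurd (h2.trans h4.symm) hlm
      · exact ⟨by rw [hs, h3, hx], by rw [hee, ht', h5, hx]⟩
      · exact ⟨by rw [hee, hs', h5, hx], by rw [ht, h3, hx]⟩
      · exact absurd (h2.trans h4.symm) hlm
    obtain ⟨k1, k2⟩ := (subdividedRose_edge_at h0 hi (f.onE e)).1 h1
    obtain ⟨k3, k4⟩ := (subdividedRose_edge_at h0 hi (f.onE e')).1 h1'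
    have hdiff : ((f.onE e).down.2 : ℕ) ≠ (f.onE e').down.2 := by
      intro h
      refine hne (ULift.down_injective (Sigma.ext (k1.trans k3.symm) ?_))
      refine (Fin.heq_ext_iff ?_).mpr h
      rw [k1, k3]
    rcases k2 with k2 | k2 <;> rcases k4 with k4 | k4
    · omega
    · exact ⟨⟨e, k1, k2⟩, e', k3, k4⟩
    · exact ⟨⟨e', k3, k4⟩, e, k1, k2⟩
    · omega
  have hstep : ∀ e, (f.onE e).down.1 = b → ∀ k, (k = ((f.onE e).down.2 : ℕ) ∨ k = (f.onE e).down.2 + 1) →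
      ∃ x l y, S.Step x l y ∧ f.onV x = petalPoint ws b k := by
    intro e he k hk
    have hs := f.src_onE e
    have ht := f.tgt_onE e
    have : f.onV (S.src e) = petalPoint ws b k ∨ f.onV (S.tgt e) = petalPoint ws b k := by
      rw [← hs, ← ht]
      have hb : ∀ k, petalPoint.{u, v} ws (f.onE e).down.1 k = petalPoint ws b k := fun k => by rw [he]
      rcases subdividedRose_ends (f.onE e) with ⟨h1, h2⟩ | ⟨h1, h2⟩ <;> rcases hk with rfl | rfl
      · exact Or.inl (h1.trans (hb _))
      · exact Or.inr (h2.trans (hb _))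
      · exact Or.inr (h1.trans (hb _))
      · exact Or.inl (h2.trans (hb _))
    rcases this with h | h
    · exact ⟨_, _, _, step_edge S e, h⟩
    · exact ⟨_, _, _, (step_edge S e).bar, h⟩
  have hup : ∀ k, ((f.onE e₀).down.2 : ℕ) + k < (ws b).length →
      ∃ e, (f.onE e).down.1 = b ∧ ((f.onE e).down.2 : ℕ) = (f.onE e₀).down.2 + k := by
    intro k
    induction k with
    | zero => exact fun _ => ⟨e₀, he₀, rfl⟩
    | succ k ih =>
      intro hk
      obtain ⟨e, he, hek⟩ := ih (by omega)
      obtain ⟨x, l, y, hl, hx⟩ := hstep e he _ (Or.inr rfl)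
      rw [hek] at hx
      exact (hint x l y _ hl (Nat.succ_pos _) hk hx).1
  have hdown : ∀ k, k ≤ ((f.onE e₀).down.2 : ℕ) →
      ∃ e, (f.onE e).down.1 = b ∧ ((f.onE e).down.2 : ℕ) + k = (f.onE e₀).down.2 := by
    intro k
    induction k with
    | zero => exact fun _ => ⟨e₀, he₀, rfl⟩
    | succ k ih =>
      intro hk
      obtain ⟨e, he, hek⟩ := ih (by omega)
      obtain ⟨x, l, y, hl, hx⟩ := hstep e he _ (Or.inl rfl)
      have hlt : ((f.onE e).down.2 : ℕ) < (ws b).length := he ▸ (f.onE e).down.2.2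
      obtain ⟨e', he', hek'⟩ := (hint x l y _ hl (by omega) hlt hx).2
      exact ⟨e', he', by omega⟩
  rcases le_total ((f.onE e₀).down.2 : ℕ) i with hle | hle
  · obtain ⟨k, rfl⟩ := Nat.exists_eq_add_of_le hle
    exact hup k hi
  · obtain ⟨k, hk⟩ := Nat.exists_eq_add_of_le hle
    obtain ⟨e, he, hek⟩ := hdown k (by omega)
    exact ⟨e, he, by omega⟩

theorem exists_petalPoint_eq [Nonempty β] (hne : ∀ b, ws b ≠ []) (t : (subdividedRose.{u, v} ws).V) :
    ∃ (b : β) (i : ℕ), i < (ws b).length ∧ t = petalPoint ws b i := by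
  obtain ⟨_ | ⟨⟨b, i⟩, h⟩⟩ := t
  · exact ⟨Classical.arbitrary β, 0, List.length_pos_iff.mpr (hne _), (petalPoint_zero _ _).symm⟩
  · exact ⟨b, i, h.2, by rw [petalPoint, dif_pos h]⟩

end Rose

end XDigraph

/-! ### Property (S) of the rose with one adjoined petal -/

namespace XDigraph

open FreeGroup

variable {X : Type u} {S : XDigraph.{u, v} X} [DecidableEq X] {κ : Type} {f : κ → X} {w : List (X × Bool)}

theorem label_augment_some {e : (subdividedRose.{u, v} (augment f w)).E} {j : κ}
    (h : e.down.1 = some j) :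
    (subdividedRose.{u, v} (augment f w)).label e = f j ∧ (e.down.2 : ℕ) = 0 := by
  obtain ⟨⟨b, i⟩⟩ := e
  obtain rfl : b = some j := h
  have h1 : (augment f w (some j)).length = 1 := rfl
  obtain rfl : i = ⟨0, Nat.zero_lt_one⟩ := Fin.ext (by have := i.2; simp only; omega)
  exact ⟨rfl, rfl⟩

theorem label_augment_none {e : (subdividedRose.{u, v} (augment f w)).E} (h : e.down.1 = none)
    (hw : ∀ l ∈ w, l.1 ∉ Set.range f) :
    (subdividedRose.{u, v} (augment f w)).label e ∉ Set.range f := by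
  obtain ⟨⟨b, i⟩⟩ := e
  obtain rfl : b = none := h
  exact hw _ (List.get_mem _ _)

theorem down_fst_eq_some (hf : Function.Injective f) (hw : ∀ l ∈ w, l.1 ∉ Set.range f)
    {e : (subdividedRose.{u, v} (augment f w)).E} {j : κ}
    (h : (subdividedRose.{u, v} (augment f w)).label e = f j) : e.down.1 = some j := by
  cases hb : e.down.1 with
  | none => exact absurd ⟨j, h.symm⟩ (label_augment_none hb hw)
  | some i => rw [hf ((label_augment_some hb).1.symm.trans h)]

theorem down_fst_eq_none {e : (subdividedRose.{u, v} (augment f w)).E}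
    (h : (subdividedRose.{u, v} (augment f w)).label e ∉ Set.range f) : e.down.1 = none := by
  cases hb : e.down.1 with
  | none => rfl
  | some i => exact absurd ⟨i, (label_augment_some hb).1.symm⟩ h

theorem subdividedRose_E_ext {β : Type} {ws : β → List (X × Bool)} {e e' : (subdividedRose.{u, v} ws).E}
    (h : e.down.1 = e'.down.1) (h' : (e.down.2 : ℕ) = e'.down.2) : e = e' := by
  obtain ⟨⟨b, i⟩⟩ := e
  obtain ⟨⟨c, j⟩⟩ := e'
  obtain rfl : b = c := h
  obtain rfl : i = j := Fin.ext h'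
  rfl

/-- A label `f j` occurs only on its own petal, and a label outside the range only on the additional
petal. Hence every petal is reached, and then covered entirely. -/
theorem Hom.surjective_augment (g : Hom S (subdividedRose.{u, v} (augment f w))) (hfold : S.IsFolded)
    (hred : S.IsCyclicallyReduced) (hf : Function.Injective f) (hw : IsComplementaryWord f w)
    (hB : ∃ b, b ∉ Set.range f) (hlab : ∀ a, ∃ e : S.E, S.label e = a) :
    Function.Surjective g.onV ∧ Function.Surjective g.onE := by
  have hE : ∀ (b : Option κ) (i : ℕ), i < (augment f w b).length →
      ∃ e, (g.onE e).down.1 = b ∧ ((g.onE e).down.2 : ℕ) = i := by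
    intro b i hi
    obtain ⟨e₀, he₀⟩ : ∃ e₀, (g.onE e₀).down.1 = b := by
      rcases b with _ | j
      · obtain ⟨b, hb⟩ := hB
        obtain ⟨e, he⟩ := hlab b
        refine ⟨e, down_fst_eq_none ?_⟩
        rwa [g.label_onE, he]
      · obtain ⟨e, he⟩ := hlab (f j)
        refine ⟨e, down_fst_eq_some hf hw.notMem_range ?_⟩
        rw [g.label_onE, he]
    exact g.covers_petal hfold hred he₀ i hi
  constructor
  · intro t
    obtain ⟨b, i, hi, rfl⟩ := exists_petalPoint_eq (hw.isBlowup hf).ne_nil t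
    obtain ⟨e, he, hei⟩ := hE b i hi
    have hs := g.src_onE e
    have ht := g.tgt_onE e
    have hb : petalPoint.{u, v} (augment f w) (g.onE e).down.1 (g.onE e).down.2 =
        petalPoint (augment f w) b i := by rw [hei, he]
    rcases subdividedRose_ends (g.onE e) with ⟨h1, -⟩ | ⟨h1, -⟩
    · exact ⟨S.src e, hs.symm.trans (h1.trans hb)⟩
    · exact ⟨S.tgt e, ht.symm.trans (h1.trans hb)⟩
  · intro e'
    obtain ⟨e, he, hei⟩ := hE e'.down.1 e'.down.2 e'.down.2.2
    exact ⟨e, subdividedRose_E_ext he hei⟩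

theorem Hom.isCyclicallyReduced_of_surjective {T : XDigraph.{u, v} X} (g : Hom S T)
    (hV : Function.Surjective g.onV) (hfold : S.IsFolded) (hred : S.IsCyclicallyReduced)
    (hstep : ∀ x : S.V, ∃ l y, S.Step x l y) : T.IsCyclicallyReduced := by
  intro t ht
  obtain ⟨x, rfl⟩ := hV t
  obtain ⟨l, y, hl⟩ := hstep x
  obtain ⟨m, hm, z, hz⟩ := hfold.exists_step_ne (hred x) hl
  exact hm (ht.step_unique (g.step hz) (g.step hl))

theorem Hom.isConnected_of_surjective {T : XDigraph.{u, v} X} (g : Hom S T)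
    (hV : Function.Surjective g.onV) (hS : S.IsConnected) : T.IsConnected := by
  intro s t
  obtain ⟨x, rfl⟩ := hV s
  obtain ⟨y, rfl⟩ := hV t
  obtain ⟨w, hw⟩ := hS x y
  exact ⟨w, g.isPath hw⟩

theorem isBouquet_spanned_range [Nonempty κ] (hf : Function.Injective f) (hw : IsComplementaryWord f w) :
    ((subdividedRose.{u, v} (augment f w)).spanned (Set.range f)).IsBouquet := by
  have hbase : ∀ e : (subdividedRose.{u, v} (augment f w)).E,
      (subdividedRose.{u, v} (augment f w)).label e ∈ Set.range f →
      (subdividedRose.{u, v} (augment f w)).src e = roseBase _ ∧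
      (subdividedRose.{u, v} (augment f w)).tgt e = roseBase _ := by
    rintro e ⟨j, hj⟩
    have he := down_fst_eq_some hf hw.notMem_range hj.symm
    have hi := (label_augment_some he).2
    have h0 : petalPoint.{u, v} (augment f w) e.down.1 e.down.2 = roseBase _ := by
      rw [hi, petalPoint_zero]
    have h1 : petalPoint.{u, v} (augment f w) e.down.1 (e.down.2 + 1) = roseBase _ := by
      rw [hi, he]
      exact petalPoint_length (augment f w) (some j)
    rcases subdividedRose_ends e with ⟨h2, h3⟩ | ⟨h2, h3⟩
    · exact ⟨h2.trans h0, h3.trans h1⟩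
    · exact ⟨h3.trans h1, h2.trans h0⟩
  constructor
  · let j : κ := Classical.arbitrary κ
    let e : (subdividedRose.{u, v} (augment f w)).E := ⟨⟨some j, ⟨0, Nat.zero_lt_one⟩⟩⟩
    exact ⟨⟨_, e, ⟨j, rfl⟩, Or.inl rfl⟩⟩
  · refine ⟨fun x y => Subtype.ext ?_⟩
    have : ∀ x : ((subdividedRose.{u, v} (augment f w)).spanned (Set.range f)).V, x.1 = roseBase _ := by
      rintro ⟨x, e, he, rfl | rfl⟩
      · exact (hbase e he).1
      · exact (hbase e he).2
    rw [this x, this y]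

/-- These edges form a circle: its edges and its vertices are both indexed by the positions in `w`.
-/
theorem isRankOne_spanned_compl (hw : IsComplementaryWord f w) :
    ((subdividedRose.{u, v} (augment f w)).spanned (Set.range f)ᶜ).IsRankOne := by
  set R := subdividedRose.{u, v} (augment f w) with hR
  have hpos : 0 < w.length := List.length_pos_iff.mpr hw.ne_nil
  let edge : Fin w.length → R.E := fun i => ⟨⟨none, i⟩⟩
  have hedge : ∀ i, R.label (edge i) ∈ (Set.range f)ᶜ := fun i =>
    label_augment_none (e := edge i) rfl hw.notMem_range
  have hsurj : ∀ e : R.E, R.label e ∈ (Set.range f)ᶜ → ∃ i, edge i = e := by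
    intro e he
    have hn := down_fst_eq_none he
    obtain ⟨⟨b, i⟩⟩ := e
    obtain rfl : b = none := hn
    exact ⟨i, rfl⟩
  have hinc : ∀ i : Fin w.length, ∃ e : R.E, R.label e ∈ (Set.range f)ᶜ ∧
      (R.src e = petalPoint (augment f w) none i ∨ R.tgt e = petalPoint (augment f w) none i) :=
    fun i => ⟨edge i, hedge i, (subdividedRose_ends (edge i)).imp And.left And.left⟩
  let vert : Fin w.length → (R.spanned (Set.range f)ᶜ).V := fun i =>
    ⟨petalPoint (augment f w) none i, hinc i⟩
  have hvsurj : Function.Surjective vert := by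
    have hpt : ∀ (x : R.V) (hx : ∃ e : R.E, R.label e ∈ (Set.range f)ᶜ ∧ (R.src e = x ∨ R.tgt e = x))
        (k : ℕ), k ≤ w.length → x = petalPoint (augment f w) none k → ∃ i, vert i = ⟨x, hx⟩ := by
      intro x hx k hk hxk
      rcases hk.lt_or_eq with hlt | rfl
      · exact ⟨⟨k, hlt⟩, Subtype.ext hxk.symm⟩
      -- The position after the last letter is the base again.
      · refine ⟨⟨0, hpos⟩, Subtype.ext ?_⟩
        exact ((petalPoint_zero (augment f w) none).trans (petalPoint_length (augment f w) none).symm).trans hxk.symm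
    rintro ⟨x, e, he, hx⟩
    obtain ⟨i, rfl⟩ := hsurj e he
    rcases subdividedRose_ends (edge i) with ⟨h1, h2⟩ | ⟨h1, h2⟩ <;> rcases hx with hx | hx
    · exact hpt x _ i i.2.le (hx.symm.trans h1)
    · exact hpt x _ (i + 1) i.2 (hx.symm.trans h2)
    · exact hpt x _ (i + 1) i.2 (hx.symm.trans h2)
    · exact hpt x _ i i.2.le (hx.symm.trans h1)
  have hvinj : Function.Injective vert := by
    intro i j hij
    have h : petalPoint.{u, v} (augment f w) none i = petalPoint (augment f w) none j :=
      congrArg Subtype.val hij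
    rcases Nat.eq_zero_or_pos (i : ℕ) with hi | hi
    · rcases Nat.eq_zero_or_pos (j : ℕ) with hj | hj
      · exact Fin.ext (hi.trans hj.symm)
      · exact Fin.ext (petalPoint_eq_iff (ws := augment f w) (b := none) hj j.2 h.symm).2.symm
    · exact Fin.ext (petalPoint_eq_iff (ws := augment f w) (b := none) hi i.2 h).2
  let edge' : Fin w.length → (R.spanned (Set.range f)ᶜ).E := fun i => ⟨edge i, hedge i⟩
  have hesurj : Function.Surjective edge' := fun e => by
    obtain ⟨i, hi⟩ := hsurj e.1 e.2
    exact ⟨i, Subtype.ext hi⟩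
  have heinj : Function.Injective edge' := fun i j hij => by
    have h : edge i = edge j := congrArg Subtype.val hij
    have h' := congrArg (fun e : R.E => (e.down.2 : ℕ)) h
    exact Fin.ext h'
  refine ⟨Finite.of_surjective _ hvsurj, Finite.of_surjective _ hesurj, ⟨vert ⟨0, hpos⟩⟩, ?_, ?_⟩
  · intro x y
    obtain ⟨i, rfl⟩ := hvsurj x
    obtain ⟨j, rfl⟩ := hvsurj y
    have hi := subdividedRose_isPath_take.{u, v} (augment f w) none i i.2.le
    have hj := subdividedRose_isPath_take.{u, v} (augment f w) none j j.2.le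
    refine ⟨_, (hi.invRev.append hj).spanned (fun l hl => ?_) _ _⟩
    rcases List.mem_append.mp hl with hl | hl
    · simp only [invRev, List.mem_reverse, List.mem_map] at hl
      obtain ⟨m, hm, rfl⟩ := hl
      exact hw.notMem_range m (List.mem_of_mem_take hm)
    · exact hw.notMem_range l (List.mem_of_mem_take hl)
  · rw [← Nat.card_eq_of_bijective _ ⟨hvinj, hvsurj⟩, ← Nat.card_eq_of_bijective _ ⟨heinj, hesurj⟩]

end XDigraph

open XDigraph FreeGroup in
theorem mainTheorem3 {X : Type u} [Fintype X] [DecidableEq X] (hX : 3 ≤ Fintype.card X)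
    (S : XDigraph.{u, v} X) [Finite S.V] [Finite S.E]
    (hconn : S.IsConnected) (hfold : S.IsFolded) (hred : S.IsCyclicallyReduced)
    (H : Subgroup (FreeGroup X)) (hH : S.Represents H)
    (hfactor : ∀ K : Subgroup (FreeGroup X), IsProperFreeFactor K → ¬ H ≤ K)
    (A B : Set X)
    (himm : ∃ T : XDigraph.{u, v} X, T.PropertyS A B ∧ S.ImmersesOnto T)
    (hmin : ¬ S.IsMinimal) :
    ∃ S' ∈ S.minSet, ∃ T' : XDigraph.{u, v} X, T'.PropertyS A B ∧ S'.ImmersesOnto T' := by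
  have hfree := not_map_le_of_not_le_properFreeFactor hfactor
  have hne : Nonempty S.V := ⟨hH.choose⟩
  obtain ⟨r, hr⟩ := exists_isMarking_of_represents hconn hfold hH
  obtain ⟨T, hT, q, -⟩ := himm
  -- the basis elements of the bouquet
  obtain ⟨n, f, hf, rfl⟩ : ∃ (n : ℕ) (f : Fin n → X), Function.Injective f ∧ Set.range f = A :=
    ⟨Nat.card A, fun i => ((Finite.equivFin A).symm i).1,
      Subtype.val_injective.comp (Equiv.injective _), by
        rw [Set.range_comp', (Equiv.range_eq_univ _), Set.image_univ, Subtype.range_coe]⟩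
  obtain rfl : (Set.range f)ᶜ = B := hT.isCompl.compl_eq
  have hκ : Nonempty (Fin n) := by
    obtain ⟨⟨⟨-, e, ⟨j, -⟩, -⟩⟩, -⟩ := hT.bouquet
    exact ⟨j⟩
  have hB : ∃ b, b ∉ Set.range f := by
    obtain ⟨-, -, ⟨⟨-, e, he, -⟩⟩, -⟩ := hT.rankOne
    exact ⟨_, he⟩
  -- a position in which the subgroup is generated by part of the basis and one further word
  obtain ⟨η, g, hg, hη⟩ := hT.exists_isPotential
  obtain ⟨c, hc⟩ := hr.exists_map_conj_le q hη
  -- Otherwise a conjugate of `H` would lie in the factor generated by `A`, which is proper because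
  -- `B` is not empty.
  have hg1 : g ≠ 1 := by
    rintro rfl
    obtain ⟨b, hb⟩ := hB
    refine hfree (MulAut.conj c) b (hc.trans ((Subgroup.closure_le _).mpr ?_))
    rintro _ (⟨a, ha, rfl⟩ | rfl)
    · exact Subgroup.subset_closure ⟨a, fun e => hb (e ▸ ha), rfl⟩
    · exact one_mem _
  obtain ⟨w₀, φ₀, hw₀, h₀⟩ := exists_isComplementaryWord_map_le hg hg1 hc
  have hfin : ∀ φ : FreeGroup X ≃* FreeGroup X, totalSplit (H.map φ.toMonoidHom) ≠ ⊤ := by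
    intro φ
    obtain ⟨T, hT, -⟩ := hr.exists_isImage φ
    rw [← hr.card_image_eq hT]
    exact ENat.natCast_ne_top _
  obtain ⟨φ, w, hw, hle, hφ⟩ := exists_minimal_le_range_augment hf hB hfin hfree hw₀ h₀
  -- the minimal image and its immersion
  obtain ⟨S', hS', hV, hE, hne', hfold', hred', r', hr'⟩ := hr.exists_isImage φ
  have hK : H.map φ.toMonoidHom ≠ ⊥ := by
    obtain ⟨b, hb⟩ := hB
    intro h
    exact hfree φ b (h ▸ bot_le)
  have hp : ∀ k ∈ H.map φ.toMonoidHom, (subdividedRose.{u, v} (augment f w)).IsPath (roseBase _)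
      k.toWord (roseBase _) := by
    intro k hk
    obtain ⟨x, rfl⟩ := hle hk
    exact subdividedRose_isPath_blowup (hw.isBlowup hf) x
  obtain ⟨F, hF⟩ := hr'.exists_hom hfold' hred' hK (subdividedRose_isFolded (hw.isBlowup hf)) hp
  have hlab : ∀ a, ∃ e : S'.E, S'.label e = a := fun a => hr'.exists_label_eq fun c => by
    rw [← map_trans_toMonoidHom]
    exact hfree _ a
  obtain ⟨hFV, hFE⟩ := F.surjective_augment hfold' hred' hf hw hB hlab
  refine ⟨S', ⟨⟨φ, hS'⟩, fun ψ T' hT' => ?_⟩, subdividedRose.{u, v} (augment f w),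
    ⟨F.isConnected_of_surjective hFV hr'.isConnected,
      F.isCyclicallyReduced_of_surjective hFV hfold' hred' (hr'.exists_step hK), hT.isCompl,
      isBouquet_spanned_range hf hw, isRankOne_spanned_compl hw⟩, F, hF, hFV, hFE⟩
  -- An image of `S'` under `ψ` is compared with the position of `H` under the composite of `φ` and
  -- `ψ`, since both have the same number of edges.
  have h1 := hr'.card_image_eq hT'
  have h2 := hr.card_image_eq hS'
  rw [← map_trans_toMonoidHom] at h1
  have h3 := hφ (φ.trans ψ)
  rw [← h1, ← h2] at h3
  exact_mod_cast h3
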